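/- **Setting.** Let $X$ be a countable set with a measure $m$ such that $0<m(x)<\infty$ for all $x\in X$, and let $(b,c)$ be a connected graph over $X$: $b\colon X\times X\to[0,\infty)$ is symmetric with zero diagonal and $\sum_y b(x,y)<\infty$ for all $x$, $c\colon X\to[0,\infty)$, and any two points of $X$ are joined by a finite path along which $b>0$. Put $\mathcal Q(f)=\frac12\sum_{x,y}b(x,y)(f(x)-f(y))^2+\sum_x c(x)f(x)^2\in[0,\infty]$ and $\mathcal L f(x)=\frac1{m(x)}\sum_y b(x,y)(f(x)-f(y))+\frac{c(x)}{m(x)}f(x)$. A form $q$ on a real Hilbert space is a symmetric positive bilinear form on a subspace $D(q)$, identified with its quadratic functional ($q(f)=\infty$ for $f\notin D(q)$); $q\le q'$ is meant pointwise, $q_1:=q+\|\cdot\|^2$, and $q$ is closed if $D(q)$ is complete for the norm $q_1^{1/2}$. A form on an $L^2$-space is Markovian if $q(C\circ f)\le q(f)$ for all $f\in L^2$ and all normal contractions $C$ ($C(0)=0$, $|C(u)-C(w)|\le|u-w|$). A Dirichlet form in the wide sense is a closed Markovian form; a Dirichlet form is in addition densely defined. $Q^{(N)}$ is the restriction of $\mathcal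 Q$ to $D(Q^{(N)})=\{f\in\ell^2(X,m):\mathcal Q(f)<\infty\}$, and $Q^{(D)}$ is its restriction to the closure of the finitely supported functions with respect to the norm $(Q^{(N)}_1)^{1/2}$. Let $\hat X$ be the compact Hausdorff space, unique up to homeomorphism, that contains $X$ as a dense set of isolated points and to which all $f\in D(Q^{(N)})\cap\ell^\infty(X)$ extend continuously, such that these extensions separate the points of $\hat X$. Let $\partial X=\{z\in\hat X\setminus X: f(z)=0\text{ for all }f\in D(Q^{(D)})\cap\ell^\infty(X)\}$. Every $f\in D(Q^{(N)})$ extends uniquely to a continuous function $\hat X\to[-\infty,\infty]$; its restriction to $\partial X$ is the trace $\gamma f$. For $\varphi\in\operatorname{ran}\gamma$, $H\varphi$ is the unique $u\in D(Q^{(N)})$ with $(\mathcal L+1)u=0$ on $X$ and $\gamma u=\varphi$. Fix $o\in X$ and let $\mu$ be the $1$-harmonic measure at $o$: the unique Radon measure on $\partial X$ with $\mu(\partial X)\le1$ and $H(\gamma f)(o)=\int_{\partial X}\gamma f\,d\mu$ for all $f\in D(Q^{(N)})\cap\ell^\infty(X)$, and with $\mu(\{z\})=0$ for every $z \in \partial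 X$ at which all such $\gamma f$ vanish (there is at most one such $z$). Write $L^2(\partial X)=L^2(\partial X,\mu)$. Each $\gamma f$, $f\in D(Q^{(N)})$, is finite $\mu$-almost everywhere and defines an element of $L^2(\partial X)$. For a Dirichlet form $Q$ on $\ell^2(X,m)$ with $Q^{(N)}\le Q\le Q^{(D)}$, the trace form on $L^2(\partial X)$ is given by $D(\operatorname{Tr}Q)=\gamma D(Q)$ and $\operatorname{Tr}Q(\varphi)=Q_1(H\varphi)$. Let $q^{DN}=\operatorname{Tr}Q^{(N)}$. **Proposition (Traces of Dirichlet forms).** For every Dirichlet form $Q$ on $\ell^2(X,m)$ with $Q^{(N)}\le Q\le Q^{(D)}$: 1. $\operatorname{Tr}Q$ is well defined on $L^2(\partial X)$: $\mu$ exists, $\gamma f\in L^2(\partial X)$ and $H(\gamma f)$ exists uniquely for every $f\in D(Q^{(N)})$, and for every $f\in D(Q)$ one has $H(\gamma f)\in D(Q)$, and $\operatorname{Tr}Q(\varphi)=Q_1(H(\gamma f))$ whenever $\varphi=\gamma f$ $\mu$-almost everywhere. 2. $\operatorname{Tr}Q$ is a Dirichlet form in the wide sense on $L^2(\partial X)$.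 3. $q^{DN}\le\operatorname{Tr}Q$, and $\operatorname{Tr}Q-q^{DN}$, considered as a quadratic form with domain $D(\operatorname{Tr}Q)$, is a Markovian form. 4. $D(Q)=\{f\in D(Q^{(N)}):\gamma f\in D(\operatorname{Tr}Q)\}$. -/

import Mathlib

open MeasureTheory Filter Topology
open scoped ENNReal

noncomputable section

/-! ### Quadratic forms on Hilbert spaces and on `L²`-spaces

A symmetric positive form with domain `D(q)` is represented by its quadratic functional
`q : H → [0, ∞]`, with `q f = ∞` for `f ∉ D(q)`. In this way `D(q) = {f | q f < ∞}`, the bilinear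
form is recovered by polarization, and `q ≤ q'` is the pointwise order. -/

section Forms

variable {H : Type*} [NormedAddCommGroup H] [InnerProductSpace ℝ H]

/-- `q` is the quadratic functional of a symmetric positive bilinear form defined on a subspace. -/
def IsForm (q : H → ℝ≥0∞) : Prop :=
  ∃ (D : Submodule ℝ H) (B : LinearMap.BilinForm ℝ D),
    (∀ f g : D, B f g = B g f) ∧ (∀ f : D, 0 ≤ B f f) ∧
    (∀ f : D, q f = ENNReal.ofReal (B f f)) ∧ ∀ f : H, f ∉ D → q f = ∞

/-- `q₁ f = q f + ‖f‖²`, the square of the form norm of `f`. -/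
def formOne (q : H → ℝ≥0∞) (f : H) : ℝ≥0∞ := q f + ‖f‖ₑ ^ 2

/-- The domain of `q` is complete with respect to the form norm. -/
def IsClosedForm (q : H → ℝ≥0∞) : Prop :=
  ∀ u : ℕ → H, (∀ n, q (u n) < ∞) →
    (∀ ε : ℝ≥0∞, 0 < ε → ∃ N, ∀ k ≥ N, ∀ n ≥ N, formOne q (u k - u n) < ε) →
    ∃ v : H, q v < ∞ ∧ Tendsto (fun n => formOne q (u n - v)) atTop (𝓝 0)

end Forms

section DirichletForms

variable {Ω : Type*} [MeasurableSpace Ω] {ν : Measure Ω}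

/-- Compatibility with all normal contractions, that is, with all `C : ℝ → ℝ` such that
`C 0 = 0` and `|C u - C w| ≤ |u - w|`; `hC.compLp h0 f` is the class of `C ∘ f`. -/
def IsMarkovian (q : Lp ℝ 2 ν → ℝ≥0∞) : Prop :=
  ∀ (C : ℝ → ℝ) (hC : LipschitzWith 1 C) (h0 : C 0 = 0) (f : Lp ℝ 2 ν),
    q (hC.compLp h0 f) ≤ q f

/-- Dirichlet form in the wide sense: a closed Markovian form, not necessarily densely defined. -/
structure IsWideDirichletForm (q : Lp ℝ 2 ν → ℝ≥0∞) : Prop where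
  isForm : IsForm q
  closed : IsClosedForm q
  markovian : IsMarkovian q

/-- Dirichlet form: a densely defined closed Markovian form. -/
structure IsDirichletForm (q : Lp ℝ 2 ν → ℝ≥0∞) : Prop extends IsWideDirichletForm q where
  dense : Dense {f : Lp ℝ 2 ν | q f < ∞}

end DirichletForms

/-- The difference `p - q` on the domain of `p`. It is used only where `q ≤ p`, so that the
subtraction in `[0, ∞]` is the usual one on the domain of `p`. -/
def formDiff {H : Type*} (p q : H → ℝ≥0∞) (f : H) : ℝ≥0∞ :=
  open Classical in if p f < ∞ then p f - q f else ∞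

/-! ### Graphs -/

/-- A graph `(b, c)` over `X` with edge weight `b` and killing term `c`. -/
structure WeightedGraph (X : Type*) where
  b : X → X → ℝ
  c : X → ℝ
  b_nonneg : ∀ x y, 0 ≤ b x y
  b_symm : ∀ x y, b x y = b y x
  b_diag : ∀ x, b x x = 0
  b_summable : ∀ x, Summable (b x)
  c_nonneg : ∀ x, 0 ≤ c x

namespace WeightedGraph

variable {X : Type*} (G : WeightedGraph X)

/-- Any two vertices are joined by a finite path. -/
def Connected : Prop := ∀ x y, Relation.ReflTransGen (fun u v => 0 < G.b u v) x y

/-- The energy form on all functions `X → ℝ`, with values in `[0, ∞]`. -/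
def energy (f : X → ℝ) : ℝ≥0∞ :=
  2⁻¹ * (∑' x, ∑' y, ENNReal.ofReal (G.b x y * (f x - f y) ^ 2))
    + ∑' x, ENNReal.ofReal (G.c x * f x ^ 2)

/-- Characteristic functions of vertices have finite energy. -/
lemma energy_indicator_lt_top (x : X) :
    G.energy (Set.indicator {x} fun _ => (1 : ℝ)) < ∞ := by
  classical
  have hs : ∀ u, (∑' v, ENNReal.ofReal (G.b u v)) < ∞ := fun u => by
    rw [← ENNReal.ofReal_tsum_of_nonneg (G.b_nonneg u) (G.b_summable u)]
    exact ENNReal.ofReal_lt_top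
  have hb : ∀ u v, ENNReal.ofReal (G.b u v * ((Set.indicator {x} fun _ => (1 : ℝ)) u
      - (Set.indicator {x} fun _ => (1 : ℝ)) v) ^ 2)
      ≤ (if u = x then ENNReal.ofReal (G.b x v) else 0)
        + (if v = x then ENNReal.ofReal (G.b x u) else 0) := by
    intro u v
    by_cases hu : u = x <;> by_cases hv : v = x
    · simp [hu, hv]
    · simp [hu, hv]
    · simp [hu, hv, G.b_symm u x]
    · simp [hu, hv]
  have h1 : (∑' u, ∑' v, ENNReal.ofReal (G.b u v * ((Set.indicator {x} fun _ => (1 : ℝ)) u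
      - (Set.indicator {x} fun _ => (1 : ℝ)) v) ^ 2)) < ∞ := by
    refine lt_of_le_of_lt (ENNReal.tsum_le_tsum fun u => ENNReal.tsum_le_tsum (hb u)) ?_
    simp only [ENNReal.tsum_add, tsum_ite_eq]
    refine ENNReal.add_lt_top.2 ⟨?_, hs x⟩
    rw [tsum_eq_single x]
    · simpa using hs x
    · intro u hu
      simp [hu]
  have h2 : (∑' u, ENNReal.ofReal (G.c u * (Set.indicator {x} fun _ => (1 : ℝ)) u ^ 2)) < ∞ := by
    rw [tsum_eq_single x]
    · exact ENNReal.ofReal_lt_top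
    · intro u hu
      simp [hu]
  exact ENNReal.add_lt_top.2 ⟨ENNReal.mul_lt_top (by simp) h1, h2⟩

variable [MeasurableSpace X] (m : Measure X)

/-- The formal Laplacian. -/
def laplacian (f : X → ℝ) (x : X) : ℝ :=
  (m.real {x})⁻¹ * (∑' y, G.b x y * (f x - f y)) + G.c x / m.real {x} * f x

/-- `f` is in the domain of the formal Laplacian `𝓛` and `(𝓛 + 1) f = 0`. -/
def IsOneHarmonic (f : X → ℝ) : Prop :=
  (∀ x, Summable fun y => G.b x y * |f y|) ∧ ∀ x, G.laplacian m f x + f x = 0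

/-- `D(Q⁽ᴺ⁾)`: functions of finite energy in `ℓ²(X, m)`. -/
def neumannDomain : Set (X → ℝ) := {f | G.energy f < ∞ ∧ MemLp f 2 m}

/-- `D(Q⁽ᴰ⁾)`: the closure of the finitely supported functions in `D(Q⁽ᴺ⁾)` with respect to
the form norm. -/
def dirichletDomain : Set (X → ℝ) :=
  {f | f ∈ G.neumannDomain m ∧ ∃ g : ℕ → X → ℝ, (∀ n, (Function.support (g n)).Finite) ∧
    Tendsto (fun n => G.energy (f - g n) + eLpNorm (f - g n) 2 m ^ 2) atTop (𝓝 0)}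

/-- The Neumann form `Q⁽ᴺ⁾` on `ℓ²(X, m)`. -/
def neumannForm (f : Lp ℝ 2 m) : ℝ≥0∞ := G.energy f

/-- The Dirichlet form `Q⁽ᴰ⁾` on `ℓ²(X, m)`. -/
def dirichletForm (f : Lp ℝ 2 m) : ℝ≥0∞ :=
  open Classical in if (f : X → ℝ) ∈ G.dirichletDomain m then G.energy f else ∞

/-! ### The compactification `X̂`, the `1`-harmonic boundary and the trace map -/

/-- `D(Q⁽ᴺ⁾) ∩ ℓ^∞(X)`. -/
def BoundedNeumann : Type _ :=
  {f : X → ℝ // f ∈ G.neumannDomain m ∧ ∃ M : ℝ, ∀ x, |f x| ≤ M}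

/-- Evaluation of the functions in `D(Q⁽ᴺ⁾) ∩ ℓ^∞(X)` at a vertex. -/
def evalAt (x : X) : G.BoundedNeumann m → ℝ := fun f => f.1 x

/-- The Royden compactification `X̂`: the closure of the image of `X` in the product of copies of
`ℝ` indexed by `D(Q⁽ᴺ⁾) ∩ ℓ^∞(X)`. See `roydenCompactification_spec` for the properties that
characterize it up to homeomorphism. -/
def RoydenCompactification : Type _ := {z // z ∈ closure (Set.range (G.evalAt m))}

instance : TopologicalSpace (G.RoydenCompactification m) :=
  inferInstanceAs (TopologicalSpace {z // z ∈ closure (Set.range (G.evalAt m))})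

/-- The embedding of `X` into `X̂`. -/
def toRoyden (x : X) : G.RoydenCompactification m :=
  ⟨G.evalAt m x, subset_closure ⟨x, rfl⟩⟩

/-- The continuous extension of `f ∈ D(Q⁽ᴺ⁾) ∩ ℓ^∞(X)` to `X̂`. -/
def boundedExtension (f : G.BoundedNeumann m) (z : G.RoydenCompactification m) : ℝ := z.1 f

/-- The `1`-harmonic boundary `∂X`. -/
def HarmonicBoundary : Type _ :=
  {z : G.RoydenCompactification m // z ∉ Set.range (G.toRoyden m) ∧
    ∀ f : G.BoundedNeumann m, f.1 ∈ G.dirichletDomain m → G.boundedExtension m f z = 0}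

instance : TopologicalSpace (G.HarmonicBoundary m) :=
  inferInstanceAs (TopologicalSpace {z : G.RoydenCompactification m //
    z ∉ Set.range (G.toRoyden m) ∧
    ∀ f : G.BoundedNeumann m, f.1 ∈ G.dirichletDomain m → G.boundedExtension m f z = 0})

instance : MeasurableSpace (G.HarmonicBoundary m) := borel _

instance : BorelSpace (G.HarmonicBoundary m) := ⟨rfl⟩

/-- The preliminary trace map `γ₀` on `D(Q⁽ᴺ⁾) ∩ ℓ^∞(X)`. -/
def boundedTrace (f : G.BoundedNeumann m) (z : G.HarmonicBoundary m) : ℝ :=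
  G.boundedExtension m f z.1

/-- The trace map `γ`: the value at `z ∈ ∂X` of the continuous extension `X̂ → [-∞, ∞]` of `f`,
that is, the limit of `f x` as `x ∈ X` tends to `z`. -/
def trace (f : X → ℝ) (z : G.HarmonicBoundary m) : EReal :=
  limUnder (comap (G.toRoyden m) (𝓝 z.1)) fun x => (f x : EReal)

/-! ### `1`-harmonic extensions and `1`-harmonic measures -/

/-- `u ∈ D(Q⁽ᴺ⁾)` solves the Dirichlet problem `(𝓛 + 1) u = 0` on `X`, `γ u = Φ` on `∂X`. -/
def IsHarmonicExtension (Φ : G.HarmonicBoundary m → EReal) (u : Lp ℝ 2 m) : Prop :=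
  G.neumannForm m u < ∞ ∧ G.IsOneHarmonic m u ∧ G.trace m u = Φ

/-- The `1`-harmonic extension `H Φ` of `Φ ∈ ran γ` (and `0` if `Φ ∉ ran γ`). -/
def harmonicExtension (Φ : G.HarmonicBoundary m → EReal) : Lp ℝ 2 m :=
  open Classical in
  if h : ∃ u, G.IsHarmonicExtension m Φ u then h.choose else 0

/-- `μ` is the `1`-harmonic measure at the vertex `o`: a Radon measure on `∂X` of mass at most one
that represents `φ ↦ H φ (o)` on `ran γ₀`, without mass at the point `∞ ∈ ∂X`, if there is one,
at which all functions of `D(Q⁽ᴺ⁾) ∩ ℓ^∞(X)` vanish (it exists if and only if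
`1 ∉ D(Q⁽ᴺ⁾)`). These properties determine `μ`. -/
structure IsHarmonicMeasure (o : X) (μ : Measure (G.HarmonicBoundary m)) : Prop where
  regular : μ.Regular
  mass_le_one : μ Set.univ ≤ 1
  representation : ∀ f : G.BoundedNeumann m,
    G.harmonicExtension m (fun z => (G.boundedTrace m f z : EReal)) o
      = ∫ z, G.boundedTrace m f z ∂μ
  no_mass_at_infinity : ∀ z : G.HarmonicBoundary m,
    (∀ f : G.BoundedNeumann m, G.boundedTrace m f z = 0) → μ {z} = 0

/-- The `1`-harmonic measure at the vertex `o`. -/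
def harmonicMeasure (o : X) : Measure (G.HarmonicBoundary m) :=
  open Classical in
  if h : ∃ μ, G.IsHarmonicMeasure m o μ then h.choose else 0

/-! ### Trace forms -/

/-- `φ ∈ L²(∂X, μ)` is the class of `γ f`; in particular `γ f` is finite `μ`-almost everywhere. -/
def IsTrace (μ : Measure (G.HarmonicBoundary m)) (f : Lp ℝ 2 m) (φ : Lp ℝ 2 μ) : Prop :=
  (fun z => (φ z : EReal)) =ᵐ[μ] G.trace m f

/-- The trace form `Tr Q` on `L²(∂X, μ)`: its domain is `γ D(Q)`, and
`Tr Q (φ) = Q₁ (H φ)` for `φ` in the domain. -/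
def traceForm (μ : Measure (G.HarmonicBoundary m)) (Q : Lp ℝ 2 m → ℝ≥0∞)
    (φ : Lp ℝ 2 μ) : ℝ≥0∞ :=
  open Classical in
  if h : ∃ f : Lp ℝ 2 m, Q f < ∞ ∧ G.IsTrace m μ f φ then
    formOne Q (G.harmonicExtension m (G.trace m h.choose))
  else ∞

/-- The Dirichlet-to-Neumann form `q^{DN} = Tr Q⁽ᴺ⁾`. -/
def dirichletToNeumann (μ : Measure (G.HarmonicBoundary m)) : Lp ℝ 2 μ → ℝ≥0∞ :=
  G.traceForm m μ (G.neumannForm m)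

/-! ### The characterizing properties of the compactification -/

/-- `X̂` is a compact Hausdorff space, `X` is a dense subset of it all of whose points are isolated,
every `f ∈ D(Q⁽ᴺ⁾) ∩ ℓ^∞(X)` extends continuously to `X̂`, and the extensions separate the points
of `X̂`. -/
theorem roydenCompactification_spec [DiscreteMeasurableSpace X]
    (hm : ∀ x, 0 < m {x} ∧ m {x} < ∞) :
    CompactSpace (G.RoydenCompactification m) ∧ T2Space (G.RoydenCompactification m) ∧
    Function.Injective (G.toRoyden m) ∧ DenseRange (G.toRoyden m) ∧
    (∀ x, IsOpen {G.toRoyden m x}) ∧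
    (∀ f, Continuous (G.boundedExtension m f)) ∧
    (∀ f x, G.boundedExtension m f (G.toRoyden m x) = f.1 x) ∧
    ∀ z w, (∀ f, G.boundedExtension m f z = G.boundedExtension m f w) → z = w := by
  have hT2 : T2Space (G.RoydenCompactification m) :=
    inferInstanceAs (T2Space {z // z ∈ closure (Set.range (G.evalAt m))})
  have hcont : ∀ f, Continuous (G.boundedExtension m f) := fun f =>
    (continuous_apply f).comp continuous_subtype_val
  have hdense : DenseRange (G.toRoyden m) := by
    intro z
    have h : (z.1 : G.BoundedNeumann m → ℝ) ∈
        closure (Subtype.val '' Set.range (fun x => (⟨G.evalAt m x, subset_closure ⟨x, rfl⟩⟩ :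
          {z // z ∈ closure (Set.range (G.evalAt m))}))) := by
      rw [← Set.range_comp]
      exact z.2
    exact closure_subtype.2 h
  have hsep : ∀ z w : G.RoydenCompactification m,
      (∀ f, G.boundedExtension m f z = G.boundedExtension m f w) → z = w :=
    fun z w h => Subtype.ext (funext h)
  have hcompact : CompactSpace (G.RoydenCompactification m) := by
    have hK : IsCompact (Set.univ.pi fun f : G.BoundedNeumann m =>
        Set.Icc (-f.2.2.choose) f.2.2.choose) :=
      isCompact_univ_pi fun f => isCompact_Icc
    refine isCompact_iff_compactSpace.1 (hK.of_isClosed_subset isClosed_closure ?_)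
    refine closure_minimal ?_ hK.isClosed
    rintro _ ⟨x, rfl⟩ f -
    exact abs_le.1 (f.2.2.choose_spec x)
  let δ : X → G.BoundedNeumann m := fun x =>
    ⟨Set.indicator {x} fun _ => (1 : ℝ),
      ⟨G.energy_indicator_lt_top x,
        memLp_indicator_const 2 (MeasurableSet.singleton x) 1 (Or.inr (hm x).2.ne)⟩,
      1, fun y => by by_cases h : y = x <;> simp [h]⟩
  have hδ : ∀ x y, G.boundedExtension m (δ x) (G.toRoyden m y)
      = Set.indicator {x} (fun _ => (1 : ℝ)) y := fun x y => rfl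
  have hinj : Function.Injective (G.toRoyden m) := by
    intro x y hxy
    by_contra hne
    have h := hδ x x
    rw [hxy, hδ] at h
    simp [Ne.symm hne] at h
  refine ⟨hcompact, hT2, hinj, hdense, fun x => ?_, hcont, fun f x => rfl, hsep⟩
  have hopen : IsOpen {z | 0 < G.boundedExtension m (δ x) z} :=
    isOpen_lt continuous_const (hcont _)
  have heq : {z | 0 < G.boundedExtension m (δ x) z} = {G.toRoyden m x} := by
    refine Set.eq_singleton_iff_unique_mem.2 ⟨by simp [hδ], fun z hz => ?_⟩
    by_contra hne
    obtain ⟨y, hy1, hy2⟩ := hdense.exists_mem_open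
      (hopen.inter (isOpen_ne (x := G.toRoyden m x))) ⟨z, hz, hne⟩
    by_cases hyx : y = x
    · exact hy2 (by rw [hyx])
    · simp [hδ, hyx] at hy1
  exact heq ▸ hopen

end WeightedGraph

end

/-! Everything takes place in the Hilbert space D(Q⁽ᴺ⁾) with the inner product Q⁽ᴺ⁾₁. It splits
orthogonally into D(Q⁽ᴰ⁾) and the 1-harmonic functions (`exists_royden`), and D(Q⁽ᴰ⁾) consists
exactly of the functions that vanish on ∂X (`tendsto_zero_of_mem_dirichletSpace`,
`mem_dirichletSpace_of_tendsto_zero`). So H(γf) is the harmonic component of f.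

By the maximum principle, Hφ(o) is at most the supremum of the positive part of φ; Hahn–Banach and
Riesz–Markov then give μ. An estimate with the Green function, H((γf)²)(o) ≤ K Q⁽ᴺ⁾₁(f) for bounded
f, makes γ continuous into L²(∂X, μ) (`exists_trace_bound`). If γf = 0 almost everywhere, then f ∈
D(Q⁽ᴰ⁾), by the minimum principle on the connected graph. Passing to classes modulo μ therefore
loses nothing.

Let Q lie between Q⁽ᴺ⁾ and Q⁽ᴰ⁾. The difference Q − Q⁽ᴺ⁾ is nonnegative and vanishes on D(Q⁽ᴰ⁾), so
its mixed terms with D(Q⁽ᴰ⁾) vanish too (`IsIntermediate.bilin_eq`): it depends only on boundary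
values. Hence Hγ preserves D(Q), and Hγf minimizes Q₁ among the functions with the trace of f.
Well-definedness, the Markov property and closedness of Tr Q, and the description of D(Q), follow.

The delicate point is that Tr Q − q^{DN} is Markovian. It is the difference Q − Q⁽ᴺ⁾ evaluated at
Hφ. Approximation of Q by its Markovian resolvents shows that a normal contraction lowers Q at least
as much as it lowers the jump energy with weights −Q(1_x, 1_y) = b(x,y) (`form_energy_le`). This
proves the claim up to an error ∑ (c + m) f². Since Q − Q⁽ᴺ⁾ does not see changes of f on finite
sets, f may be set to zero on ever larger finite sets, and the error disappears
(`IsIntermediate.excess_compLp_le`). -/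

set_option linter.unusedSectionVars false

noncomputable section

/-! ### Square summable families -/

section SquareSummable

lemma summable_mul_of_sq {ι : Type*} {a b : ι → ℝ} (ha : Summable fun i => a i ^ 2)
    (hb : Summable fun i => b i ^ 2) : Summable fun i => a i * b i := by
  refine Summable.of_norm_bounded (ha.add hb) fun i => ?_
  rw [Real.norm_eq_abs, abs_le]
  constructor <;> nlinarith [sq_nonneg (a i + b i), sq_nonneg (a i - b i)]

lemma summable_add_sq {ι : Type*} {a b : ι → ℝ} (ha : Summable fun i => a i ^ 2)
    (hb : Summable fun i => b i ^ 2) : Summable fun i => (a i + b i) ^ 2 := by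
  refine Summable.of_nonneg_of_le (fun i => sq_nonneg _) (fun i => ?_)
    ((ha.mul_left 2).add (hb.mul_left 2))
  nlinarith [sq_nonneg (a i - b i)]

lemma memℓp_two_iff {ι : Type*} {a : ι → ℝ} :
    Memℓp (E := fun _ : ι => ℝ) a 2 ↔ Summable fun i => a i ^ 2 := by
  rw [memℓp_gen_iff (by norm_num)]
  simp

/-- A bounded sequence of vectors which converges weakly when tested on a dense set converges
weakly. -/
lemma tendsto_inner_of_dense {V : Type*} [NormedAddCommGroup V] [InnerProductSpace ℝ V]
    {w : ℕ → V} {w₀ : V} {M : ℝ} (hM : ∀ n, ‖w n - w₀‖ ≤ M) {S : Set V} (hS : Dense S)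
    (h : ∀ s ∈ S, Tendsto (fun n => inner ℝ (w n) s) atTop (𝓝 (inner ℝ w₀ s))) (v : V) :
    Tendsto (fun n => inner ℝ (w n) v) atTop (𝓝 (inner ℝ w₀ v)) := by
  have hM0 : 0 ≤ M := (norm_nonneg _).trans (hM 0)
  rw [Metric.tendsto_atTop]
  intro ε hε
  -- The `M + 1` keeps the denominator positive if `M = 0`, and still gives M · ε / (2(M + 1)) < ε /
  -- 2.
  obtain ⟨s, hs, hsv⟩ := hS.exists_dist_lt v (show 0 < ε / (2 * (M + 1)) by positivity)
  obtain ⟨N, hN⟩ := Metric.tendsto_atTop.1 (h s hs) (ε / 2) (by positivity)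
  refine ⟨N, fun n hn => ?_⟩
  have h1 := hN n hn
  rw [Real.dist_eq, ← inner_sub_left] at h1 ⊢
  have h2 : inner ℝ (w n - w₀) v = inner ℝ (w n - w₀) s + inner ℝ (w n - w₀) (v - s) := by
    rw [← inner_add_right]; congr 1; abel
  have h3 : |inner ℝ (w n - w₀) (v - s)| ≤ M * (ε / (2 * (M + 1))) := by
    refine (abs_real_inner_le_norm _ _).trans ?_
    rw [dist_eq_norm] at hsv
    exact mul_le_mul (hM n) hsv.le (norm_nonneg _) hM0
  have h4 : M * (ε / (2 * (M + 1))) < ε / 2 := by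
    rw [mul_div_assoc', div_lt_div_iff₀ (by positivity) (by positivity)]
    nlinarith
  rw [h2]
  exact (abs_add_le _ _).trans_lt (by linarith)

/-- A bounded sequence in `ℓ²` which converges pointwise converges weakly. -/
lemma tendsto_tsum_mul_of_bounded {ι : Type*} {a : ℕ → ι → ℝ} {a' h : ι → ℝ} {M : ℝ}
    (hs : ∀ n, Summable fun i => a n i ^ 2) (hM : ∀ n, ∑' i, a n i ^ 2 ≤ M)
    (hp : ∀ i, Tendsto (fun n => a n i) atTop (𝓝 (a' i))) (hh : Summable fun i => h i ^ 2) :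
    (Summable fun i => a' i ^ 2) ∧ ∑' i, a' i ^ 2 ≤ M ∧
      Tendsto (fun n => ∑' i, a n i * h i) atTop (𝓝 (∑' i, a' i * h i)) := by
  classical
  have hfin : ∀ s : Finset ι, ∑ i ∈ s, a' i ^ 2 ≤ M := fun s =>
    le_of_tendsto (tendsto_finsetSum s fun i _ => (hp i).pow 2) (Eventually.of_forall fun n =>
      ((hs n).sum_le_tsum s fun i _ => sq_nonneg _).trans (hM n))
  have hs' : Summable fun i => a' i ^ 2 :=
    summable_of_sum_le (fun i => sq_nonneg _) hfin
  refine ⟨hs', hs'.tsum_le_of_sum_le hfin, ?_⟩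
  let A : ℕ → lp (fun _ : ι => ℝ) 2 := fun n => ⟨a n, memℓp_two_iff.2 (hs n)⟩
  let A' : lp (fun _ : ι => ℝ) 2 := ⟨a', memℓp_two_iff.2 hs'⟩
  let Hh : lp (fun _ : ι => ℝ) 2 := ⟨h, memℓp_two_iff.2 hh⟩
  have hin : ∀ F K : lp (fun _ : ι => ℝ) 2, inner ℝ F K = ∑' i, F i * K i := fun F K => by
    rw [lp.inner_eq_tsum]
    exact tsum_congr fun i => by simp [mul_comm]
  have hnorm : ∀ F : lp (fun _ : ι => ℝ) 2, ‖F‖ ^ 2 = ∑' i, F i ^ 2 := fun F => by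
    rw [← real_inner_self_eq_norm_sq, hin]
    exact tsum_congr fun i => (sq _).symm
  have hb : ∀ F : lp (fun _ : ι => ℝ) 2, ∑' i, F i ^ 2 ≤ M → ‖F‖ ≤ √M := fun F hF =>
    Real.le_sqrt_of_sq_le (by rw [hnorm]; exact hF)
  -- The test vectors are the finite sums of their own coordinates. They are dense, and inner
  -- products with them are finite sums, for which pointwise convergence suffices.
  have key := tendsto_inner_of_dense (w := A) (w₀ := A') (M := √M + √M)
    (fun n => (norm_sub_le _ _).trans
      (add_le_add (hb _ (hM n)) (hb _ (hs'.tsum_le_of_sum_le hfin))))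
    (S := {F | ∃ s : Finset ι, F = ∑ i ∈ s, lp.single 2 i (F i)}) ?_ ?_ Hh
  · simpa only [hin] using key
  · intro F
    refine mem_closure_of_tendsto (lp.hasSum_single (by norm_num) F)
      (Eventually.of_forall fun s => ⟨s, ?_⟩)
    refine Finset.sum_congr rfl fun i hi => ?_
    rw [lp.coeFn_sum, Finset.sum_apply, Finset.sum_eq_single i]
    · simp
    · intro j _ hj
      simp [hj.symm]
    · exact fun h => absurd hi h
  · rintro F ⟨s, hF⟩
    have h0 : ∀ K : lp (fun _ : ι => ℝ) 2, inner ℝ K F = ∑ i ∈ s, K i * F i := fun K => by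
      conv_lhs => rw [hF]
      rw [inner_sum]
      refine Finset.sum_congr rfl fun i _ => ?_
      rw [lp.inner_single_right]
      simp [mul_comm]
    simp only [h0]
    exact tendsto_finsetSum s fun i _ => (hp i).mul_const _

end SquareSummable

namespace WeightedGraph

variable {X : Type*} [MeasurableSpace X]

/-! ### The form `Q⁽ᴺ⁾₁` in coordinates -/

/-- The coordinates of a function with respect to which `Q⁽ᴺ⁾₁` is the sum of the squares. -/
def coord (G : WeightedGraph X) (m : Measure X) : (X → ℝ) →ₗ[ℝ] ((X × X) ⊕ X → ℝ) where
  toFun f := Sum.elim (fun p => √(G.b p.1 p.2 / 2) * (f p.1 - f p.2))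
    (fun x => √(G.c x + m.real {x}) * f x)
  map_add' f g := by
    ext (p | x) <;> simp <;> ring
  map_smul' r f := by
    ext (p | x) <;> simp <;> ring

/-- `D(Q⁽ᴺ⁾)` as a subspace of the space of all functions. -/
def formDomain (G : WeightedGraph X) (m : Measure X) : Submodule ℝ (X → ℝ) where
  carrier := {f | Summable fun i => G.coord m f i ^ 2}
  add_mem' {f g} hf hg := by
    simpa using summable_add_sq hf hg
  zero_mem' := by simp
  smul_mem' r f hf := by
    simpa [mul_pow] using Summable.mul_left (r ^ 2) hf

/-- The bilinear form of `Q⁽ᴺ⁾₁`. -/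
def oneForm (G : WeightedGraph X) (m : Measure X) (f g : X → ℝ) : ℝ :=
  ∑' i, G.coord m f i * G.coord m g i

variable {G : WeightedGraph X} {m : Measure X}

@[simp] lemma coord_inl (f : X → ℝ) (p : X × X) :
    G.coord m f (Sum.inl p) = √(G.b p.1 p.2 / 2) * (f p.1 - f p.2) := rfl

@[simp] lemma coord_inr (f : X → ℝ) (x : X) :
    G.coord m f (Sum.inr x) = √(G.c x + m.real {x}) * f x := rfl

lemma coord_inl_sq (f : X → ℝ) (p : X × X) :
    G.coord m f (Sum.inl p) ^ 2 = G.b p.1 p.2 / 2 * (f p.1 - f p.2) ^ 2 := by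
  rw [coord_inl, mul_pow, Real.sq_sqrt (div_nonneg (G.b_nonneg _ _) two_pos.le)]

lemma vertexWeight_nonneg (x : X) : 0 ≤ G.c x + m.real {x} :=
  add_nonneg (G.c_nonneg x) measureReal_nonneg

lemma coord_inr_sq (f : X → ℝ) (x : X) :
    G.coord m f (Sum.inr x) ^ 2 = (G.c x + m.real {x}) * f x ^ 2 := by
  rw [coord_inr, mul_pow, Real.sq_sqrt (vertexWeight_nonneg x)]

lemma mem_formDomain {f : X → ℝ} :
    f ∈ G.formDomain m ↔ Summable fun i => G.coord m f i ^ 2 := Iff.rfl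

lemma oneForm_summable {f g : X → ℝ} (hf : f ∈ G.formDomain m) (hg : g ∈ G.formDomain m) :
    Summable fun i => G.coord m f i * G.coord m g i := summable_mul_of_sq hf hg

lemma oneForm_comm (f g : X → ℝ) : G.oneForm m f g = G.oneForm m g f :=
  tsum_congr fun _ => mul_comm _ _

lemma oneForm_self (f : X → ℝ) : G.oneForm m f f = ∑' i, G.coord m f i ^ 2 :=
  tsum_congr fun _ => (sq _).symm

lemma oneForm_self_nonneg (f : X → ℝ) : 0 ≤ G.oneForm m f f :=
  tsum_nonneg fun _ => mul_self_nonneg _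

lemma oneForm_add_left {f g h : X → ℝ} (hf : f ∈ G.formDomain m) (hg : g ∈ G.formDomain m)
    (hh : h ∈ G.formDomain m) : G.oneForm m (f + g) h = G.oneForm m f h + G.oneForm m g h := by
  rw [oneForm, oneForm, oneForm, ← (oneForm_summable hf hh).tsum_add (oneForm_summable hg hh)]
  exact tsum_congr fun i => by simp [add_mul]

lemma oneForm_smul_left (r : ℝ) (f h : X → ℝ) :
    G.oneForm m (r • f) h = r * G.oneForm m f h := by
  rw [oneForm, oneForm, ← tsum_mul_left]
  exact tsum_congr fun i => by simp [mul_assoc]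

lemma oneForm_sub_left {f g h : X → ℝ} (hf : f ∈ G.formDomain m) (hg : g ∈ G.formDomain m)
    (hh : h ∈ G.formDomain m) : G.oneForm m (f - g) h = G.oneForm m f h - G.oneForm m g h := by
  rw [oneForm, oneForm, oneForm, ← (oneForm_summable hf hh).tsum_sub (oneForm_summable hg hh)]
  exact tsum_congr fun i => by simp [sub_mul]

lemma oneForm_zero_left (h : X → ℝ) : G.oneForm m 0 h = 0 := by
  simp [oneForm]

lemma oneForm_add_right {f g h : X → ℝ} (hf : f ∈ G.formDomain m) (hg : g ∈ G.formDomain m)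
    (hh : h ∈ G.formDomain m) : G.oneForm m h (f + g) = G.oneForm m h f + G.oneForm m h g := by
  simp only [oneForm_comm h]; exact oneForm_add_left hf hg hh

lemma oneForm_sub_right {f g h : X → ℝ} (hf : f ∈ G.formDomain m) (hg : g ∈ G.formDomain m)
    (hh : h ∈ G.formDomain m) : G.oneForm m h (f - g) = G.oneForm m h f - G.oneForm m h g := by
  simp only [oneForm_comm h]; exact oneForm_sub_left hf hg hh

lemma oneForm_smul_right (r : ℝ) (f h : X → ℝ) :
    G.oneForm m h (r • f) = r * G.oneForm m h f := by
  simp only [oneForm_comm h]; exact oneForm_smul_left r f h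

/-- One square is bounded by the sum of all. As every vertex has positive mass, point evaluations
are thus continuous for the form norm. -/
lemma vertexWeight_mul_sq_le {f : X → ℝ} (hf : f ∈ G.formDomain m) (x : X) :
    (G.c x + m.real {x}) * f x ^ 2 ≤ G.oneForm m f f := by
  rw [← coord_inr_sq, oneForm_self]
  exact Summable.le_tsum hf (Sum.inr x) fun _ _ => sq_nonneg _

lemma mass_mul_sq_le {f : X → ℝ} (hf : f ∈ G.formDomain m) (x : X) :
    m.real {x} * f x ^ 2 ≤ G.oneForm m f f :=
  (mul_le_mul_of_nonneg_right (le_add_of_nonneg_left (G.c_nonneg x)) (sq_nonneg _)).trans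
    (vertexWeight_mul_sq_le hf x)

lemma eq_zero_of_oneForm_self (hm : ∀ x, 0 < m {x} ∧ m {x} < ∞) {f : X → ℝ}
    (hf : f ∈ G.formDomain m) (h : G.oneForm m f f = 0) : f = 0 := by
  ext x
  have h1 := mass_mul_sq_le hf x
  have h2 : 0 < m.real {x} := ENNReal.toReal_pos (hm x).1.ne' (hm x).2.ne
  have h3 : f x ^ 2 ≤ 0 := by
    by_contra h4
    push Not at h4
    nlinarith [mul_pos h2 h4]
  simpa using le_antisymm h3 (sq_nonneg _)

/-- Domination of coordinates. -/
lemma mem_formDomain_of_abs_coord_le {f g : X → ℝ} (hg : g ∈ G.formDomain m)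
    (h : ∀ i, |G.coord m f i| ≤ |G.coord m g i|) :
    f ∈ G.formDomain m ∧ G.oneForm m f f ≤ G.oneForm m g g := by
  have hf : f ∈ G.formDomain m :=
    Summable.of_nonneg_of_le (fun i => sq_nonneg _) (fun i => sq_le_sq.2 (h i)) hg
  refine ⟨hf, ?_⟩
  rw [oneForm_self, oneForm_self]
  exact Summable.tsum_le_tsum (fun i => sq_le_sq.2 (h i)) hf hg

/-- Domination of coordinates by a sum. -/
lemma mem_formDomain_of_abs_coord_le_add {f g h : X → ℝ} (hg : g ∈ G.formDomain m)
    (hh : h ∈ G.formDomain m) {r s : ℝ}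
    (hle : ∀ i, |G.coord m f i| ≤ r * |G.coord m g i| + s * |G.coord m h i|) :
    f ∈ G.formDomain m ∧
      G.oneForm m f f ≤ 2 * r ^ 2 * G.oneForm m g g + 2 * s ^ 2 * G.oneForm m h h := by
  have hle2 : ∀ i, G.coord m f i ^ 2
      ≤ 2 * r ^ 2 * G.coord m g i ^ 2 + 2 * s ^ 2 * G.coord m h i ^ 2 := fun i => by
    have h1 : G.coord m f i ^ 2 ≤ (r * |G.coord m g i| + s * |G.coord m h i|) ^ 2 :=
      sq_le_sq.2 ((hle i).trans (le_abs_self _))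
    nlinarith [sq_nonneg (r * |G.coord m g i| - s * |G.coord m h i|),
      sq_abs (G.coord m g i), sq_abs (G.coord m h i)]
  have hs := (Summable.mul_left (2 * r ^ 2) hg).add (Summable.mul_left (2 * s ^ 2) hh)
  have hf : f ∈ G.formDomain m := Summable.of_nonneg_of_le (fun i => sq_nonneg _) hle2 hs
  refine ⟨hf, ?_⟩
  rw [oneForm_self, oneForm_self, oneForm_self, ← tsum_mul_left, ← tsum_mul_left,
    ← Summable.tsum_add (Summable.mul_left _ hg) (Summable.mul_left _ hh)]
  exact Summable.tsum_le_tsum hle2 hf hs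

lemma abs_coord_le_of_le {f g : X → ℝ} (h1 : ∀ x, |f x| ≤ |g x|)
    (h2 : ∀ x y, |f x - f y| ≤ |g x - g y|) (i : (X × X) ⊕ X) :
    |G.coord m f i| ≤ |G.coord m g i| := by
  rcases i with p | x
  · simp only [coord_inl, abs_mul]
    exact mul_le_mul_of_nonneg_left (h2 _ _) (abs_nonneg _)
  · simp only [coord_inr, abs_mul]
    exact mul_le_mul_of_nonneg_left (h1 _) (abs_nonneg _)

lemma abs_coord_le_add_of_le {f g h : X → ℝ} {r s : ℝ}
    (h1 : ∀ x, |f x| ≤ r * |g x| + s * |h x|)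
    (h2 : ∀ x y, |f x - f y| ≤ r * |g x - g y| + s * |h x - h y|) (i : (X × X) ⊕ X) :
    |G.coord m f i| ≤ r * |G.coord m g i| + s * |G.coord m h i| := by
  rcases i with p | x
  · simp only [coord_inl, abs_mul]
    nlinarith [mul_le_mul_of_nonneg_left (h2 p.1 p.2) (abs_nonneg √(G.b p.1 p.2 / 2))]
  · simp only [coord_inr, abs_mul]
    nlinarith [mul_le_mul_of_nonneg_left (h1 x) (abs_nonneg √(G.c x + m.real {x}))]

lemma abs_le_of_contraction {C : ℝ → ℝ} (hC : LipschitzWith 1 C) (u w : ℝ) :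
    |C u - C w| ≤ |u - w| := by
  simpa [Real.dist_eq] using hC.dist_le_mul u w

/-- Normal contractions operate on `D(Q⁽ᴺ⁾)`. -/
lemma contraction_mem {C : ℝ → ℝ} (hC : LipschitzWith 1 C) (h0 : C 0 = 0) {f : X → ℝ}
    (hf : f ∈ G.formDomain m) :
    (fun x => C (f x)) ∈ G.formDomain m ∧
      G.oneForm m (fun x => C (f x)) (fun x => C (f x)) ≤ G.oneForm m f f :=
  mem_formDomain_of_abs_coord_le hf (abs_coord_le_of_le
    (fun x => by simpa [h0] using abs_le_of_contraction hC (f x) 0)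
    fun _ _ => abs_le_of_contraction hC _ _)

lemma tendsto_coord {f : ℕ → X → ℝ} {g : X → ℝ}
    (h : ∀ x, Tendsto (fun n => f n x) atTop (𝓝 (g x))) (i : (X × X) ⊕ X) :
    Tendsto (fun n => G.coord m (f n) i) atTop (𝓝 (G.coord m g i)) := by
  rcases i with p | x
  · exact ((h p.1).sub (h p.2)).const_mul _
  · exact (h x).const_mul _

/-- Pointwise limits of bounded sequences in `D(Q⁽ᴺ⁾)` are weak limits. -/
lemma mem_formDomain_of_tendsto {f : ℕ → X → ℝ} {g : X → ℝ} {M : ℝ}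
    (hf : ∀ n, f n ∈ G.formDomain m) (hM : ∀ n, G.oneForm m (f n) (f n) ≤ M)
    (h : ∀ x, Tendsto (fun n => f n x) atTop (𝓝 (g x))) :
    g ∈ G.formDomain m ∧ G.oneForm m g g ≤ M ∧ ∀ k ∈ G.formDomain m,
      Tendsto (fun n => G.oneForm m (f n) k) atTop (𝓝 (G.oneForm m g k)) := by
  simp only [oneForm_self] at hM ⊢
  have key := fun k : X → ℝ => fun hk : k ∈ G.formDomain m =>
    tendsto_tsum_mul_of_bounded hf hM (tendsto_coord h) hk
  have h0 := key 0 (zero_mem _)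
  exact ⟨h0.1, h0.2.1, fun k hk => (key k hk).2.2⟩

end WeightedGraph
end

noncomputable section

namespace WeightedGraph

variable {X : Type*} [MeasurableSpace X] {G : WeightedGraph X} {m : Measure X}

/-! ### Comparison with the measure theoretic definitions -/

section Bridge

variable [Countable X] [DiscreteMeasurableSpace X]

lemma sq_eLpNorm_two (hm : ∀ x, 0 < m {x} ∧ m {x} < ∞) (f : X → ℝ) :
    eLpNorm f 2 m ^ 2 = ∑' x, ENNReal.ofReal (m.real {x} * f x ^ 2) := by
  have h1 := eLpNorm_nnreal_pow_eq_lintegral (μ := m) (f := f) (p := 2) two_ne_zero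
  have h2 : eLpNorm f 2 m ^ 2 = ∫⁻ x, ‖f x‖ₑ ^ 2 ∂m := by
    have h3 : ((2 : NNReal) : ℝ) = ((2 : ℕ) : ℝ) := by norm_num
    rw [h3] at h1
    simp only [ENNReal.rpow_natCast] at h1
    simpa using h1
  rw [h2, lintegral_countable']
  refine tsum_congr fun x => ?_
  rw [ENNReal.ofReal_mul measureReal_nonneg, ofReal_measureReal (hm x).2.ne, mul_comm,
    ← sq_abs, ENNReal.ofReal_pow (abs_nonneg _), Real.enorm_eq_ofReal_abs]

/-- An identity in [0, ∞] that needs no summability. It turns membership in D(Q⁽ᴺ⁾) into summability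
of squared coordinates. -/
lemma energy_add_eLpNorm (hm : ∀ x, 0 < m {x} ∧ m {x} < ∞) (f : X → ℝ) :
    G.energy f + eLpNorm f 2 m ^ 2 = ∑' i, ENNReal.ofReal (G.coord m f i ^ 2) := by
  rw [sq_eLpNorm_two hm, energy, add_assoc, ← ENNReal.tsum_add,
    Summable.tsum_sum ENNReal.summable ENNReal.summable, ← ENNReal.tsum_mul_left]
  congr 1
  · rw [ENNReal.tsum_prod' (f := fun p : X × X => ENNReal.ofReal (G.coord m f (Sum.inl p) ^ 2))]
    refine tsum_congr fun x => ?_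
    rw [← ENNReal.tsum_mul_left]
    refine tsum_congr fun y => ?_
    rw [coord_inl_sq, show (2 : ℝ≥0∞)⁻¹ = ENNReal.ofReal 2⁻¹ by
      rw [ENNReal.ofReal_inv_of_pos two_pos]; simp, ← ENNReal.ofReal_mul (by norm_num)]
    congr 1
    ring
  · refine tsum_congr fun x => ?_
    rw [coord_inr_sq, ← ENNReal.ofReal_add (mul_nonneg (G.c_nonneg x) (sq_nonneg _))
      (mul_nonneg measureReal_nonneg (sq_nonneg _)), add_mul]

lemma mem_neumannDomain_iff (hm : ∀ x, 0 < m {x} ∧ m {x} < ∞) {f : X → ℝ} :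
    f ∈ G.neumannDomain m ↔ f ∈ G.formDomain m := by
  have h1 : f ∈ G.formDomain m ↔ ∑' i, ENNReal.ofReal (G.coord m f i ^ 2) ≠ ∞ := by
    rw [mem_formDomain]
    constructor
    · exact fun h => h.tsum_ofReal_ne_top
    · intro h
      have h2 := ENNReal.summable_toReal h
      simpa [ENNReal.toReal_ofReal (sq_nonneg _)] using h2
  rw [h1, ← energy_add_eLpNorm hm, neumannDomain, Set.mem_ofPred_eq, MemLp,
    ← lt_top_iff_ne_top, ENNReal.add_lt_top, ENNReal.pow_lt_top_iff]
  simp [(Measurable.of_discrete (f := f)).aestronglyMeasurable]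

lemma energy_add_eLpNorm_eq (hm : ∀ x, 0 < m {x} ∧ m {x} < ∞) {f : X → ℝ}
    (hf : f ∈ G.formDomain m) :
    G.energy f + eLpNorm f 2 m ^ 2 = ENNReal.ofReal (G.oneForm m f f) := by
  rw [energy_add_eLpNorm hm, oneForm_self, ENNReal.ofReal_tsum_of_nonneg (fun _ => sq_nonneg _) hf]

end Bridge

/-! ### Finitely supported functions and Green's formula -/

/-- The characteristic function of a vertex. -/
def vertexFn (x : X) : X → ℝ := Set.indicator {x} fun _ => 1

@[simp] lemma vertexFn_self (x : X) : vertexFn x x = 1 := by simp [vertexFn]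

lemma vertexFn_of_ne {x y : X} (h : y ≠ x) : vertexFn x y = 0 := by simp [vertexFn, h]

lemma support_vertexFn (x : X) : (Function.support (vertexFn x)).Finite :=
  (Set.finite_singleton x).subset Set.support_indicator_subset

lemma vertexFn_mem [Countable X] [DiscreteMeasurableSpace X]
    (hm : ∀ x, 0 < m {x} ∧ m {x} < ∞) (x : X) : vertexFn x ∈ G.formDomain m :=
  (mem_neumannDomain_iff hm).1 ⟨G.energy_indicator_lt_top x,
    memLp_indicator_const 2 (MeasurableSet.singleton x) 1 (Or.inr (hm x).2.ne)⟩

lemma eq_sum_vertexFn {f : X → ℝ} (hf : (Function.support f).Finite) :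
    f = ∑ x ∈ hf.toFinset, f x • vertexFn x := by
  ext y
  rw [Finset.sum_apply]
  by_cases hy : f y = 0
  · rw [hy, Finset.sum_eq_zero]
    intro x hx
    have : y ≠ x := fun h => by simp [← h, hy] at hx
    simp [vertexFn_of_ne this]
  · rw [Finset.sum_eq_single y]
    · simp
    · intro x _ hx
      simp [vertexFn_of_ne hx.symm]
    · intro h
      simp [hy] at h

lemma finite_support_mem [Countable X] [DiscreteMeasurableSpace X]
    (hm : ∀ x, 0 < m {x} ∧ m {x} < ∞) {f : X → ℝ} (hf : (Function.support f).Finite) :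
    f ∈ G.formDomain m := by
  rw [eq_sum_vertexFn hf]
  exact Submodule.sum_mem _ fun x _ => Submodule.smul_mem _ _ (vertexFn_mem hm x)

/-- Cauchy–Schwarz for the finite weight b(x, ·): the term is the product of √(2b(x,y)) and the
coordinate √(b(x,y)/2) (f x − f y), both square summable in y. -/
lemma summable_b_mul_sub {f : X → ℝ} (hf : f ∈ G.formDomain m) (x : X) :
    Summable fun y => G.b x y * (f x - f y) := by
  have h1 : Summable fun y => G.coord m f (Sum.inl (x, y)) ^ 2 :=
    Summable.comp_injective (i := fun y => Sum.inl (x, y)) hf fun a b h => by simpa using h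
  have h2 : Summable fun y => √(2 * G.b x y) ^ 2 := by
    simpa only [Real.sq_sqrt (mul_nonneg two_pos.le (G.b_nonneg x _))] using
      (G.b_summable x).mul_left 2
  refine (summable_mul_of_sq h2 h1).congr fun y => ?_
  rw [coord_inl, ← mul_assoc, ← Real.sqrt_mul (mul_nonneg two_pos.le (G.b_nonneg x _))]
  congr 1
  rw [show 2 * G.b x y * (G.b x y / 2) = G.b x y ^ 2 by ring, Real.sqrt_sq (G.b_nonneg x y)]

/-- Green's formula. -/
lemma oneForm_vertexFn {f : X → ℝ} (hf : f ∈ G.formDomain m) {x : X}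
    (hx : vertexFn x ∈ G.formDomain m) :
    G.oneForm m f (vertexFn x)
      = ∑' y, G.b x y * (f x - f y) + (G.c x + m.real {x}) * f x := by
  classical
  have hsum := oneForm_summable hf hx
  rw [oneForm, Summable.tsum_sum (hsum.comp_injective Sum.inl_injective)
    (hsum.comp_injective Sum.inr_injective)]
  congr 1
  · have hb : ∀ u v, √(G.b u v / 2) * √(G.b u v / 2) = G.b u v / 2 := fun u v =>
      Real.mul_self_sqrt (div_nonneg (G.b_nonneg u v) two_pos.le)
    -- Each edge at `x` occurs as (x, y) and as (y, x), with weight b/2; splitting according to the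
    -- endpoint equal to `x` gives two equal halves. At (x, x) both terms vanish.
    have hterm : ∀ p : X × X, G.coord m f (Sum.inl p) * G.coord m (vertexFn x) (Sum.inl p)
        = (if p.1 = x then G.b x p.2 / 2 * (f x - f p.2) else 0)
          + (if p.2 = x then G.b x p.1 / 2 * (f x - f p.1) else 0) := by
      rintro ⟨u, v⟩
      simp only [coord_inl]
      rw [show √(G.b u v / 2) * (f u - f v) * (√(G.b u v / 2) * (vertexFn x u - vertexFn x v))
        = (√(G.b u v / 2) * √(G.b u v / 2)) * ((f u - f v) * (vertexFn x u - vertexFn x v)) by ring,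
        hb]
      by_cases hu : u = x <;> by_cases hv : v = x
      · simp [hu, hv]
      · simp [hu, vertexFn_of_ne hv, hv]
      · simp only [hu, hv, vertexFn_of_ne hu, if_true, if_false, vertexFn_self]
        rw [G.b_symm u x]; ring
      · simp [vertexFn_of_ne hv, hv, vertexFn_of_ne hu, hu]
    rw [tsum_congr hterm]
    have e1 : HasSum (fun p : X × X => if p.1 = x then G.b x p.2 / 2 * (f x - f p.2) else 0)
        ((∑' y, G.b x y * (f x - f y)) / 2) := by
      have hi : Function.Injective fun y : X => (x, y) := fun a b h => by simpa using h
      refine (hi.hasSum_iff ?_).1 ?_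
      · rintro ⟨u, v⟩ h
        rw [if_neg]
        rintro rfl
        exact h ⟨v, rfl⟩
      · have h := (summable_b_mul_sub hf x).hasSum.div_const 2
        rwa [show (fun y => G.b x y * (f x - f y) / 2)
          = (fun p : X × X => if p.1 = x then G.b x p.2 / 2 * (f x - f p.2) else 0) ∘
            fun y => (x, y) from funext fun y => by
              simp only [Function.comp_apply, if_true]; ring] at h
    have e2 : HasSum (fun p : X × X => if p.2 = x then G.b x p.1 / 2 * (f x - f p.1) else 0)
        ((∑' y, G.b x y * (f x - f y)) / 2) := by
      have := (Equiv.prodComm X X).hasSum_iff.2 e1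
      exact this
    rw [(e1.add e2).tsum_eq]
    ring
  · rw [tsum_eq_single x]
    · simp only [coord_inr, vertexFn_self, mul_one]
      rw [mul_right_comm, Real.mul_self_sqrt (vertexWeight_nonneg x)]
    · intro y hy
      simp [vertexFn_of_ne hy]

/-! ### The Dirichlet subspace -/

/-- The functions `h ∈ D(Q⁽ᴺ⁾)` that are orthogonal to the finitely supported functions. -/
def harmonicSpace (G : WeightedGraph X) (m : Measure X) : Set (X → ℝ) :=
  {h | h ∈ G.formDomain m ∧ ∀ x, G.oneForm m h (vertexFn x) = 0}

/-- `D(Q⁽ᴰ⁾)` as the orthogonal complement of the `1`-harmonic functions. -/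
def dirichletSpace (G : WeightedGraph X) (m : Measure X) : Submodule ℝ (X → ℝ) where
  carrier := {f | f ∈ G.formDomain m ∧ ∀ h ∈ G.harmonicSpace m, G.oneForm m f h = 0}
  add_mem' {f g} hf hg := ⟨add_mem hf.1 hg.1, fun h hh => by
    rw [oneForm_add_left hf.1 hg.1 hh.1, hf.2 h hh, hg.2 h hh, add_zero]⟩
  zero_mem' := ⟨zero_mem _, fun h _ => oneForm_zero_left h⟩
  smul_mem' r f hf := ⟨Submodule.smul_mem _ _ hf.1, fun h hh => by
    rw [oneForm_smul_left, hf.2 h hh, mul_zero]⟩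

/-- Pointwise limits of bounded sequences in `D(Q⁽ᴰ⁾)` are in `D(Q⁽ᴰ⁾)`. -/
lemma mem_dirichletSpace_of_tendsto {f : ℕ → X → ℝ} {g : X → ℝ} {M : ℝ}
    (hf : ∀ n, f n ∈ G.dirichletSpace m) (hM : ∀ n, G.oneForm m (f n) (f n) ≤ M)
    (h : ∀ x, Tendsto (fun n => f n x) atTop (𝓝 (g x))) : g ∈ G.dirichletSpace m := by
  obtain ⟨h1, -, h3⟩ := mem_formDomain_of_tendsto (fun n => (hf n).1) hM h
  refine ⟨h1, fun k hk => ?_⟩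
  have h4 := h3 k hk.1
  simp only [fun n => (hf n).2 k hk] at h4
  exact tendsto_nhds_unique h4 tendsto_const_nhds

/-- The square summable family of the coordinates of `f ∈ D(Q⁽ᴺ⁾)`. -/
def lift (G : WeightedGraph X) (m : Measure X) :
    G.formDomain m →ₗ[ℝ] lp (fun _ : (X × X) ⊕ X => ℝ) 2 where
  toFun f := ⟨G.coord m f, memℓp_two_iff.2 f.2⟩
  map_add' f g := Subtype.ext (map_add (G.coord m) f.1 g.1)
  map_smul' r f := Subtype.ext (map_smul (G.coord m) r f.1)

lemma inner_lift (F : lp (fun _ : (X × X) ⊕ X => ℝ) 2) (f : G.formDomain m) :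
    inner ℝ F (G.lift m f) = ∑' i, F i * G.coord m f i := by
  rw [lp.inner_eq_tsum]
  exact tsum_congr fun i => by simp [lift, mul_comm]

lemma inner_lift_lift (f g : G.formDomain m) :
    inner ℝ (G.lift m f) (G.lift m g) = G.oneForm m f g := inner_lift _ _

lemma abs_oneForm_le {f g : X → ℝ} (hf : f ∈ G.formDomain m) (hg : g ∈ G.formDomain m) :
    |G.oneForm m f g| ≤ √(G.oneForm m f f) * √(G.oneForm m g g) := by
  have h := abs_real_inner_le_norm (G.lift m ⟨f, hf⟩) (G.lift m ⟨g, hg⟩)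
  rw [norm_eq_sqrt_real_inner, norm_eq_sqrt_real_inner] at h
  simpa only [inner_lift_lift] using h

/-! ### Orthogonal projection, Royden decomposition and the Green function -/

section Projection

variable [Countable X] [DiscreteMeasurableSpace X]

lemma finite_support_mem_dirichletSpace (hm : ∀ x, 0 < m {x} ∧ m {x} < ∞) {f : X → ℝ}
    (hf : (Function.support f).Finite) : f ∈ G.dirichletSpace m := by
  have hx : ∀ x, vertexFn x ∈ G.dirichletSpace m := fun x =>
    ⟨vertexFn_mem hm x, fun h hh => by rw [oneForm_comm]; exact hh.2 x⟩
  rw [eq_sum_vertexFn hf]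
  exact Submodule.sum_mem _ fun x _ => Submodule.smul_mem _ _ (hx x)

/-- Projection onto the closure of the finitely supported functions. -/
lemma exists_projection (hm : ∀ x, 0 < m {x} ∧ m {x} < ∞)
    (F : lp (fun _ : (X × X) ⊕ X => ℝ) 2) :
    ∃ g ∈ G.formDomain m, (∃ u : ℕ → X → ℝ, (∀ n, (Function.support (u n)).Finite) ∧
      Tendsto (fun n => G.oneForm m (g - u n) (g - u n)) atTop (𝓝 0)) ∧
      ∀ x, ∑' i, F i * G.coord m (vertexFn x) i = G.oneForm m g (vertexFn x) := by
  let W₀ : Submodule ℝ (G.formDomain m) :=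
    { carrier := {f | (Function.support f.1).Finite}
      add_mem' := fun {f g} hf hg => (hf.union hg).subset (Function.support_add _ _)
      zero_mem' := by simp
      smul_mem' := fun r f hf => Set.Finite.subset hf
        (Function.support_const_smul_subset r f.1) }
  let W := W₀.map (G.lift m)
  let K := W.topologicalClosure
  have : CompleteSpace K := (Submodule.isClosed_topologicalClosure W).completeSpace_coe
  let P := K.starProjection F
  have hPK : P ∈ closure (W : Set (lp (fun _ : (X × X) ⊕ X => ℝ) 2)) := by
    rw [← Submodule.topologicalClosure_coe]
    exact Submodule.starProjection_apply_mem K F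
  obtain ⟨w, hw, hwP⟩ := mem_closure_iff_seq_limit.1 hPK
  choose v hv hvw using hw
  have hcoord : ∀ i, Tendsto (fun n => G.coord m (v n).1 i) atTop (𝓝 (P i)) := by
    intro i
    have h1 : Tendsto (fun n => ‖w n - P‖) atTop (𝓝 0) := by
      simpa using (hwP.sub_const P).norm
    refine tendsto_iff_norm_sub_tendsto_zero.2
      (squeeze_zero (fun n => norm_nonneg _) (fun n => ?_) h1)
    have h2 := lp.norm_apply_le_norm (by norm_num) (w n - P) i
    rw [← hvw n] at h2 ⊢
    exact h2
  have hpos : ∀ x, 0 < √(G.c x + m.real {x}) := fun x =>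
    Real.sqrt_pos.2 (add_pos_of_nonneg_of_pos (G.c_nonneg x)
      (ENNReal.toReal_pos (hm x).1.ne' (hm x).2.ne))
  -- The ℓ² limit `P` of coordinate families is again one. Its vertex coordinates, divided by the
  -- positive vertex weights, define a function to which the approximants converge pointwise, and
  -- then the edge coordinates agree as well.
  let g : X → ℝ := fun x => P (Sum.inr x) / √(G.c x + m.real {x})
  have hg : ∀ x, Tendsto (fun n => (v n).1 x) atTop (𝓝 (g x)) := fun x => by
    have h := (hcoord (Sum.inr x)).div_const √(G.c x + m.real {x})
    refine h.congr fun n => ?_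
    rw [coord_inr, mul_div_cancel_left₀ _ (hpos x).ne']
  have hgP : G.coord m g = P := by
    ext i
    exact tendsto_nhds_unique (tendsto_coord hg i) (hcoord i)
  have hgD : g ∈ G.formDomain m := by
    rw [mem_formDomain, hgP]
    exact memℓp_two_iff.1 P.2
  have hlg : G.lift m ⟨g, hgD⟩ = P := Subtype.ext hgP
  refine ⟨g, hgD, ⟨fun n => (v n).1, fun n => hv n, ?_⟩, fun x => ?_⟩
  · have h1 : Tendsto (fun n => ‖P - w n‖ ^ 2) atTop (𝓝 0) := by
      simpa using ((hwP.const_sub P).norm).pow 2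
    refine h1.congr fun n => ?_
    rw [← hvw n, ← hlg, ← map_sub, ← real_inner_self_eq_norm_sq, inner_lift_lift]
    rfl
  · have h1 : G.lift m ⟨vertexFn x, vertexFn_mem hm x⟩ ∈ K :=
      W.le_topologicalClosure ⟨⟨vertexFn x, vertexFn_mem hm x⟩, support_vertexFn x, rfl⟩
    have h2 := Submodule.starProjection_inner_eq_zero (K := K) F _ h1
    rw [inner_sub_left, sub_eq_zero, inner_lift] at h2
    rw [h2]
    change inner ℝ P _ = _
    rw [← hlg, inner_lift_lift]

/-- For 1-harmonic `k` one has Q₁(f, k) = Q₁(f − uₙ, k), which tends to zero by Cauchy–Schwarz. -/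
lemma mem_dirichletSpace_of_approx (hm : ∀ x, 0 < m {x} ∧ m {x} < ∞) {f : X → ℝ}
    (hf : f ∈ G.formDomain m) {u : ℕ → X → ℝ} (hu : ∀ n, (Function.support (u n)).Finite)
    (h : Tendsto (fun n => G.oneForm m (f - u n) (f - u n)) atTop (𝓝 0)) :
    f ∈ G.dirichletSpace m := by
  refine ⟨hf, fun k hk => ?_⟩
  have h1 : ∀ n, |G.oneForm m f k| ≤ √(G.oneForm m (f - u n) (f - u n)) * √(G.oneForm m k k) := by
    intro n
    have h2 := abs_oneForm_le (sub_mem hf (finite_support_mem hm (hu n))) hk.1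
    rwa [oneForm_sub_left hf (finite_support_mem hm (hu n)) hk.1,
      (finite_support_mem_dirichletSpace hm (hu n)).2 k hk, sub_zero] at h2
  have h3 : Tendsto (fun n => √(G.oneForm m (f - u n) (f - u n)) * √(G.oneForm m k k)) atTop
      (𝓝 0) := by
    simpa using (h.sqrt).mul_const √(G.oneForm m k k)
  have h4 := ge_of_tendsto h3 (Eventually.of_forall h1)
  exact abs_eq_zero.1 (le_antisymm h4 (abs_nonneg _))

/-- Royden decomposition. -/
lemma exists_royden (hm : ∀ x, 0 < m {x} ∧ m {x} < ∞) {f : X → ℝ} (hf : f ∈ G.formDomain m) :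
    ∃ h ∈ G.harmonicSpace m, f - h ∈ G.dirichletSpace m := by
  obtain ⟨g, hg, ⟨u, hu, hlim⟩, hor⟩ := exists_projection hm (G.lift m ⟨f, hf⟩)
  refine ⟨f - g, ⟨sub_mem hf hg, fun x => ?_⟩, ?_⟩
  · rw [oneForm_sub_left hf hg (vertexFn_mem hm x), ← hor x, sub_eq_zero]
    rfl
  · rw [sub_sub_cancel]
    exact mem_dirichletSpace_of_approx hm hg hu hlim

lemma eq_zero_of_mem_harmonicSpace (hm : ∀ x, 0 < m {x} ∧ m {x} < ∞) {f : X → ℝ}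
    (h1 : f ∈ G.harmonicSpace m) (h2 : f ∈ G.dirichletSpace m) : f = 0 :=
  eq_zero_of_oneForm_self hm h1.1 (h2.2 f h1)

/-- Projecting `f` to the closure of the finitely supported functions leaves a 1-harmonic remainder,
which also lies in `dirichletSpace` and is therefore orthogonal to itself. -/
lemma exists_approx (hm : ∀ x, 0 < m {x} ∧ m {x} < ∞) {f : X → ℝ}
    (hf : f ∈ G.dirichletSpace m) :
    ∃ u : ℕ → X → ℝ, (∀ n, (Function.support (u n)).Finite) ∧
      Tendsto (fun n => G.oneForm m (f - u n) (f - u n)) atTop (𝓝 0) := by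
  obtain ⟨g, hg, ⟨u, hu, hlim⟩, hor⟩ := exists_projection hm (G.lift m ⟨f, hf.1⟩)
  have h1 : f - g ∈ G.harmonicSpace m := ⟨sub_mem hf.1 hg, fun x => by
    rw [oneForm_sub_left hf.1 hg (vertexFn_mem hm x), ← hor x, sub_eq_zero]
    rfl⟩
  have h2 := eq_zero_of_mem_harmonicSpace hm h1
    (sub_mem hf (mem_dirichletSpace_of_approx hm hg hu hlim))
  rw [sub_eq_zero.1 h2]
  exact ⟨u, hu, hlim⟩

/-- Links the definition of D(Q⁽ᴰ⁾) by approximation to the one by orthogonality, which is linear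
and stable under weak limits. -/
lemma mem_dirichletDomain_iff (hm : ∀ x, 0 < m {x} ∧ m {x} < ∞) {f : X → ℝ} :
    f ∈ G.dirichletDomain m ↔ f ∈ G.dirichletSpace m := by
  have key : ∀ {f : X → ℝ}, f ∈ G.formDomain m → ∀ {u : ℕ → X → ℝ},
      (∀ n, (Function.support (u n)).Finite) →
      (Tendsto (fun n => G.energy (f - u n) + eLpNorm (f - u n) 2 m ^ 2) atTop (𝓝 0) ↔
        Tendsto (fun n => G.oneForm m (f - u n) (f - u n)) atTop (𝓝 0)) := by
    intro f hf u hu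
    simp only [fun n => energy_add_eLpNorm_eq hm (sub_mem hf (finite_support_mem hm (hu n)))]
    constructor
    · intro h
      have h1 := (ENNReal.tendsto_toReal ENNReal.zero_ne_top).comp h
      simpa [Function.comp_def, ENNReal.toReal_ofReal (oneForm_self_nonneg _)] using h1
    · intro h
      simpa using ENNReal.tendsto_ofReal h
  constructor
  · rintro ⟨h1, u, hu, hlim⟩
    have hf := (mem_neumannDomain_iff hm).1 h1
    exact mem_dirichletSpace_of_approx hm hf hu ((key hf hu).1 hlim)
  · intro hf
    obtain ⟨u, hu, hlim⟩ := exists_approx hm hf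
    exact ⟨(mem_neumannDomain_iff hm).2 hf.1, u, hu, (key hf.1 hu).2 hlim⟩

lemma oneForm_le_two_mul {f g : X → ℝ} (hf : f ∈ G.formDomain m) (hg : g ∈ G.formDomain m) :
    G.oneForm m f f ≤ 2 * G.oneForm m g g + 2 * G.oneForm m (g - f) (g - f) := by
  have h := (mem_formDomain_of_abs_coord_le_add (f := f) hg (sub_mem hg hf) (r := 1) (s := 1)
    fun i => ?_).2
  · simpa using h
  · have : G.coord m f i = G.coord m g i - G.coord m (g - f) i := by simp
    rw [this, one_mul, one_mul]
    exact abs_sub _ _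

/-- An element of `D(Q⁽ᴰ⁾)` is the pointwise limit of a bounded sequence of finitely supported
functions. -/
lemma exists_bounded_approx (hm : ∀ x, 0 < m {x} ∧ m {x} < ∞) {f : X → ℝ}
    (hf : f ∈ G.dirichletSpace m) :
    ∃ (u : ℕ → X → ℝ) (M : ℝ), (∀ n, (Function.support (u n)).Finite) ∧
      (∀ n, G.oneForm m (u n) (u n) ≤ M) ∧
      ∀ x, Tendsto (fun n => u n x) atTop (𝓝 (f x)) := by
  obtain ⟨u, hu, hlim⟩ := exists_approx hm hf
  obtain ⟨B, hB⟩ := hlim.bddAbove_range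
  refine ⟨u, 2 * G.oneForm m f f + 2 * B, hu, fun n => ?_, fun x => ?_⟩
  · have h1 := oneForm_le_two_mul (finite_support_mem hm (hu n)) hf.1
    have h2 : G.oneForm m (f - u n) (f - u n) ≤ B := hB ⟨n, rfl⟩
    linarith
  · have hpos : 0 < m.real {x} := ENNReal.toReal_pos (hm x).1.ne' (hm x).2.ne
    have h1 : Tendsto (fun n => (f x - u n x) ^ 2) atTop (𝓝 0) := by
      have h2 : Tendsto (fun n => G.oneForm m (f - u n) (f - u n) / m.real {x}) atTop (𝓝 0) := by
        simpa using hlim.div_const (m.real {x})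
      refine squeeze_zero (fun n => sq_nonneg _) (fun n => ?_) h2
      rw [le_div_iff₀' hpos]
      exact mass_mul_sq_le (sub_mem hf.1 (finite_support_mem hm (hu n))) x
    have h3 : Tendsto (fun n => f x - u n x) atTop (𝓝 0) := by
      have h4 := h1.sqrt
      simp only [Real.sqrt_sq_eq_abs, Real.sqrt_zero] at h4
      exact (tendsto_zero_iff_abs_tendsto_zero _).2 h4
    simpa using h3.const_sub (f x)

/-- The `1`-Green function. -/
lemma exists_green (hm : ∀ x, 0 < m {x} ∧ m {x} < ∞) (o : X) :
    ∃ g ∈ G.dirichletSpace m, ∀ v ∈ G.dirichletSpace m, G.oneForm m g v = v o := by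
  classical
  have hpos : 0 < √(G.c o + m.real {o}) :=
    Real.sqrt_pos.2 (add_pos_of_nonneg_of_pos (G.c_nonneg o)
      (ENNReal.toReal_pos (hm o).1.ne' (hm o).2.ne))
  -- The family supported at the vertex coordinate of `o`, with the inverse weight, represents v ↦
  -- v(o) in ℓ²; its projection is the reproducing element.
  obtain ⟨g, hg, ⟨u, hu, hlim⟩, hor⟩ := exists_projection (G := G) hm
    (lp.single 2 (Sum.inr o) (√(G.c o + m.real {o}))⁻¹)
  have hg0 := mem_dirichletSpace_of_approx hm hg hu hlim
  have hx : ∀ x, G.oneForm m g (vertexFn x) = vertexFn x o := fun x => by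
    rw [← hor x, tsum_eq_single (Sum.inr o)]
    · rw [lp.single_apply_self, coord_inr, inv_mul_cancel_left₀ hpos.ne']
    · intro j hj
      rw [lp.single_apply_ne _ _ _ hj, zero_mul]
  have hfin : ∀ v : X → ℝ, (Function.support v).Finite → G.oneForm m v g = v o := by
    intro v hv
    have hle : ∀ s : Finset X, G.oneForm m (∑ x ∈ s, v x • vertexFn x) g
        = (∑ x ∈ s, v x • vertexFn x : X → ℝ) o := by
      intro s
      induction s using Finset.induction_on with
      | empty => simp [oneForm_zero_left]
      | insert a s ha ih =>
        rw [Finset.sum_insert ha, oneForm_add_left (Submodule.smul_mem _ _ (vertexFn_mem hm a))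
          (Submodule.sum_mem _ fun x _ => Submodule.smul_mem _ _ (vertexFn_mem hm x)) hg, ih,
          oneForm_smul_left, oneForm_comm, hx a]
        simp
    rw [eq_sum_vertexFn hv]
    exact hle _
  refine ⟨g, hg0, fun v hv => ?_⟩
  -- Passage from finitely supported functions to `v`: weak convergence on the left, pointwise
  -- convergence on the right.
  obtain ⟨w, M, hw, hM, hwv⟩ := exists_bounded_approx hm hv
  have h1 := (mem_formDomain_of_tendsto (fun n => finite_support_mem hm (hw n)) hM hwv).2.2 g hg
  simp only [hfin _ (hw _)] at h1
  rw [oneForm_comm]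
  exact tendsto_nhds_unique h1 (hwv o)

end Projection

end WeightedGraph
end

noncomputable section

/-! ### Normal contractions -/

lemma lipschitz_of_abs_le {C : ℝ → ℝ} (h : ∀ u w, |C u - C w| ≤ |u - w|) : LipschitzWith 1 C :=
  LipschitzWith.of_dist_le_mul fun u w => by simpa [Real.dist_eq] using h u w

/-- Truncation at `-M` and `M`. -/
def truncate (M t : ℝ) : ℝ := max (-M) (min t M)

lemma truncate_lipschitz (M : ℝ) : LipschitzWith 1 (truncate M) :=
  lipschitz_of_abs_le fun u w => (abs_max_sub_max_le_max _ _ _ _).trans <| by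
    rw [sub_self, abs_zero, max_eq_right (abs_nonneg _)]
    refine (abs_min_sub_min_le_max _ _ _ _).trans ?_
    rw [sub_self, abs_zero, max_eq_left (abs_nonneg _)]

lemma truncate_zero {M : ℝ} (hM : 0 ≤ M) : truncate M 0 = 0 := by
  rw [truncate, min_eq_left hM, max_eq_right (by linarith)]

lemma abs_truncate_le {M : ℝ} (hM : 0 ≤ M) (t : ℝ) : |truncate M t| ≤ M :=
  abs_le.2 ⟨le_max_left _ _, max_le (by linarith) (min_le_right _ _)⟩

lemma truncate_eq_self {M t : ℝ} (h : |t| ≤ M) : truncate M t = t := by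
  rw [truncate, min_eq_left (abs_le.1 h).2, max_eq_right (abs_le.1 h).1]

lemma abs_truncate_lt_iff {M t r : ℝ} (hr : r ≤ M) (h : |truncate M t| < r) :
    |t| < r ∧ truncate M t = t := by
  have h1 := abs_lt.1 h
  rw [truncate] at h1
  have h3 : t < r := by
    by_contra h3
    push Not at h3
    have : r ≤ max (-M) (min t M) := le_max_of_le_right (le_min h3 hr)
    linarith
  have h4 : -r < t := by
    by_contra h4
    push Not at h4
    have : max (-M) (min t M) ≤ -r := max_le (by linarith) ((min_le_left _ _).trans h4)
    linarith
  have h5 : |t| < r := abs_lt.2 ⟨h4, h3⟩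
  exact ⟨h5, truncate_eq_self (h5.le.trans hr)⟩

/-- Positive part above the level `c`. -/
lemma excess_lipschitz (c : ℝ) : LipschitzWith 1 fun t : ℝ => max (t - c) 0 :=
  lipschitz_of_abs_le fun u w => (abs_max_sub_max_le_max _ _ _ _).trans <| by simp

/-- The positive part, truncated at `c`. -/
lemma min_max_lipschitz (c : ℝ) : LipschitzWith 1 fun t : ℝ => min (max t 0) c :=
  lipschitz_of_abs_le fun u w => (abs_min_sub_min_le_max _ _ _ _).trans <| by
    rw [sub_self, abs_zero, max_eq_left (abs_nonneg _)]
    exact (abs_max_sub_max_le_max _ _ _ _).trans (by simp)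

/-- The absolute value, truncated at `c`. -/
lemma min_abs_lipschitz (c : ℝ) : LipschitzWith 1 fun t : ℝ => min |t| c :=
  lipschitz_of_abs_le fun u w => (abs_min_sub_min_le_max _ _ _ _).trans <| by
    rw [sub_self, abs_zero, max_eq_left (abs_nonneg _)]
    exact abs_abs_sub_abs_le _ _

namespace WeightedGraph

variable {X : Type*} [MeasurableSpace X] {G : WeightedGraph X} {m : Measure X}

/-- Discrete Leibniz rule: the increment of fg along (x, y) is g(x)(f x − f y) + f(y)(g x − g y). -/
lemma mul_bounded_mem {f g : X → ℝ} {r s : ℝ} (hf : f ∈ G.formDomain m)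
    (hg : g ∈ G.formDomain m) (hr : ∀ x, |f x| ≤ r) (hs : ∀ x, |g x| ≤ s) :
    f * g ∈ G.formDomain m ∧
      G.oneForm m (f * g) (f * g)
        ≤ 2 * s ^ 2 * G.oneForm m f f + 2 * r ^ 2 * G.oneForm m g g := by
  refine mem_formDomain_of_abs_coord_le_add hf hg (abs_coord_le_add_of_le (fun x => ?_)
    fun x y => ?_)
  · have hr0 : 0 ≤ r := (abs_nonneg _).trans (hr x)
    rw [Pi.mul_apply, abs_mul, mul_comm]
    exact (mul_le_mul_of_nonneg_right (hs x) (abs_nonneg _)).trans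
      (le_add_of_nonneg_right (mul_nonneg hr0 (abs_nonneg _)))
  · have : (f * g) x - (f * g) y = g x * (f x - f y) + f y * (g x - g y) := by
      simp only [Pi.mul_apply]; ring
    rw [this]
    refine (abs_add_le _ _).trans (add_le_add ?_ ?_)
    · rw [abs_mul]; exact mul_le_mul_of_nonneg_right (hs x) (abs_nonneg _)
    · rw [abs_mul]; exact mul_le_mul_of_nonneg_right (hr y) (abs_nonneg _)

/-! ### Contractions and ideal properties of D(Q⁽ᴰ⁾) -/

section DirichletSpace

variable [Countable X] [DiscreteMeasurableSpace X]

/-- Normal contractions operate on `D(Q⁽ᴰ⁾)`. -/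
lemma contraction_mem_dirichletSpace (hm : ∀ x, 0 < m {x} ∧ m {x} < ∞) {C : ℝ → ℝ}
    (hC : LipschitzWith 1 C) (h0 : C 0 = 0) {f : X → ℝ} (hf : f ∈ G.dirichletSpace m) :
    (fun x => C (f x)) ∈ G.dirichletSpace m := by
  obtain ⟨u, M, hu, hM, hlim⟩ := exists_bounded_approx hm hf
  refine mem_dirichletSpace_of_tendsto (f := fun n x => C (u n x)) (M := M) (fun n => ?_)
    (fun n => ?_) fun x => (hC.continuous.tendsto _).comp (hlim x)
  · refine finite_support_mem_dirichletSpace hm ((hu n).subset ?_)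
    intro x hx hx0
    exact hx (by simp [hx0, h0])
  · exact (contraction_mem hC h0 (finite_support_mem hm (hu n))).2.trans (hM n)

/-- `D(Q⁽ᴰ⁾)` is an order ideal in `D(Q⁽ᴺ⁾)`. -/
lemma mem_dirichletSpace_of_le (hm : ∀ x, 0 < m {x} ∧ m {x} < ∞) {f g : X → ℝ}
    (hf : f ∈ G.formDomain m) (hg : g ∈ G.dirichletSpace m) (h0 : ∀ x, 0 ≤ f x)
    (hle : ∀ x, f x ≤ g x) : f ∈ G.dirichletSpace m := by
  obtain ⟨u, M, hu, hM, hlim⟩ := exists_bounded_approx hm hg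
  -- The functions min(f, |uₙ|) have finite support and bounded form norm, and converge pointwise to
  -- min(f, |g|) = f.
  have key : ∀ n, (fun x => min (f x) |u n x|) ∈ G.formDomain m ∧ _ := fun n =>
    mem_formDomain_of_abs_coord_le_add (f := fun x => min (f x) |u n x|) hf
      (finite_support_mem hm (hu n)) (r := 1) (s := 1) (abs_coord_le_add_of_le (fun x => by
        rw [abs_of_nonneg (le_min (h0 x) (abs_nonneg _)), one_mul, one_mul]
        exact (min_le_right _ _).trans (le_add_of_nonneg_left (abs_nonneg _)))
        fun x y => (abs_min_sub_min_le_max _ _ _ _).trans (by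
          rw [one_mul, one_mul]
          exact max_le (le_add_of_nonneg_right (abs_nonneg _))
            ((abs_abs_sub_abs_le _ _).trans (le_add_of_nonneg_left (abs_nonneg _)))))
  refine mem_dirichletSpace_of_tendsto (f := fun n x => min (f x) |u n x|)
    (M := 2 * G.oneForm m f f + 2 * M) (fun n => ?_) (fun n => ?_) fun x => ?_
  · refine finite_support_mem_dirichletSpace hm ((hu n).subset ?_)
    intro x hx hx0
    exact hx (by simp [hx0, h0])
  · have h1 := (key n).2
    have h2 := hM n
    linarith
  · have h1 := (tendsto_const_nhds (x := f x)).min (hlim x).abs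
    rwa [min_eq_left ((hle x).trans (le_abs_self _))] at h1

/-- Approximants of `f`, truncated at its bound `r`, are uniformly bounded, so their products with
`g` are bounded in form norm; these products still have finite support. -/
lemma mul_mem_dirichletSpace (hm : ∀ x, 0 < m {x} ∧ m {x} < ∞) {f g : X → ℝ} {r s : ℝ}
    (hf : f ∈ G.dirichletSpace m) (hg : g ∈ G.formDomain m) (hr : ∀ x, |f x| ≤ r)
    (hs : ∀ x, |g x| ≤ s) : f * g ∈ G.dirichletSpace m := by
  obtain ⟨u, M, hu, hM, hlim⟩ := exists_bounded_approx hm hf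
  rcases isEmpty_or_nonempty X with hX | ⟨⟨x₀⟩⟩
  · rw [Subsingleton.elim (f * g) 0]
    exact zero_mem _
  have hr0 : 0 ≤ r := (abs_nonneg _).trans (hr x₀)
  have hsupp : ∀ n, (Function.support fun x => truncate r (u n x)).Finite := fun n => by
    refine (hu n).subset ?_
    intro x hx hx0
    exact hx (by simp [hx0, truncate_zero hr0])
  have hcon := fun n => contraction_mem (truncate_lipschitz r) (truncate_zero hr0)
    (finite_support_mem (G := G) hm (hu n))
  refine mem_dirichletSpace_of_tendsto (f := fun n => (fun x => truncate r (u n x)) * g)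
    (M := 2 * s ^ 2 * M + 2 * r ^ 2 * G.oneForm m g g) (fun n => ?_) (fun n => ?_) fun x => ?_
  · refine finite_support_mem_dirichletSpace hm ((hsupp n).subset ?_)
    exact Function.support_mul_subset_left _ _
  · refine (mul_bounded_mem (hcon n).1 hg (fun x => abs_truncate_le hr0 _) hs).2.trans ?_
    have h1 := mul_le_mul_of_nonneg_left ((hcon n).2.trans (hM n)) (sq_nonneg s)
    linarith
  · have h1 := ((truncate_lipschitz r).continuous.tendsto _).comp (hlim x)
    rw [truncate_eq_self (hr x)] at h1
    exact h1.mul_const _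

/-- The `1`-Green function is nonnegative and bounded. -/
lemma exists_bounded_green (hm : ∀ x, 0 < m {x} ∧ m {x} < ∞) (o : X) :
    ∃ g ∈ G.dirichletSpace m, (∀ v ∈ G.dirichletSpace m, G.oneForm m g v = v o) ∧
      (∀ x, 0 ≤ g x) ∧ ∀ x, g x ≤ g o := by
  obtain ⟨g, hg, hgv⟩ := exists_green (G := G) hm o
  have h0 : 0 ≤ g o := by rw [← hgv g hg]; exact oneForm_self_nonneg g
  -- The contraction k = C ∘ g satisfies k(o) = g(o) and Q₁(k) ≤ Q₁(g) = g(o). By the reproducing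
  -- property Q₁(k − g) = Q₁(k) − 2k(o) + g(o) ≤ 0, so g = min(|g|, g(o)).
  let C : ℝ → ℝ := fun t => min |t| (g o)
  have hC0 : C 0 = 0 := by simp [C, h0]
  have hk : (fun x => C (g x)) ∈ G.dirichletSpace m :=
    contraction_mem_dirichletSpace hm (min_abs_lipschitz (g o)) hC0 hg
  have hk2 := (contraction_mem (min_abs_lipschitz (g o)) hC0 hg.1).2
  set k : X → ℝ := fun x => C (g x) with hkdef
  have hko : k o = g o := by simp [hkdef, C, abs_of_nonneg h0]
  have hkg : k - g = 0 := by
    refine eq_zero_of_oneForm_self hm (sub_mem hk.1 hg.1) (le_antisymm ?_ (oneForm_self_nonneg _))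
    rw [oneForm_sub_left hk.1 hg.1 (sub_mem hk.1 hg.1), oneForm_sub_right hk.1 hg.1 hk.1,
      oneForm_sub_right hk.1 hg.1 hg.1, hgv k hk, oneForm_comm k g, hgv k hk, hgv g hg, hko]
    have h2 : G.oneForm m k k ≤ G.oneForm m g g := hk2
    rw [hgv g hg] at h2
    linarith
  have hkx : ∀ x, g x = min |g x| (g o) := fun x => (congrFun (sub_eq_zero.1 hkg) x).symm
  exact ⟨g, hg, hgv, fun x => by rw [hkx x]; exact le_min (abs_nonneg _) h0,
    fun x => by rw [hkx x]; exact min_le_right _ _⟩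

end DirichletSpace

/-! ### Limits at the points of the compactification -/

/-- The trace on `X` of the neighbourhoods of a point of the compactification. -/
def nhdsTrace (z : G.RoydenCompactification m) : Filter X := comap (G.toRoyden m) (𝓝 z)

section Limits

variable [Countable X] [DiscreteMeasurableSpace X]

lemma nhdsTrace_neBot (hm : ∀ x, 0 < m {x} ∧ m {x} < ∞) (z : G.RoydenCompactification m) :
    (nhdsTrace z).NeBot :=
  comap_neBot_iff_frequently.2 <| by
    have h := (G.roydenCompactification_spec m hm).2.2.2.1 z
    exact (mem_closure_iff_frequently.1 h)

/-- A bounded function of `D(Q⁽ᴺ⁾)`. -/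
def toBounded (hm : ∀ x, 0 < m {x} ∧ m {x} < ∞) {f : X → ℝ} (hf : f ∈ G.formDomain m) {M : ℝ}
    (hM : ∀ x, |f x| ≤ M) : G.BoundedNeumann m :=
  ⟨f, (mem_neumannDomain_iff hm).2 hf, M, hM⟩

lemma tendsto_boundedExtension (hm : ∀ x, 0 < m {x} ∧ m {x} < ∞) (f : G.BoundedNeumann m)
    (z : G.RoydenCompactification m) :
    Tendsto f.1 (nhdsTrace z) (𝓝 (G.boundedExtension m f z)) := by
  have h := ((G.roydenCompactification_spec m hm).2.2.2.2.2.1 f).tendsto z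
  exact h.comp tendsto_comap

/-- The functions in `D(Q⁽ᴺ⁾)` have limits in `[-∞, ∞]` at all points of the compactification. -/
lemma exists_tendsto (hm : ∀ x, 0 < m {x} ∧ m {x} < ∞) {f : X → ℝ} (hf : f ∈ G.formDomain m)
    (z : G.RoydenCompactification m) :
    ∃ c : EReal, Tendsto (fun x => (f x : EReal)) (nhdsTrace z) (𝓝 c) := by
  refine tendsto_of_no_upcrossings (s := Set.range ((↑) : ℝ → EReal))
    (dense_of_exists_between fun a b hab => ?_) ?_
  · obtain ⟨r, h1, h2⟩ := EReal.lt_iff_exists_real_btwn.1 hab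
    exact ⟨r, ⟨r, rfl⟩, h1, h2⟩
  rintro _ ⟨a, rfl⟩ _ ⟨b, rfl⟩ hab ⟨h1, h2⟩
  have hab' : a < b := EReal.coe_lt_coe_iff.1 hab
  -- At this level, truncation does not affect comparison with `a` and `b`. The truncated function
  -- is bounded and of finite energy, hence has a limit and cannot oscillate across [a, b].
  let M := |a| + |b|
  have hM : 0 ≤ M := add_nonneg (abs_nonneg _) (abs_nonneg _)
  have hlim := tendsto_boundedExtension hm (toBounded hm
    (contraction_mem (truncate_lipschitz M) (truncate_zero hM) hf).1
    (fun x => abs_truncate_le hM _)) z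
  set r := G.boundedExtension m (toBounded hm
    (contraction_mem (truncate_lipschitz M) (truncate_zero hM) hf).1
    (fun x => abs_truncate_le hM _)) z
  have ha : a ≤ M := (le_abs_self a).trans (le_add_of_nonneg_right (abs_nonneg _))
  have ha' : -M ≤ a := by
    have := neg_abs_le a
    have := abs_nonneg b
    simp only [M]; linarith
  have hb : b ≤ M := (le_abs_self b).trans (le_add_of_nonneg_left (abs_nonneg _))
  have hr1 : r ≤ a := by
    refine le_of_tendsto_of_frequently hlim (h1.mono fun x hx => ?_)
    have hx' : f x < a := EReal.coe_lt_coe_iff.1 hx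
    exact max_le ha' ((min_le_left _ _).trans hx'.le)
  have hr2 : b ≤ r := by
    refine ge_of_tendsto_of_frequently hlim (h2.mono fun x hx => ?_)
    have hx' : b < f x := EReal.coe_lt_coe_iff.1 hx
    exact le_max_of_le_right (le_min hx'.le hb)
  linarith

lemma tendsto_trace (hm : ∀ x, 0 < m {x} ∧ m {x} < ∞) {f : X → ℝ} (hf : f ∈ G.formDomain m)
    (z : G.HarmonicBoundary m) :
    Tendsto (fun x => (f x : EReal)) (nhdsTrace z.1) (𝓝 (G.trace m f z)) :=
  tendsto_nhds_limUnder (exists_tendsto hm hf z.1)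

lemma trace_eq_of_tendsto (hm : ∀ x, 0 < m {x} ∧ m {x} < ∞) {f : X → ℝ}
    {z : G.HarmonicBoundary m} {c : EReal}
    (h : Tendsto (fun x => (f x : EReal)) (nhdsTrace z.1) (𝓝 c)) : G.trace m f z = c := by
  have := nhdsTrace_neBot hm z.1
  exact h.limUnder_eq

lemma trace_eq_coe_iff (hm : ∀ x, 0 < m {x} ∧ m {x} < ∞) {f : X → ℝ} (hf : f ∈ G.formDomain m)
    {z : G.HarmonicBoundary m} {r : ℝ} :
    G.trace m f z = r ↔ Tendsto f (nhdsTrace z.1) (𝓝 r) := by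
  constructor
  · intro h
    have h1 := tendsto_trace hm hf z
    rw [h] at h1
    exact EReal.tendsto_coe.1 h1
  · exact fun h => trace_eq_of_tendsto hm (EReal.tendsto_coe.2 h)

lemma mem_formDomain_of_bounded (hm : ∀ x, 0 < m {x} ∧ m {x} < ∞) (f : G.BoundedNeumann m) :
    f.1 ∈ G.formDomain m := (mem_neumannDomain_iff hm).1 f.2.1

lemma tendsto_boundedTrace (hm : ∀ x, 0 < m {x} ∧ m {x} < ∞) (f : G.BoundedNeumann m)
    (z : G.HarmonicBoundary m) : Tendsto f.1 (nhdsTrace z.1) (𝓝 (G.boundedTrace m f z)) :=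
  tendsto_boundedExtension hm f z.1

lemma trace_bounded (hm : ∀ x, 0 < m {x} ∧ m {x} < ∞) (f : G.BoundedNeumann m)
    (z : G.HarmonicBoundary m) : G.trace m f.1 z = G.boundedTrace m f z :=
  trace_eq_of_tendsto hm (EReal.tendsto_coe.2 (tendsto_boundedTrace hm f z))

/-- Truncation at level one is inactive as soon as the truncated value has modulus below one. -/
lemma tendsto_zero_of_truncate {ι : Type*} {l : Filter ι} {f : ι → ℝ}
    (h : Tendsto (fun x => truncate 1 (f x)) l (𝓝 0)) : Tendsto f l (𝓝 0) := by
  refine h.congr' ?_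
  filter_upwards [Metric.tendsto_nhds.1 h 1 one_pos] with x hx
  rw [Real.dist_eq, sub_zero] at hx
  exact (abs_truncate_lt_iff le_rfl hx).2

/-- Functions in `D(Q⁽ᴰ⁾)` vanish at the harmonic boundary. -/
lemma tendsto_zero_of_mem_dirichletSpace (hm : ∀ x, 0 < m {x} ∧ m {x} < ∞) {f : X → ℝ}
    (hf : f ∈ G.dirichletSpace m) (z : G.HarmonicBoundary m) :
    Tendsto f (nhdsTrace z.1) (𝓝 0) := by
  have h1 := contraction_mem_dirichletSpace hm (truncate_lipschitz 1) (truncate_zero one_pos.le) hf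
  let F := toBounded hm h1.1 fun x => abs_truncate_le one_pos.le (f x)
  have h2 : Tendsto (fun x => truncate 1 (f x)) (nhdsTrace z.1)
      (𝓝 (G.boundedExtension m F z.1)) := tendsto_boundedExtension hm F z.1
  have h3 : G.boundedExtension m F z.1 = 0 := z.2.2 F ((mem_dirichletDomain_iff hm).2 h1)
  rw [h3] at h2
  exact tendsto_zero_of_truncate h2

/-- Away from the harmonic boundary there is a function in `D(Q⁽ᴰ⁾)` that is at least one. -/
lemma exists_one_le_of_isCompact (hm : ∀ x, 0 < m {x} ∧ m {x} < ∞)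
    {K : Set (G.RoydenCompactification m)} (hK : IsCompact K)
    (hKb : ∀ z : G.HarmonicBoundary m, z.1 ∉ K) :
    ∃ g ∈ G.dirichletSpace m, (∀ x, 0 ≤ g x) ∧ ∀ x, G.toRoyden m x ∈ K → 1 ≤ g x := by
  -- The property passes to subsets and, by adding the functions, to finite unions. Compactness
  -- reduces it to neighbourhoods of single points.
  refine hK.induction_on (p := fun s => ∃ g ∈ G.dirichletSpace m, (∀ x, 0 ≤ g x) ∧
    ∀ x, G.toRoyden m x ∈ s → 1 ≤ g x) ?_ ?_ ?_ ?_
  · exact ⟨0, zero_mem _, fun _ => le_rfl, fun x hx => absurd hx (Set.notMem_empty _)⟩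
  · rintro s t hst ⟨g, hg, h0, h1⟩
    exact ⟨g, hg, h0, fun x hx => h1 x (hst hx)⟩
  · rintro s t ⟨g, hg, h0, h1⟩ ⟨g', hg', h0', h1'⟩
    refine ⟨g + g', add_mem hg hg', fun x => add_nonneg (h0 x) (h0' x), ?_⟩
    rintro x (hx | hx)
    · exact (h1 x hx).trans (le_add_of_nonneg_right (h0' x))
    · exact (h1' x hx).trans (le_add_of_nonneg_left (h0 x))
  · intro z hz
    -- A point of X is detected by its characteristic function, any other point of K by the
    -- definition of ∂X.
    have key : ∃ f : G.BoundedNeumann m, f.1 ∈ G.dirichletSpace m ∧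
        G.boundedExtension m f z ≠ 0 := by
      by_cases hzX : z ∈ Set.range (G.toRoyden m)
      · obtain ⟨x, rfl⟩ := hzX
        refine ⟨toBounded hm (vertexFn_mem hm x) (M := 1) fun y => ?_,
          finite_support_mem_dirichletSpace hm (support_vertexFn x), ?_⟩
        · by_cases hy : y = x
          · simp [hy]
          · simp [vertexFn_of_ne hy]
        · rw [(G.roydenCompactification_spec m hm).2.2.2.2.2.2.1]
          change vertexFn x x ≠ 0
          simp
      · by_contra hcon
        push Not at hcon
        exact hKb ⟨z, hzX, fun f hf => hcon f ((mem_dirichletDomain_iff hm).1 hf)⟩ hz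
    obtain ⟨f, hf, hfz⟩ := key
    have hcont := (G.roydenCompactification_spec m hm).2.2.2.2.2.1 f
    set r := |G.boundedExtension m f z| / 2
    have hr : 0 < r := half_pos (abs_pos.2 hfz)
    refine ⟨{w | r < |G.boundedExtension m f w|}, mem_nhdsWithin_of_mem_nhds
      ((isOpen_lt continuous_const hcont.abs).mem_nhds (half_lt_self (abs_pos.2 hfz))), ?_⟩
    refine ⟨r⁻¹ • fun x => |f.1 x|, Submodule.smul_mem _ _ (contraction_mem_dirichletSpace hm
      (lipschitz_of_abs_le fun u w => abs_abs_sub_abs_le u w) abs_zero hf), fun x => ?_,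
      fun x hx => ?_⟩
    · exact mul_nonneg (inv_nonneg.2 hr.le) (abs_nonneg _)
    · rw [Set.mem_ofPred_eq, (G.roydenCompactification_spec m hm).2.2.2.2.2.2.1] at hx
      rw [Pi.smul_apply, smul_eq_mul, inv_mul_eq_div, le_div_iff₀ hr, one_mul]
      exact hx.le

/-- Functions in `D(Q⁽ᴺ⁾)` that vanish at the harmonic boundary are in `D(Q⁽ᴰ⁾)`. -/
lemma mem_dirichletSpace_of_tendsto_zero (hm : ∀ x, 0 < m {x} ∧ m {x} < ∞) {f : X → ℝ}
    (hf : f ∈ G.formDomain m)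
    (h : ∀ z : G.HarmonicBoundary m, Tendsto f (nhdsTrace z.1) (𝓝 0)) :
    f ∈ G.dirichletSpace m := by
  have bounded : ∀ {f : X → ℝ} {M : ℝ}, f ∈ G.formDomain m →
      (∀ z : G.HarmonicBoundary m, Tendsto f (nhdsTrace z.1) (𝓝 0)) →
      (∀ x, 0 ≤ f x) → (∀ x, f x ≤ M) → f ∈ G.dirichletSpace m := by
    intro f M hf h h0 hM
    have habs : ∀ x, |f x| ≤ M := fun x => by rw [abs_of_nonneg (h0 x)]; exact hM x
    let F := toBounded hm hf habs
    have hspec := G.roydenCompactification_spec m hm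
    have hF := hspec.2.2.2.2.2.1 F
    -- The compact set where the extension of f is at least ε misses ∂X. Some `g ∈ D(Q⁽ᴰ⁾)` is at
    -- least one on it, and (f − ε)₊ ≤ M g puts (f − ε)₊ in D(Q⁽ᴰ⁾). Afterwards ε → 0.
    have hε : ∀ ε : ℝ, 0 < ε → (fun x => max (f x - ε) 0) ∈ G.dirichletSpace m := by
      intro ε hε
      have := hspec.1
      have hK : IsCompact {z | ε ≤ G.boundedExtension m F z} :=
        (isClosed_le continuous_const hF).isCompact
      obtain ⟨g, hg, hg0, hg1⟩ := exists_one_le_of_isCompact hm hK fun z hz => by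
        have := nhdsTrace_neBot hm z.1
        rw [Set.mem_ofPred_eq, tendsto_nhds_unique (tendsto_boundedExtension hm F z.1) (h z)] at hz
        linarith
      refine mem_dirichletSpace_of_le hm (contraction_mem (excess_lipschitz ε)
        (by simp [hε.le]) hf).1 (Submodule.smul_mem _ M hg) (fun x => le_max_right _ _) fun x => ?_
      have hM0 : 0 ≤ M := (h0 x).trans (hM x)
      rw [Pi.smul_apply, smul_eq_mul]
      by_cases hx : ε ≤ f x
      · refine max_le ?_ (mul_nonneg hM0 (hg0 x))
        have h1 : 1 ≤ g x := hg1 x hx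
        nlinarith [hM x]
      · rw [max_eq_right (by linarith)]
        exact mul_nonneg hM0 (hg0 x)
    refine mem_dirichletSpace_of_tendsto (f := fun (n : ℕ) x => max (f x - 1 / ((n : ℝ) + 1)) 0)
      (fun n => hε _ (by positivity)) (fun n => (contraction_mem (excess_lipschitz _)
        (by simpa using (by positivity : (0 : ℝ) ≤ (n : ℝ) + 1)) hf).2) fun x => ?_
    have h1 := ((tendsto_one_div_add_atTop_nhds_zero_nat (𝕜 := ℝ)).const_sub (f x)).max
      (tendsto_const_nhds (x := (0 : ℝ)))
    simpa [h0 x] using h1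
  have positive : ∀ {f : X → ℝ}, f ∈ G.formDomain m →
      (∀ z : G.HarmonicBoundary m, Tendsto f (nhdsTrace z.1) (𝓝 0)) →
      (fun x => max (f x) 0) ∈ G.dirichletSpace m := by
    intro f hf h
    have h0 : ∀ n : ℕ, min (max (0 : ℝ) 0) n = 0 := fun n => by simp
    refine mem_dirichletSpace_of_tendsto (f := fun (n : ℕ) x => min (max (f x) 0) n)
      (fun n => bounded (contraction_mem (min_max_lipschitz n) (h0 n) hf).1 (fun z => ?_)
        (fun x => le_min (le_max_right _ _) n.cast_nonneg) fun x => min_le_right _ _)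
      (fun n => (contraction_mem (min_max_lipschitz n) (h0 n) hf).2) fun x => ?_
    · have h1 := ((min_max_lipschitz n).continuous.tendsto 0).comp (h z)
      simp only [h0] at h1
      exact h1
    · refine tendsto_const_nhds.congr' ?_
      obtain ⟨N, hN⟩ := exists_nat_ge (max (f x) 0)
      filter_upwards [eventually_ge_atTop N] with n hn
      rw [min_eq_left (hN.trans (by exact_mod_cast hn))]
  have h1 := positive hf h
  have h2 := positive (neg_mem hf) fun z => by
    have := (h z).neg
    rw [neg_zero] at this
    exact this
  have h3 := sub_mem h1 h2
  convert h3 using 1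
  ext x
  rw [Pi.sub_apply, Pi.neg_apply]
  rcases le_total (f x) 0 with h4 | h4
  · rw [max_eq_right h4, max_eq_left (by linarith)]; ring
  · rw [max_eq_left h4, max_eq_right (by linarith)]; ring

/-- The difference tends to zero at ∂X. As zero is finite, addition in `EReal` is continuous there,
even where the trace of `f` is infinite. -/
lemma trace_eq_of_sub_mem (hm : ∀ x, 0 < m {x} ∧ m {x} < ∞) {f g : X → ℝ}
    (hf : f ∈ G.formDomain m) (h : f - g ∈ G.dirichletSpace m) : G.trace m f = G.trace m g := by
  funext z
  refine (trace_eq_of_tendsto hm ?_).symm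
  have h1 : Tendsto (fun x => ((-(f - g) x : ℝ) : EReal)) (nhdsTrace z.1) (𝓝 ((0 : ℝ) : EReal)) := by
    refine EReal.tendsto_coe.2 ?_
    simpa using (tendsto_zero_of_mem_dirichletSpace hm h z).neg
  have h2 := (EReal.continuousAt_add (p := (G.trace m f z, ((0 : ℝ) : EReal)))
    (Or.inr (by simp)) (Or.inr (by simp))).tendsto.comp
      ((tendsto_trace hm hf z).prodMk_nhds h1)
  simp only [EReal.coe_zero, add_zero] at h2
  refine h2.congr fun x => ?_
  simp only [Function.comp_apply, ← EReal.coe_add, Pi.sub_apply]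
  congr 1
  ring

/-- Maximum principle. -/
lemma le_of_mem_harmonicSpace (hm : ∀ x, 0 < m {x} ∧ m {x} < ∞) {h : X → ℝ}
    (hh : h ∈ G.harmonicSpace m) {c : ℝ} (hc : 0 ≤ c)
    (hb : ∀ z : G.HarmonicBoundary m, ∃ r ≤ c, Tendsto h (nhdsTrace z.1) (𝓝 r)) (x : X) :
    h x ≤ c := by
  have hC0 : max ((0 : ℝ) - c) 0 = 0 := by simp [hc]
  have hv := (contraction_mem (excess_lipschitz c) hC0 hh.1).1
  set v : X → ℝ := fun x => max (h x - c) 0 with hvdef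
  have hv0 : v ∈ G.dirichletSpace m := by
    refine mem_dirichletSpace_of_tendsto_zero hm hv fun z => ?_
    obtain ⟨r, hr, hrz⟩ := hb z
    have h1 := ((excess_lipschitz c).continuous.tendsto r).comp hrz
    rwa [max_eq_right (by linarith : r - c ≤ 0)] at h1
  -- For v = (h − c)₊ this holds coordinate by coordinate; the vertex terms need `0 ≤ c`. The right
  -- side is zero, since v ∈ D(Q⁽ᴰ⁾) and h is 1-harmonic.
  have h1 : G.oneForm m v v ≤ G.oneForm m v h := by
    refine Summable.tsum_le_tsum (fun i => ?_) (oneForm_summable hv hv) (oneForm_summable hv hh.1)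
    rcases i with p | y
    · simp only [coord_inl]
      have h2 : (v p.1 - v p.2) * (v p.1 - v p.2) ≤ (v p.1 - v p.2) * (h p.1 - h p.2) := by
        simp only [hvdef]
        rcases max_cases (h p.1 - c) 0 with h3 | h3 <;> rcases max_cases (h p.2 - c) 0 with h4 | h4 <;>
          rw [h3.1, h4.1] <;> nlinarith
      nlinarith [mul_le_mul_of_nonneg_left h2 (mul_self_nonneg √(G.b p.1 p.2 / 2))]
    · simp only [coord_inr]
      have h2 : v y * v y ≤ v y * h y := by
        simp only [hvdef]
        rcases max_cases (h y - c) 0 with h3 | h3 <;> rw [h3.1] <;> nlinarith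
      nlinarith [mul_le_mul_of_nonneg_left h2 (mul_self_nonneg √(G.c y + m.real {y}))]
  rw [hv0.2 h hh] at h1
  have h2 := congrFun (eq_zero_of_oneForm_self hm hv (le_antisymm h1 (oneForm_self_nonneg _))) x
  simp only [hvdef, Pi.zero_apply] at h2
  have h3 := le_max_left (h x - c) 0
  linarith

lemma neg_mem_harmonicSpace {h : X → ℝ} (hh : h ∈ G.harmonicSpace m) :
    -h ∈ G.harmonicSpace m :=
  ⟨neg_mem hh.1, fun x => by
    rw [← neg_one_smul ℝ h, oneForm_smul_left, hh.2 x, mul_zero]⟩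

lemma abs_le_of_mem_harmonicSpace (hm : ∀ x, 0 < m {x} ∧ m {x} < ∞) {h : X → ℝ}
    (hh : h ∈ G.harmonicSpace m) {c : ℝ} (hc : 0 ≤ c)
    (hb : ∀ z : G.HarmonicBoundary m, ∃ r, |r| ≤ c ∧ Tendsto h (nhdsTrace z.1) (𝓝 r)) (x : X) :
    |h x| ≤ c := by
  refine abs_le.2 ⟨?_, ?_⟩
  · have h1 := le_of_mem_harmonicSpace hm (neg_mem_harmonicSpace hh) hc (fun z => by
      obtain ⟨r, hr, hrz⟩ := hb z
      exact ⟨-r, by linarith [(abs_le.1 hr).1], hrz.neg⟩) x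
    rw [Pi.neg_apply] at h1
    linarith
  · refine le_of_mem_harmonicSpace hm hh hc (fun z => ?_) x
    obtain ⟨r, hr, hrz⟩ := hb z
    exact ⟨r, (le_abs_self r).trans hr, hrz⟩

end Limits

end WeightedGraph
end

/-! ### Harmonic functions and the harmonic measure -/

noncomputable section

/-- A linear functional which is dominated by the supremum of the positive part is represented by a
measure of mass at most one. -/
lemma exists_measure_of_le_sup {K : Type*} [TopologicalSpace K] [CompactSpace K] [T2Space K]
    [MeasurableSpace K] [BorelSpace K] {A : Type*} [AddCommGroup A] [Module ℝ A]
    (T : A →ₗ[ℝ] C(K, ℝ)) (L : A →ₗ[ℝ] ℝ)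
    (h : ∀ a c, 0 ≤ c → (∀ z, T a z ≤ c) → L a ≤ c) :
    ∃ μ : Measure K, μ.Regular ∧ μ Set.univ ≤ 1 ∧ ∀ a, L a = ∫ z, T a z ∂μ := by
  -- This functional is sublinear, vanishes at −φ for φ ≥ 0 and is at most one at the constant 1. A
  -- Hahn–Banach extension below it is therefore positive, and its measure has mass at most one.
  let N : C(K, ℝ) → ℝ := fun φ => ‖φ ⊔ 0‖
  have hLN : ∀ a, L a ≤ N (T a) := fun a => h a _ (norm_nonneg _) fun z =>
    (le_max_left (T a z) 0).trans ((le_abs_self _).trans ((T a ⊔ 0).norm_coe_le_norm z))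
  -- `T` need not be injective; the bound with c = 0, applied to a and −a, lets `L` descend to the
  -- range of `T`.
  have hker : T.ker ≤ L.ker := by
    intro a ha
    rw [LinearMap.mem_ker] at ha ⊢
    refine le_antisymm (h a 0 le_rfl fun z => by simp [ha]) ?_
    have h1 := h (-a) 0 le_rfl fun z => by simp [ha]
    rw [map_neg] at h1
    linarith
  let f : C(K, ℝ) →ₗ.[ℝ] ℝ :=
    ⟨T.range, (T.ker.liftQ L hker).comp T.quotKerEquivRange.symm.toLinearMap⟩
  have hf : ∀ a, f ⟨T a, LinearMap.mem_range_self T a⟩ = L a := fun a => by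
    change T.ker.liftQ L hker (T.quotKerEquivRange.symm ⟨T a, _⟩) = L a
    rw [LinearMap.quotKerEquivRange_symm_apply_image T a (LinearMap.mem_range_self T a)]
    rfl
  obtain ⟨g, hg, hgN⟩ := exists_extension_of_le_sublinear f N
    (fun c hc φ => by
      have : c • φ ⊔ 0 = c • (φ ⊔ 0) := by
        ext z
        simp only [ContinuousMap.sup_apply, ContinuousMap.smul_apply, ContinuousMap.zero_apply,
          smul_eq_mul, mul_max_of_nonneg _ _ hc.le, mul_zero]
      simp only [N]
      rw [this, norm_smul, Real.norm_of_nonneg hc.le])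
    (fun φ ψ => by
      refine (ContinuousMap.norm_le _ (add_nonneg (norm_nonneg _) (norm_nonneg _))).2 fun z => ?_
      have h1 := (le_abs_self _).trans ((φ ⊔ 0).norm_coe_le_norm z)
      have h2 := (le_abs_self _).trans ((ψ ⊔ 0).norm_coe_le_norm z)
      simp only [ContinuousMap.sup_apply, ContinuousMap.zero_apply] at h1 h2
      simp only [ContinuousMap.sup_apply, ContinuousMap.zero_apply, ContinuousMap.add_apply]
      rw [Real.norm_of_nonneg (le_max_right _ _)]
      refine max_le ?_ (add_nonneg (norm_nonneg _) (norm_nonneg _))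
      have := le_max_left (φ z) 0
      have := le_max_left (ψ z) 0
      linarith)
    (by
      rintro ⟨_, a, rfl⟩
      rw [hf]
      exact hLN a)
  have hpos : ∀ φ : C(K, ℝ), 0 ≤ φ → 0 ≤ g φ := fun φ hφ => by
    have h1 := hgN (-φ)
    have h2 : -φ ⊔ 0 = 0 := sup_eq_right.2 (neg_nonpos.2 hφ)
    simp only [N] at h1
    rw [h2, norm_zero, map_neg] at h1
    linarith
  open CompactlySupported in
  let Λ : C_c(K, ℝ) →ₚ[ℝ] ℝ := PositiveLinearMap.mk₀
    { toFun := fun φ => g φ.toContinuousMap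
      map_add' := fun φ ψ => g.map_add φ.toContinuousMap ψ.toContinuousMap
      map_smul' := fun r φ => g.map_smul r φ.toContinuousMap }
    fun φ hφ => hpos φ.toContinuousMap hφ
  have hΛ : ∀ φ : C(K, ℝ), ∫ z, φ z ∂(RealRMK.rieszMeasure Λ) = g φ := fun φ =>
    RealRMK.integral_rieszMeasure Λ (CompactlySupportedContinuousMap.continuousMapEquiv φ)
  refine ⟨RealRMK.rieszMeasure Λ, inferInstance, ?_, fun a => ?_⟩
  · have h1 := hΛ 1
    have h2 : N 1 ≤ 1 := by
      refine (ContinuousMap.norm_le _ zero_le_one).2 fun z => ?_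
      simp
    simp only [ContinuousMap.one_apply, integral_const, smul_eq_mul, mul_one] at h1
    rw [← ENNReal.ofReal_toReal (measure_ne_top (RealRMK.rieszMeasure Λ) Set.univ)]
    refine ENNReal.ofReal_le_one.2 ?_
    exact h1.trans_le ((hgN 1).trans h2)
  · rw [hΛ, ← hf a]
    exact (hg ⟨T a, LinearMap.mem_range_self T a⟩).symm

namespace WeightedGraph

variable {X : Type*} [MeasurableSpace X] {G : WeightedGraph X} {m : Measure X}

section Harmonic

variable [Countable X] [DiscreteMeasurableSpace X]

/-! ### The space `ℓ²(X, m)` -/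

/-- Every vertex is an atom, so classes in ℓ²(X, m) have a single representative and their
identities may be read pointwise. -/
lemma ae_iff_forall (hm : ∀ x, 0 < m {x} ∧ m {x} < ∞) {p : X → Prop} :
    (∀ᵐ x ∂m, p x) ↔ ∀ x, p x := by
  rw [ae_iff_of_countable]
  exact forall_congr' fun x => imp_iff_right (hm x).1.ne'

lemma coe_add (hm : ∀ x, 0 < m {x} ∧ m {x} < ∞) (f g : Lp ℝ 2 m) :
    (⇑(f + g) : X → ℝ) = f + g := funext ((ae_iff_forall hm).1 (Lp.coeFn_add f g))

lemma coe_sub (hm : ∀ x, 0 < m {x} ∧ m {x} < ∞) (f g : Lp ℝ 2 m) :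
    (⇑(f - g) : X → ℝ) = f - g := funext ((ae_iff_forall hm).1 (Lp.coeFn_sub f g))

lemma coe_smul (hm : ∀ x, 0 < m {x} ∧ m {x} < ∞) (r : ℝ) (f : Lp ℝ 2 m) :
    (⇑(r • f) : X → ℝ) = r • f := funext ((ae_iff_forall hm).1 (Lp.coeFn_smul r f))

lemma coe_zero (hm : ∀ x, 0 < m {x} ∧ m {x} < ∞) : (⇑(0 : Lp ℝ 2 m) : X → ℝ) = 0 :=
  funext ((ae_iff_forall hm).1 (Lp.coeFn_zero ℝ 2 m))

lemma coe_compLp (hm : ∀ x, 0 < m {x} ∧ m {x} < ∞) {C : ℝ → ℝ} (hC : LipschitzWith 1 C)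
    (h0 : C 0 = 0) (f : Lp ℝ 2 m) : (⇑(hC.compLp h0 f) : X → ℝ) = fun x => C (f x) :=
  funext ((ae_iff_forall hm).1 (hC.coeFn_compLp h0 f))

lemma coe_injective (hm : ∀ x, 0 < m {x} ∧ m {x} < ∞) {f g : Lp ℝ 2 m}
    (h : (f : X → ℝ) = g) : f = g :=
  Lp.ext ((ae_iff_forall hm).2 (congrFun h))

/-- An element of `D(Q⁽ᴺ⁾)` as an element of `ℓ²(X, m)`. -/
def toLp (hm : ∀ x, 0 < m {x} ∧ m {x} < ∞) {f : X → ℝ} (hf : f ∈ G.formDomain m) : Lp ℝ 2 m :=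
  ((mem_neumannDomain_iff hm).2 hf).2.toLp f

lemma coe_toLp (hm : ∀ x, 0 < m {x} ∧ m {x} < ∞) {f : X → ℝ} (hf : f ∈ G.formDomain m) :
    (⇑(toLp hm hf) : X → ℝ) = f := funext ((ae_iff_forall hm).1 (MemLp.coeFn_toLp _))

lemma neumannForm_lt_top_iff (hm : ∀ x, 0 < m {x} ∧ m {x} < ∞) {f : Lp ℝ 2 m} :
    G.neumannForm m f < ∞ ↔ (f : X → ℝ) ∈ G.formDomain m := by
  rw [← mem_neumannDomain_iff hm]
  exact ⟨fun h => ⟨h, Lp.memLp f⟩, fun h => h.1⟩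

lemma formOne_neumannForm (hm : ∀ x, 0 < m {x} ∧ m {x} < ∞) {f : Lp ℝ 2 m}
    (hf : (f : X → ℝ) ∈ G.formDomain m) :
    formOne (G.neumannForm m) f = ENNReal.ofReal (G.oneForm m f f) := by
  rw [formOne, Lp.enorm_def, ← energy_add_eLpNorm_eq hm hf]
  rfl

lemma dirichletForm_eq (hm : ∀ x, 0 < m {x} ∧ m {x} < ∞) {f : Lp ℝ 2 m}
    (hf : (f : X → ℝ) ∈ G.dirichletSpace m) : G.dirichletForm m f = G.neumannForm m f := by
  rw [dirichletForm, if_pos ((mem_dirichletDomain_iff hm).2 hf)]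
  rfl

/-! ### `1`-harmonic functions -/

/-- By Green's formula (𝓛 + 1)f(x) = Q₁(f, 1_x) / m(x), and finite energy already puts `f` in the
domain of 𝓛. -/
lemma isOneHarmonic_iff (hm : ∀ x, 0 < m {x} ∧ m {x} < ∞) {f : X → ℝ}
    (hf : f ∈ G.formDomain m) : G.IsOneHarmonic m f ↔ f ∈ G.harmonicSpace m := by
  have h1 : ∀ x, Summable fun y => G.b x y * |f y| := fun x => by
    refine Summable.of_nonneg_of_le (fun y => mul_nonneg (G.b_nonneg x y) (abs_nonneg _))
      (fun y => ?_) (((G.b_summable x).mul_right |f x|).add (summable_b_mul_sub hf x).abs)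
    rw [abs_mul, abs_of_nonneg (G.b_nonneg x y), ← mul_add]
    refine mul_le_mul_of_nonneg_left ?_ (G.b_nonneg x y)
    have := abs_sub_abs_le_abs_sub (f y) (f x)
    rw [abs_sub_comm] at this
    linarith
  have h2 : ∀ x, G.laplacian m f x + f x = (m.real {x})⁻¹ * G.oneForm m f (vertexFn x) := by
    intro x
    have hpos : m.real {x} ≠ 0 := (ENNReal.toReal_pos (hm x).1.ne' (hm x).2.ne).ne'
    rw [oneForm_vertexFn hf (vertexFn_mem hm x), laplacian]
    field_simp
    ring
  rw [IsOneHarmonic, and_iff_right h1]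
  constructor
  · refine fun h => ⟨hf, fun x => ?_⟩
    have h3 := h x
    rw [h2] at h3
    exact (mul_eq_zero.1 h3).resolve_left
      (inv_ne_zero (ENNReal.toReal_pos (hm x).1.ne' (hm x).2.ne).ne')
  · intro h x
    rw [h2, h.2 x, mul_zero]

lemma isHarmonicExtension_iff (hm : ∀ x, 0 < m {x} ∧ m {x} < ∞)
    {Φ : G.HarmonicBoundary m → EReal} {u : Lp ℝ 2 m} :
    G.IsHarmonicExtension m Φ u ↔ (u : X → ℝ) ∈ G.harmonicSpace m ∧ G.trace m u = Φ := by
  rw [IsHarmonicExtension, neumannForm_lt_top_iff hm]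
  constructor
  · rintro ⟨h1, h2, h3⟩
    exact ⟨(isOneHarmonic_iff hm h1).1 h2, h3⟩
  · rintro ⟨h1, h2⟩
    exact ⟨h1.1, (isOneHarmonic_iff hm h1.1).2 h1, h2⟩

/-- The `1`-harmonic part in the Royden decomposition (and `0` outside of `D(Q⁽ᴺ⁾)`). -/
def harmonicPart (G : WeightedGraph X) (m : Measure X) (f : X → ℝ) : X → ℝ :=
  open Classical in
  if h : ∃ h ∈ G.harmonicSpace m, f - h ∈ G.dirichletSpace m then h.choose else 0

lemma harmonicPart_spec (hm : ∀ x, 0 < m {x} ∧ m {x} < ∞) {f : X → ℝ}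
    (hf : f ∈ G.formDomain m) : G.harmonicPart m f ∈ G.harmonicSpace m ∧
      f - G.harmonicPart m f ∈ G.dirichletSpace m := by
  have h := exists_royden hm hf
  rw [harmonicPart, dif_pos h]
  exact h.choose_spec

lemma sub_mem_harmonicSpace (hm : ∀ x, 0 < m {x} ∧ m {x} < ∞) {f g : X → ℝ}
    (hf : f ∈ G.harmonicSpace m) (hg : g ∈ G.harmonicSpace m) : f - g ∈ G.harmonicSpace m :=
  ⟨sub_mem hf.1 hg.1, fun x => by
    rw [oneForm_sub_left hf.1 hg.1 (vertexFn_mem hm x), hf.2 x, hg.2 x, sub_zero]⟩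

lemma add_mem_harmonicSpace (hm : ∀ x, 0 < m {x} ∧ m {x} < ∞) {f g : X → ℝ}
    (hf : f ∈ G.harmonicSpace m) (hg : g ∈ G.harmonicSpace m) : f + g ∈ G.harmonicSpace m :=
  ⟨add_mem hf.1 hg.1, fun x => by
    rw [oneForm_add_left hf.1 hg.1 (vertexFn_mem hm x), hf.2 x, hg.2 x, add_zero]⟩

lemma smul_mem_harmonicSpace (r : ℝ) {f : X → ℝ} (hf : f ∈ G.harmonicSpace m) :
    r • f ∈ G.harmonicSpace m :=
  ⟨Submodule.smul_mem _ _ hf.1, fun x => by rw [oneForm_smul_left, hf.2 x, mul_zero]⟩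

lemma eq_of_sub_mem_dirichletSpace (hm : ∀ x, 0 < m {x} ∧ m {x} < ∞) {f g : X → ℝ}
    (hf : f ∈ G.harmonicSpace m) (hg : g ∈ G.harmonicSpace m)
    (h : f - g ∈ G.dirichletSpace m) : f = g :=
  sub_eq_zero.1 (eq_zero_of_mem_harmonicSpace hm (sub_mem_harmonicSpace hm hf hg) h)

lemma harmonicPart_unique (hm : ∀ x, 0 < m {x} ∧ m {x} < ∞) {f h : X → ℝ}
    (hf : f ∈ G.formDomain m) (hh : h ∈ G.harmonicSpace m) (hfh : f - h ∈ G.dirichletSpace m) :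
    G.harmonicPart m f = h := by
  obtain ⟨h1, h2⟩ := harmonicPart_spec hm hf
  refine eq_of_sub_mem_dirichletSpace hm h1 hh ?_
  have := sub_mem hfh h2
  rwa [sub_sub_sub_cancel_left] at this

lemma harmonicPart_add (hm : ∀ x, 0 < m {x} ∧ m {x} < ∞) {f g : X → ℝ}
    (hf : f ∈ G.formDomain m) (hg : g ∈ G.formDomain m) :
    G.harmonicPart m (f + g) = G.harmonicPart m f + G.harmonicPart m g := by
  obtain ⟨h1, h2⟩ := harmonicPart_spec hm hf
  obtain ⟨h3, h4⟩ := harmonicPart_spec hm hg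
  refine harmonicPart_unique hm (add_mem hf hg) (add_mem_harmonicSpace hm h1 h3) ?_
  rw [add_sub_add_comm]
  exact add_mem h2 h4

lemma harmonicPart_smul (hm : ∀ x, 0 < m {x} ∧ m {x} < ∞) (r : ℝ) {f : X → ℝ}
    (hf : f ∈ G.formDomain m) : G.harmonicPart m (r • f) = r • G.harmonicPart m f := by
  obtain ⟨h1, h2⟩ := harmonicPart_spec hm hf
  refine harmonicPart_unique hm (Submodule.smul_mem _ _ hf) (smul_mem_harmonicSpace r h1) ?_
  rw [← smul_sub]
  exact Submodule.smul_mem _ _ h2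

lemma trace_harmonicPart (hm : ∀ x, 0 < m {x} ∧ m {x} < ∞) {f : X → ℝ}
    (hf : f ∈ G.formDomain m) : G.trace m (G.harmonicPart m f) = G.trace m f :=
  (trace_eq_of_sub_mem hm hf (harmonicPart_spec hm hf).2).symm

lemma tendsto_harmonicPart (hm : ∀ x, 0 < m {x} ∧ m {x} < ∞) {f : X → ℝ}
    (hf : f ∈ G.formDomain m) {z : G.HarmonicBoundary m} {r : ℝ}
    (h : Tendsto f (nhdsTrace z.1) (𝓝 r)) :
    Tendsto (G.harmonicPart m f) (nhdsTrace z.1) (𝓝 r) := by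
  rw [← trace_eq_coe_iff hm (harmonicPart_spec hm hf).1.1, trace_harmonicPart hm hf]
  exact (trace_eq_coe_iff hm hf).2 h

lemma isHarmonicExtension_harmonicPart (hm : ∀ x, 0 < m {x} ∧ m {x} < ∞) {f : X → ℝ}
    (hf : f ∈ G.formDomain m) :
    G.IsHarmonicExtension m (G.trace m f) (toLp hm (harmonicPart_spec hm hf).1.1) := by
  rw [isHarmonicExtension_iff hm, coe_toLp]
  exact ⟨(harmonicPart_spec hm hf).1, trace_harmonicPart hm hf⟩

/-- The `1`-harmonic extension of a bounded trace. -/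
lemma harmonicExtension_boundedTrace (hm : ∀ x, 0 < m {x} ∧ m {x} < ∞)
    (f : G.BoundedNeumann m) :
    (G.harmonicExtension m (fun z => (G.boundedTrace m f z : EReal)) : X → ℝ)
      = G.harmonicPart m f.1 := by
  have hf := mem_formDomain_of_bounded hm f
  have hex : ∃ u, G.IsHarmonicExtension m (fun z => (G.boundedTrace m f z : EReal)) u := by
    rw [show (fun z => (G.boundedTrace m f z : EReal)) = G.trace m f.1 from
      funext fun z => (trace_bounded hm f z).symm]
    exact ⟨_, isHarmonicExtension_harmonicPart hm hf⟩
  rw [harmonicExtension, dif_pos hex]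
  obtain ⟨h1, h2⟩ := (isHarmonicExtension_iff hm).1 hex.choose_spec
  refine (harmonicPart_unique hm hf h1 ?_).symm
  -- The chosen extension has the boundary values of `f`, all of them finite, so the difference
  -- vanishes on ∂X.
  refine mem_dirichletSpace_of_tendsto_zero hm (sub_mem hf h1.1) fun z => ?_
  have h3 := (trace_eq_coe_iff hm h1.1).1 (congrFun h2 z)
  have h4 := (tendsto_boundedTrace hm f z).sub h3
  rwa [sub_self] at h4

/-! ### Existence of the harmonic measure -/

/-- ∂X is closed in the compact space X̂: the isolated points X form an open set, and the remaining
conditions are equations between continuous functions. -/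
lemma harmonicBoundary_spec (hm : ∀ x, 0 < m {x} ∧ m {x} < ∞) :
    CompactSpace (G.HarmonicBoundary m) ∧ T2Space (G.HarmonicBoundary m) ∧
      ∀ f, Continuous (G.boundedTrace m f) := by
  obtain ⟨h1, h2, -, -, h5, h6, -, -⟩ := G.roydenCompactification_spec m hm
  refine ⟨?_, ?_, fun f => (h6 f).comp continuous_subtype_val⟩
  · have hcl : IsClosed {z : G.RoydenCompactification m | z ∉ Set.range (G.toRoyden m) ∧
        ∀ f : G.BoundedNeumann m, f.1 ∈ G.dirichletDomain m → G.boundedExtension m f z = 0} := by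
      refine IsClosed.inter (isClosed_compl_iff.2 ?_) ?_
      · rw [← Set.iUnion_singleton_eq_range]
        exact isOpen_iUnion h5
      · have : {z : G.RoydenCompactification m | ∀ f : G.BoundedNeumann m,
            f.1 ∈ G.dirichletDomain m → G.boundedExtension m f z = 0}
            = ⋂ (f : G.BoundedNeumann m) (_ : f.1 ∈ G.dirichletDomain m),
              {z | G.boundedExtension m f z = 0} := by
          ext z; simp
        change IsClosed {z : G.RoydenCompactification m | ∀ f : G.BoundedNeumann m,
            f.1 ∈ G.dirichletDomain m → G.boundedExtension m f z = 0}
        rw [this]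
        exact isClosed_biInter fun f _ => isClosed_eq (h6 f) continuous_const
    exact isCompact_iff_compactSpace.1 hcl.isCompact
  · exact inferInstanceAs (T2Space {z : G.RoydenCompactification m //
      z ∉ Set.range (G.toRoyden m) ∧
      ∀ f : G.BoundedNeumann m, f.1 ∈ G.dirichletDomain m → G.boundedExtension m f z = 0})

/-- The bounded functions in `D(Q⁽ᴺ⁾)` as a subspace. -/
def boundedSpace (G : WeightedGraph X) (m : Measure X) : Submodule ℝ (X → ℝ) where
  carrier := {f | f ∈ G.formDomain m ∧ ∃ M : ℝ, ∀ x, |f x| ≤ M}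
  add_mem' := by
    rintro f g ⟨hf, M, hM⟩ ⟨hg, N, hN⟩
    exact ⟨add_mem hf hg, M + N, fun x => (abs_add_le _ _).trans (add_le_add (hM x) (hN x))⟩
  zero_mem' := ⟨zero_mem _, 0, fun x => by simp⟩
  smul_mem' := by
    rintro r f ⟨hf, M, hM⟩
    refine ⟨Submodule.smul_mem _ _ hf, |r| * M, fun x => ?_⟩
    rw [Pi.smul_apply, smul_eq_mul, abs_mul]
    exact mul_le_mul_of_nonneg_left (hM x) (abs_nonneg r)

/-- The maximum principle bounds f ↦ H(γf)(o) by the supremum of the positive boundary values, as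
required by `exists_measure_of_le_sup`. -/
theorem exists_isHarmonicMeasure (hm : ∀ x, 0 < m {x} ∧ m {x} < ∞) (o : X) :
    ∃ μ, G.IsHarmonicMeasure m o μ := by
  obtain ⟨hc, hT2, hcont⟩ := harmonicBoundary_spec (G := G) hm
  let B : G.boundedSpace m → G.BoundedNeumann m := fun f =>
    ⟨f.1, (mem_neumannDomain_iff hm).2 f.2.1, f.2.2⟩
  have hB : ∀ f : G.boundedSpace m, ∀ z, Tendsto f.1 (nhdsTrace z.1) (𝓝 (G.boundedTrace m (B f) z)) :=
    fun f z => tendsto_boundedTrace hm (B f) z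
  let T : G.boundedSpace m →ₗ[ℝ] C(G.HarmonicBoundary m, ℝ) :=
    { toFun := fun f => ⟨G.boundedTrace m (B f), hcont (B f)⟩
      map_add' := fun f g => by
        ext z
        have := nhdsTrace_neBot hm z.1
        exact tendsto_nhds_unique (hB (f + g) z) ((hB f z).add (hB g z))
      map_smul' := fun r f => by
        ext z
        have := nhdsTrace_neBot hm z.1
        exact tendsto_nhds_unique (hB (r • f) z) ((hB f z).const_mul r) }
  let L : G.boundedSpace m →ₗ[ℝ] ℝ :=
    { toFun := fun f => G.harmonicPart m f.1 o
      map_add' := fun f g => congrFun (harmonicPart_add hm f.2.1 g.2.1) o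
      map_smul' := fun r f => congrFun (harmonicPart_smul hm r f.2.1) o }
  obtain ⟨ν, hν1, hν2, hν3⟩ := exists_measure_of_le_sup T L fun f c hc hz =>
    le_of_mem_harmonicSpace hm (harmonicPart_spec hm f.2.1).1 hc
      (fun z => ⟨_, hz z, tendsto_harmonicPart hm f.2.1 (hB f z)⟩) o
  -- Removing the common zero set of all bounded traces changes none of the integrals and deletes
  -- the possible mass at infinity.
  let Z : Set (G.HarmonicBoundary m) := {z | ∀ f : G.BoundedNeumann m, G.boundedTrace m f z = 0}
  have hZ : IsClosed Z := by
    have : Z = ⋂ f : G.BoundedNeumann m, {z | G.boundedTrace m f z = 0} := by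
      ext z; simp [Z]
    rw [this]
    exact isClosed_iInter fun f => isClosed_eq (hcont f) continuous_const
  refine ⟨ν.restrict Zᶜ, ?_, ?_, fun f => ?_, fun z hz => ?_⟩
  · exact Measure.Regular.restrict_of_measure_ne_top (measure_ne_top ν _)
  · exact (Measure.restrict_apply_le _ _).trans hν2
  · have h1 := hν3 ⟨f.1, mem_formDomain_of_bounded hm f, f.2.2⟩
    rw [harmonicExtension_boundedTrace hm]
    refine Eq.trans h1 ?_
    rw [setIntegral_eq_integral_of_forall_compl_eq_zero]
    · rfl
    · intro z hz
      exact (not_not.1 hz : z ∈ Z) f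
  · rw [Measure.restrict_apply (isClosed_singleton.measurableSet)]
    have : ({z} ∩ Zᶜ : Set (G.HarmonicBoundary m)) = ∅ := by
      rw [← Set.disjoint_iff_inter_eq_empty, Set.disjoint_compl_right_iff_subset,
        Set.singleton_subset_iff]
      exact hz
    rw [this, measure_empty]

lemma isHarmonicMeasure_harmonicMeasure (hm : ∀ x, 0 < m {x} ∧ m {x} < ∞) (o : X) :
    G.IsHarmonicMeasure m o (G.harmonicMeasure m o) := by
  have h := exists_isHarmonicMeasure (G := G) hm o
  rw [harmonicMeasure, dif_pos h]
  exact h.choose_spec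

end Harmonic

end WeightedGraph
end

noncomputable section

lemma continuous_truncate (M : ℝ) : Continuous (truncate M) := (truncate_lipschitz M).continuous

lemma tendsto_truncate_self (t : ℝ) : Tendsto (fun n : ℕ => truncate n t) atTop (𝓝 t) := by
  obtain ⟨N, hN⟩ := exists_nat_ge |t|
  refine tendsto_const_nhds.congr' ?_
  filter_upwards [eventually_ge_atTop N] with n hn
  exact (truncate_eq_self (hN.trans (by exact_mod_cast hn))).symm

namespace WeightedGraph

variable {X : Type*} [MeasurableSpace X] {G : WeightedGraph X} {m : Measure X}

/-! ### Continuity and kernel of the trace map -/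

section Trace

variable [Countable X] [DiscreteMeasurableSpace X]

/-- Pythagoras in the Royden decomposition. -/
lemma oneForm_harmonicPart_le (hm : ∀ x, 0 < m {x} ∧ m {x} < ∞) {f : X → ℝ}
    (hf : f ∈ G.formDomain m) :
    G.oneForm m (G.harmonicPart m f) (G.harmonicPart m f) ≤ G.oneForm m f f := by
  obtain ⟨h1, h2⟩ := harmonicPart_spec hm hf
  set u := G.harmonicPart m f
  have h3 : f = (f - u) + u := by simp
  have h4 : G.oneForm m f f = G.oneForm m (f - u) (f - u) + G.oneForm m u u := by
    conv_lhs => rw [h3]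
    rw [oneForm_add_left h2.1 h1.1 (add_mem h2.1 h1.1), oneForm_add_right h2.1 h1.1 h2.1,
      oneForm_add_right h2.1 h1.1 h1.1, h2.2 u h1, oneForm_comm u, h2.2 u h1]
    ring
  linarith [oneForm_self_nonneg (G := G) (m := m) (f - u)]

/-- The `1`-harmonic extension of the square of a bounded trace is controlled by the form norm. -/
lemma exists_harmonicPart_sq_le (hm : ∀ x, 0 < m {x} ∧ m {x} < ∞) (o : X) :
    ∃ K : ℝ, 0 ≤ K ∧ ∀ f ∈ G.boundedSpace m,
      G.harmonicPart m (f * f) o ≤ K * G.oneForm m f f := by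
  obtain ⟨g, hg, hgv, hg0, hgo⟩ := exists_bounded_green (G := G) hm o
  have hmo : 0 < m.real {o} := ENNReal.toReal_pos (hm o).1.ne' (hm o).2.ne
  -- The first summand comes from the Green potential −Q₁(g, u²), the second from the point
  -- evaluation u(o)².
  refine ⟨2 * g o + (m.real {o})⁻¹, by have := hg0 o; positivity, ?_⟩
  rintro f ⟨hf, M, hM⟩
  have hM0 : 0 ≤ M := (abs_nonneg _).trans (hM o)
  obtain ⟨hu, hfu⟩ := harmonicPart_spec hm hf
  have hlim : ∀ z : G.HarmonicBoundary m, ∃ r, |r| ≤ M ∧ Tendsto f (nhdsTrace z.1) (𝓝 r) ∧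
      Tendsto (G.harmonicPart m f) (nhdsTrace z.1) (𝓝 r) := fun z => by
    have := nhdsTrace_neBot hm z.1
    have h1 := tendsto_boundedTrace hm (toBounded hm hf hM) z
    exact ⟨_, le_of_tendsto h1.abs (Eventually.of_forall hM), h1, tendsto_harmonicPart hm hf h1⟩
  have huM := abs_le_of_mem_harmonicSpace hm hu hM0 fun z => by
    obtain ⟨r, h1, -, h2⟩ := hlim z
    exact ⟨r, h1, h2⟩
  have hEu := oneForm_harmonicPart_le hm hf
  set u := G.harmonicPart m f
  have hff := (mul_bounded_mem hf hf hM hM).1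
  have huu := (mul_bounded_mem hu.1 hu.1 huM huM).1
  obtain ⟨hw1, hw2⟩ := harmonicPart_spec hm hff
  set w := G.harmonicPart m (f * f)
  have hwu : w - u * u ∈ G.dirichletSpace m := by
    refine mem_dirichletSpace_of_tendsto_zero hm (sub_mem hw1.1 huu) fun z => ?_
    obtain ⟨r, -, h1, h2⟩ := hlim z
    have h3 := (tendsto_harmonicPart hm hff (h1.mul h1)).sub (h2.mul h2)
    rwa [sub_self] at h3
  have hgu : g * u ∈ G.dirichletSpace m := mul_mem_dirichletSpace hm hg hu.1
    (r := g o) (fun x => by rw [abs_of_nonneg (hg0 x)]; exact hgo x) huM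
  -- The function w − u² vanishes at ∂X, so `g` reproduces its value at `o`; the harmonic `w` is
  -- orthogonal to `g` and drops out.
  have h1 : w o - u o * u o = -G.oneForm m g (u * u) := by
    have h2 := hgv _ hwu
    rw [oneForm_sub_right hw1.1 huu hg.1, hg.2 w hw1] at h2
    simp only [Pi.sub_apply, Pi.mul_apply] at h2
    linarith
  -- On an edge, −∇g·∇(u²) = (g(x) + g(y))(∇u)² − 2∇(gu)·∇u, and g ≤ g(o). The last term sums to
  -- zero, because gu ∈ D(Q⁽ᴰ⁾) is orthogonal to the 1-harmonic `u`.
  have h2 : -G.oneForm m g (u * u) ≤ 2 * g o * G.oneForm m u u - 2 * G.oneForm m (g * u) u := by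
    rw [oneForm, oneForm, oneForm, ← tsum_neg, ← tsum_mul_left, ← tsum_mul_left,
      ← Summable.tsum_sub ((oneForm_summable hu.1 hu.1).mul_left _)
        ((oneForm_summable hgu.1 hu.1).mul_left _)]
    refine Summable.tsum_le_tsum (fun i => ?_) (oneForm_summable hg.1 huu).neg
      (((oneForm_summable hu.1 hu.1).mul_left _).sub ((oneForm_summable hgu.1 hu.1).mul_left _))
    rcases i with p | x
    · simp only [coord_inl, Pi.mul_apply]
      have h3 := mul_nonneg (mul_self_nonneg (√(G.b p.1 p.2 / 2) * (u p.1 - u p.2)))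
        (by linarith [hgo p.1, hgo p.2] : 0 ≤ 2 * g o - g p.1 - g p.2)
      nlinarith
    · simp only [coord_inr, Pi.mul_apply]
      have h3 := mul_nonneg (mul_self_nonneg (√(G.c x + m.real {x}) * u x))
        (by linarith [hgo x, hg0 o] : 0 ≤ 2 * g o - g x)
      nlinarith
  rw [hgu.2 u hu, mul_zero, sub_zero] at h2
  have h3 := mass_mul_sq_le hu.1 o
  have h4 : u o * u o ≤ (m.real {o})⁻¹ * G.oneForm m u u := by
    rw [inv_mul_eq_div, le_div_iff₀' hmo, ← sq]
    exact h3
  have h5 : (2 * g o + (m.real {o})⁻¹) * G.oneForm m u u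
      ≤ (2 * g o + (m.real {o})⁻¹) * G.oneForm m f f :=
    mul_le_mul_of_nonneg_left hEu (by have := hg0 o; positivity)
  linarith

variable {o : X} {μ : Measure (G.HarmonicBoundary m)}

lemma integral_eq_harmonicPart (hm : ∀ x, 0 < m {x} ∧ m {x} < ∞)
    (hμ : G.IsHarmonicMeasure m o μ) (f : G.BoundedNeumann m) :
    ∫ z, G.boundedTrace m f z ∂μ = G.harmonicPart m f.1 o := by
  rw [← hμ.representation f, harmonicExtension_boundedTrace hm]

lemma isTrace_iff (hm : ∀ x, 0 < m {x} ∧ m {x} < ∞) {f : Lp ℝ 2 m}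
    (hf : (f : X → ℝ) ∈ G.formDomain m) {φ : Lp ℝ 2 μ} :
    G.IsTrace m μ f φ ↔ ∀ᵐ z ∂μ, Tendsto f (nhdsTrace z.1) (𝓝 (φ z)) := by
  refine eventually_congr (Eventually.of_forall fun z => ?_)
  rw [← trace_eq_coe_iff hm hf, eq_comm]

/-- Near an infinite boundary value the truncation at level `n` is constantly n or −n; squaring
removes the sign. -/
lemma tendsto_top_bot_truncate (hm : ∀ x, 0 < m {x} ∧ m {x} < ∞) {f : X → ℝ}
    (hf : f ∈ G.formDomain m) {z : G.HarmonicBoundary m}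
    (hz : G.trace m f z = ⊤ ∨ G.trace m f z = ⊥) (n : ℕ) {r : ℝ}
    (hr : Tendsto (fun x => truncate n (f x)) (nhdsTrace z.1) (𝓝 r)) : r ^ 2 = (n : ℝ) ^ 2 := by
  have := nhdsTrace_neBot hm z.1
  have h1 := tendsto_trace hm hf z
  rcases hz with hz | hz
  · rw [hz] at h1
    have h2 : ∀ᶠ x in nhdsTrace z.1, truncate n (f x) = n := by
      filter_upwards [h1.eventually (lt_mem_nhds (EReal.coe_lt_top (n : ℝ)))] with x hx
      have hx' : (n : ℝ) < f x := EReal.coe_lt_coe_iff.1 hx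
      rw [truncate, min_eq_right hx'.le, max_eq_right]
      linarith [n.cast_nonneg (α := ℝ)]
    rw [tendsto_nhds_unique hr (tendsto_const_nhds.congr' (h2.mono fun _ h => h.symm))]
  · rw [hz] at h1
    have h2 : ∀ᶠ x in nhdsTrace z.1, truncate n (f x) = -n := by
      filter_upwards [h1.eventually (gt_mem_nhds (EReal.bot_lt_coe (-(n : ℝ))))] with x hx
      have hx' : f x < -n := EReal.coe_lt_coe_iff.1 hx
      rw [truncate, max_eq_left ((min_le_left _ _).trans hx'.le)]
    rw [tendsto_nhds_unique hr (tendsto_const_nhds.congr' (h2.mono fun _ h => h.symm)), neg_sq]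

/-- The trace map is continuous from `D(Q⁽ᴺ⁾)` to `L²(∂X, μ)`. -/
lemma exists_trace_bound (hm : ∀ x, 0 < m {x} ∧ m {x} < ∞) (hμ : G.IsHarmonicMeasure m o μ) :
    ∃ K : ℝ, 0 ≤ K ∧ ∀ f : Lp ℝ 2 m, (f : X → ℝ) ∈ G.formDomain m →
      ∃ φ : Lp ℝ 2 μ, G.IsTrace m μ f φ ∧ ‖φ‖ ^ 2 ≤ K * G.oneForm m f f := by
  obtain ⟨K, hK0, hK⟩ := exists_harmonicPart_sq_le (G := G) hm o
  refine ⟨K, hK0, fun f hf => ?_⟩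
  have hreg := hμ.regular
  have hfin : IsFiniteMeasure μ := ⟨hμ.mass_le_one.trans_lt ENNReal.one_lt_top⟩
  obtain ⟨hcomp, hT2, hcont⟩ := harmonicBoundary_spec (G := G) hm
  have hcon := fun n : ℕ => contraction_mem (truncate_lipschitz n) (truncate_zero n.cast_nonneg) hf
  have hbd : ∀ (n : ℕ) (x : X), |truncate n (f x)| ≤ n := fun n x =>
    abs_truncate_le n.cast_nonneg _
  let F : ℕ → G.BoundedNeumann m := fun n => toBounded hm (hcon n).1 (hbd n)
  have hF : ∀ (n : ℕ) z, Tendsto (fun x => truncate n (f x)) (nhdsTrace z.1)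
      (𝓝 (G.boundedTrace m (F n) z)) := fun n z => tendsto_boundedTrace hm (F n) z
  -- The integral of the squared truncated trace is the harmonic part of the squared truncation at
  -- `o`. Since truncation is a contraction, its bound does not depend on `n`.
  have hsq : ∀ n, ∫⁻ z, ENNReal.ofReal (G.boundedTrace m (F n) z ^ 2) ∂μ
      ≤ ENNReal.ofReal (K * G.oneForm m f f) := by
    intro n
    have hc2 : Continuous fun z => G.boundedTrace m (F n) z ^ 2 := (hcont (F n)).pow 2
    have hint : Integrable (fun z => G.boundedTrace m (F n) z ^ 2) μ :=
      hc2.integrable_of_hasCompactSupport (HasCompactSupport.of_compactSpace _)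
    rw [← ofReal_integral_eq_lintegral_ofReal hint (Eventually.of_forall fun z => sq_nonneg _)]
    refine ENNReal.ofReal_le_ofReal ?_
    have hb := mul_bounded_mem (hcon n).1 (hcon n).1 (hbd n) (hbd n)
    let F2 : G.BoundedNeumann m := toBounded hm hb.1 (M := (n : ℝ) * n) fun x => by
      rw [Pi.mul_apply, abs_mul]
      exact mul_le_mul (hbd n x) (hbd n x) (abs_nonneg _) n.cast_nonneg
    have h1 : ∀ z, G.boundedTrace m (F n) z ^ 2 = G.boundedTrace m F2 z := fun z => by
      have := nhdsTrace_neBot hm z.1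
      rw [sq]
      exact tendsto_nhds_unique ((hF n z).mul (hF n z)) (tendsto_boundedTrace hm F2 z)
    simp only [h1]
    rw [integral_eq_harmonicPart hm hμ]
    refine (hK _ ⟨(hcon n).1, n, hbd n⟩).trans ?_
    exact mul_le_mul_of_nonneg_left (hcon n).2 hK0
  have hmeas : ∀ n, Measurable fun z => ENNReal.ofReal (G.boundedTrace m (F n) z ^ 2) := fun n =>
    (((hcont (F n)).pow 2).measurable).ennreal_ofReal
  have hfatou : ∫⁻ z, liminf (fun n => ENNReal.ofReal (G.boundedTrace m (F n) z ^ 2)) atTop ∂μ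
      ≤ ENNReal.ofReal (K * G.oneForm m f f) :=
    (lintegral_liminf_le hmeas).trans (liminf_le_of_le (by isBoundedDefault) fun b hb => by
      obtain ⟨n, hn⟩ := hb.exists
      exact hn.trans (hsq n))
  -- Where the trace is infinite the integrands are n², so their lower limit is infinite, which the
  -- finite Fatou bound excludes almost everywhere.
  have hfinite : ∀ᵐ z ∂μ, G.trace m f z = ((G.trace m f z).toReal : EReal) := by
    filter_upwards [ae_lt_top (.liminf hmeas) (hfatou.trans_lt ENNReal.ofReal_lt_top).ne] with z hz
    by_contra hcon
    have hz' : G.trace m f z = ⊤ ∨ G.trace m f z = ⊥ := by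
      by_contra h
      push Not at h
      exact hcon (EReal.coe_toReal h.1 h.2).symm
    have h1 : ∀ n, G.boundedTrace m (F n) z ^ 2 = (n : ℝ) ^ 2 := fun n =>
      tendsto_top_bot_truncate hm hf hz' n (hF n z)
    simp only [h1] at hz
    have h2 : Tendsto (fun n : ℕ => ENNReal.ofReal ((n : ℝ) ^ 2)) atTop (𝓝 ∞) :=
      ENNReal.tendsto_ofReal_atTop.comp
        ((tendsto_pow_atTop two_ne_zero).comp tendsto_natCast_atTop_atTop)
    rw [h2.liminf_eq] at hz
    exact lt_irrefl _ hz
  have hlim : ∀ᵐ z ∂μ, Tendsto (fun n => G.boundedTrace m (F n) z) atTop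
      (𝓝 (G.trace m f z).toReal) := by
    filter_upwards [hfinite] with z hz
    have h1 := (trace_eq_coe_iff hm hf).1 hz
    have := nhdsTrace_neBot hm z.1
    refine (tendsto_truncate_self _).congr fun n => ?_
    exact tendsto_nhds_unique (((continuous_truncate n).tendsto _).comp h1) (hF n z)
  have hasm : AEStronglyMeasurable (fun z => (G.trace m f z).toReal) μ :=
    aestronglyMeasurable_of_tendsto_ae atTop (fun n => (hcont (F n)).measurable.aestronglyMeasurable)
      hlim
  have hbound : ∫⁻ z, ENNReal.ofReal ((G.trace m f z).toReal ^ 2) ∂μ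
      ≤ ENNReal.ofReal (K * G.oneForm m f f) := by
    refine le_trans (lintegral_mono_ae ?_) hfatou
    filter_upwards [hlim] with z hz
    exact (ENNReal.tendsto_ofReal (hz.pow 2)).liminf_eq.ge
  have hnorm : eLpNorm (fun z => (G.trace m f z).toReal) 2 μ ^ 2
      ≤ ENNReal.ofReal (K * G.oneForm m f f) := by
    have h1 := eLpNorm_nnreal_pow_eq_lintegral (μ := μ)
      (f := fun z => (G.trace m f z).toReal) (p := 2) two_ne_zero
    have h3 : ((2 : NNReal) : ℝ) = ((2 : ℕ) : ℝ) := by norm_num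
    rw [h3] at h1
    simp only [ENNReal.rpow_natCast] at h1
    refine (le_of_eq ?_).trans hbound
    refine h1.trans (lintegral_congr fun z => ?_)
    rw [Real.enorm_eq_ofReal_abs, ← ENNReal.ofReal_pow (abs_nonneg _), sq_abs]
  have hmem : MemLp (fun z => (G.trace m f z).toReal) 2 μ :=
    ⟨hasm, by
      by_contra h
      rw [not_lt, top_le_iff] at h
      rw [h] at hnorm
      simp at hnorm⟩
  refine ⟨hmem.toLp _, ?_, ?_⟩
  · filter_upwards [hfinite, hmem.coeFn_toLp] with z h1 h2
    rw [h2, ← h1]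
  · rw [Lp.norm_toLp, ← ENNReal.toReal_pow]
    exact ENNReal.toReal_le_of_le_ofReal (mul_nonneg hK0 (oneForm_self_nonneg _)) hnorm

/-! ### Linearity of the trace -/

lemma isTrace_add (hm : ∀ x, 0 < m {x} ∧ m {x} < ∞) {f g : Lp ℝ 2 m}
    (hf : (f : X → ℝ) ∈ G.formDomain m) (hg : (g : X → ℝ) ∈ G.formDomain m) {φ ψ : Lp ℝ 2 μ}
    (h1 : G.IsTrace m μ f φ) (h2 : G.IsTrace m μ g ψ) : G.IsTrace m μ (f + g) (φ + ψ) := by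
  rw [isTrace_iff hm (by rw [coe_add hm]; exact add_mem hf hg)]
  filter_upwards [(isTrace_iff hm hf).1 h1, (isTrace_iff hm hg).1 h2, Lp.coeFn_add φ ψ]
    with z h3 h4 h5
  rw [h5, coe_add hm]
  exact h3.add h4

lemma isTrace_smul (hm : ∀ x, 0 < m {x} ∧ m {x} < ∞) (r : ℝ) {f : Lp ℝ 2 m}
    (hf : (f : X → ℝ) ∈ G.formDomain m) {φ : Lp ℝ 2 μ}
    (h1 : G.IsTrace m μ f φ) : G.IsTrace m μ (r • f) (r • φ) := by
  rw [isTrace_iff hm (by rw [coe_smul hm]; exact Submodule.smul_mem _ _ hf)]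
  filter_upwards [(isTrace_iff hm hf).1 h1, Lp.coeFn_smul r φ] with z h3 h5
  rw [h5, coe_smul hm]
  exact h3.const_mul r

lemma isTrace_sub (hm : ∀ x, 0 < m {x} ∧ m {x} < ∞) {f g : Lp ℝ 2 m}
    (hf : (f : X → ℝ) ∈ G.formDomain m) (hg : (g : X → ℝ) ∈ G.formDomain m) {φ ψ : Lp ℝ 2 μ}
    (h1 : G.IsTrace m μ f φ) (h2 : G.IsTrace m μ g ψ) : G.IsTrace m μ (f - g) (φ - ψ) := by
  rw [isTrace_iff hm (by rw [coe_sub hm]; exact sub_mem hf hg)]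
  filter_upwards [(isTrace_iff hm hf).1 h1, (isTrace_iff hm hg).1 h2, Lp.coeFn_sub φ ψ]
    with z h3 h4 h5
  rw [h5, coe_sub hm]
  exact h3.sub h4

lemma isTrace_compLp (hm : ∀ x, 0 < m {x} ∧ m {x} < ∞) {C : ℝ → ℝ} (hC : LipschitzWith 1 C)
    (h0 : C 0 = 0) {f : Lp ℝ 2 m} (hf : (f : X → ℝ) ∈ G.formDomain m) {φ : Lp ℝ 2 μ}
    (h1 : G.IsTrace m μ f φ) : G.IsTrace m μ (hC.compLp h0 f) (hC.compLp h0 φ) := by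
  rw [isTrace_iff hm (by rw [coe_compLp hm]; exact (contraction_mem hC h0 hf).1)]
  filter_upwards [(isTrace_iff hm hf).1 h1, hC.coeFn_compLp h0 φ] with z h3 h5
  rw [h5, coe_compLp hm]
  exact (hC.continuous.tendsto _).comp h3

lemma isTrace_unique {f : Lp ℝ 2 m} {φ ψ : Lp ℝ 2 μ}
    (h1 : G.IsTrace m μ f φ) (h2 : G.IsTrace m μ f ψ) : φ = ψ := by
  refine Lp.ext ?_
  filter_upwards [h1, h2] with z h3 h4
  exact EReal.coe_injective (h3.trans h4.symm)

/-! ### Traces that vanish almost everywhere -/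

/-- Minimum principle. -/
lemma eq_zero_of_nonneg_of_eq_zero (hG : G.Connected) (hm : ∀ x, 0 < m {x} ∧ m {x} < ∞)
    {u : X → ℝ} (hu : u ∈ G.harmonicSpace m) (h0 : ∀ x, 0 ≤ u x) (ho : u o = 0) : u = 0 := by
  funext x
  induction hG o x with
  | refl => exact ho
  | tail _ hbc ih =>
    rename_i y z _
    have h1 := hu.2 y
    rw [oneForm_vertexFn hu.1 (vertexFn_mem hm y), ih, Pi.zero_apply, mul_zero, add_zero] at h1
    have h2 := (summable_b_mul_sub hu.1 y).neg
    rw [ih, Pi.zero_apply] at h2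
    have h3 := h2.le_tsum z fun w _ => by
      rw [zero_sub, mul_neg, neg_neg]
      exact mul_nonneg (G.b_nonneg y w) (h0 w)
    rw [tsum_neg, h1] at h3
    rw [Pi.zero_apply]
    refine le_antisymm ?_ (h0 z)
    by_contra h4
    push Not at h4
    nlinarith [mul_pos hbc h4]

/-- The harmonic part of k = min(|f|, 1) is nonnegative, with value ∫ γk dμ = 0 at `o`; by the
minimum principle it is zero. Hence `k`, and with it `f`, vanishes at every point of ∂X and not only
at almost every one. -/
lemma mem_dirichletSpace_of_isTrace_zero (hG : G.Connected)
    (hm : ∀ x, 0 < m {x} ∧ m {x} < ∞) (hμ : G.IsHarmonicMeasure m o μ) {f : Lp ℝ 2 m}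
    (hf : (f : X → ℝ) ∈ G.formDomain m) (h : G.IsTrace m μ f 0) :
    (f : X → ℝ) ∈ G.dirichletSpace m := by
  have hC0 : min |(0 : ℝ)| 1 = 0 := by simp
  have hk := (contraction_mem (min_abs_lipschitz 1) hC0 hf).1
  set k : X → ℝ := fun x => min |f x| 1 with hkdef
  have hk0 : ∀ x, 0 ≤ k x := fun x => le_min (abs_nonneg _) zero_le_one
  have hkb : ∀ x, |k x| ≤ 1 := fun x => by
    rw [abs_of_nonneg (hk0 x)]
    exact min_le_right _ _
  let F := toBounded hm hk hkb
  have hF : ∀ z, Tendsto k (nhdsTrace z.1) (𝓝 (G.boundedTrace m F z)) := tendsto_boundedTrace hm F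
  obtain ⟨hu, hku⟩ := harmonicPart_spec hm hk
  have huo : G.harmonicPart m k o = 0 := by
    have h1 := integral_eq_harmonicPart hm hμ F
    rw [integral_eq_zero_of_ae] at h1
    · exact h1.symm
    · filter_upwards [(isTrace_iff hm hf).1 h, Lp.coeFn_zero ℝ 2 μ] with z hz h0
      have := nhdsTrace_neBot hm z.1
      rw [h0] at hz
      have h2 := ((min_abs_lipschitz 1).continuous.tendsto _).comp hz
      simp only [Pi.zero_apply, abs_zero] at h2
      rw [min_eq_left zero_le_one] at h2
      exact tendsto_nhds_unique (hF z) h2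
  have hu0 : ∀ x, 0 ≤ G.harmonicPart m k x := fun x => by
    have h1 := le_of_mem_harmonicSpace hm (neg_mem_harmonicSpace hu) le_rfl (fun z => by
      have := nhdsTrace_neBot hm z.1
      exact ⟨_, neg_nonpos.2 (ge_of_tendsto (hF z) (Eventually.of_forall hk0)),
        (tendsto_harmonicPart hm hk (hF z)).neg⟩) x
    rw [Pi.neg_apply] at h1
    linarith
  have hu1 := eq_zero_of_nonneg_of_eq_zero hG hm hu hu0 huo
  rw [hu1, sub_zero] at hku
  refine mem_dirichletSpace_of_tendsto_zero hm hf fun z => ?_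
  refine (tendsto_zero_iff_abs_tendsto_zero _).2 ?_
  refine (tendsto_zero_of_mem_dirichletSpace hm hku z).congr' ?_
  filter_upwards [(tendsto_zero_of_mem_dirichletSpace hm hku z).eventually (gt_mem_nhds one_pos)]
    with x hx
  simp only [hkdef] at hx ⊢
  exact min_eq_left ((min_lt_iff.1 hx).resolve_right (lt_irrefl 1)).le

lemma sub_mem_dirichletSpace_of_isTrace (hG : G.Connected)
    (hm : ∀ x, 0 < m {x} ∧ m {x} < ∞) (hμ : G.IsHarmonicMeasure m o μ) {f g : Lp ℝ 2 m}
    {φ : Lp ℝ 2 μ} (hf : (f : X → ℝ) ∈ G.formDomain m) (hg : (g : X → ℝ) ∈ G.formDomain m)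
    (h1 : G.IsTrace m μ f φ) (h2 : G.IsTrace m μ g φ) :
    (f - g : X → ℝ) ∈ G.dirichletSpace m := by
  have h3 := isTrace_sub hm hf hg h1 h2
  rw [sub_self] at h3
  rw [← coe_sub hm]
  exact mem_dirichletSpace_of_isTrace_zero hG hm hμ
    (by rw [coe_sub hm]; exact sub_mem hf hg) h3

lemma isTrace_of_sub_mem (hm : ∀ x, 0 < m {x} ∧ m {x} < ∞) {f g : Lp ℝ 2 m}
    {φ : Lp ℝ 2 μ} (hf : (f : X → ℝ) ∈ G.formDomain m) (h : (f - g : X → ℝ) ∈ G.dirichletSpace m)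
    (h1 : G.IsTrace m μ f φ) : G.IsTrace m μ g φ := by
  rw [IsTrace, ← trace_eq_of_sub_mem hm hf h]
  exact h1

/-- The `1`-harmonic extension is unique. -/
lemma isHarmonicExtension_unique (hG : G.Connected)
    (hm : ∀ x, 0 < m {x} ∧ m {x} < ∞) (hμ : G.IsHarmonicMeasure m o μ)
    {Φ : G.HarmonicBoundary m → EReal} {u v : Lp ℝ 2 m} (hu : G.IsHarmonicExtension m Φ u)
    (hv : G.IsHarmonicExtension m Φ v) : u = v := by
  obtain ⟨hu1, hu2⟩ := (isHarmonicExtension_iff hm).1 hu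
  obtain ⟨hv1, hv2⟩ := (isHarmonicExtension_iff hm).1 hv
  obtain ⟨K, -, hK⟩ := exists_trace_bound hm hμ
  obtain ⟨φ, hφ, -⟩ := hK u hu1.1
  have h1 : G.IsTrace m μ v φ := by
    rw [IsTrace, hv2, ← hu2]
    exact hφ
  exact coe_injective hm (eq_of_sub_mem_dirichletSpace hm hu1 hv1
    (sub_mem_dirichletSpace_of_isTrace hG hm hμ hu1.1 hv1.1 hφ h1))

lemma isHarmonicExtension_harmonicExtension (hm : ∀ x, 0 < m {x} ∧ m {x} < ∞) {f : Lp ℝ 2 m}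
    (hf : (f : X → ℝ) ∈ G.formDomain m) :
    G.IsHarmonicExtension m (G.trace m f) (G.harmonicExtension m (G.trace m f)) := by
  have hex : ∃ u, G.IsHarmonicExtension m (G.trace m f) u :=
    ⟨_, isHarmonicExtension_harmonicPart hm hf⟩
  rw [harmonicExtension, dif_pos hex]
  exact hex.choose_spec

lemma coe_harmonicExtension (hG : G.Connected)
    (hm : ∀ x, 0 < m {x} ∧ m {x} < ∞) (hμ : G.IsHarmonicMeasure m o μ) {f : Lp ℝ 2 m}
    (hf : (f : X → ℝ) ∈ G.formDomain m) :
    (G.harmonicExtension m (G.trace m f) : X → ℝ) = G.harmonicPart m f := by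
  rw [isHarmonicExtension_unique hG hm hμ (isHarmonicExtension_harmonicExtension hm hf)
    (isHarmonicExtension_harmonicPart hm hf), coe_toLp]

end Trace

end WeightedGraph
end

noncomputable section

/-! ### Bilinear forms of quadratic functionals -/

section AbstractForms

universe u

variable {H : Type u} [NormedAddCommGroup H] [InnerProductSpace ℝ H] {q : H → ℝ≥0∞}

/-- The bilinear form of a form `q`, on the domain of `q`. -/
def formBilin (q : H → ℝ≥0∞) (f g : H) : ℝ :=
  ((q (f + g)).toReal - (q f).toReal - (q g).toReal) / 2

/-- Identifies the bilinear form hidden in `IsForm` with the polarization `formBilin`, so that later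
computations need not carry `D` and `B`. -/
lemma IsForm.exists_bilin (hq : IsForm q) :
    ∃ (D : Submodule ℝ H) (B : LinearMap.BilinForm ℝ D), (∀ f g, B f g = B g f) ∧
      (∀ f, 0 ≤ B f f) ∧ (∀ f, q f < ∞ ↔ f ∈ D) ∧ (∀ f : D, q f = ENNReal.ofReal (B f f)) ∧
      ∀ f g : D, formBilin q f g = B f g := by
  obtain ⟨D, B, h1, h2, h3, h4⟩ := hq
  refine ⟨D, B, h1, h2, fun f => ⟨fun h => ?_, fun h => ?_⟩, h3, fun f g => ?_⟩
  · by_contra hf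
    rw [h4 f hf] at h
    exact lt_irrefl _ h
  · rw [h3 ⟨f, h⟩]
    exact ENNReal.ofReal_lt_top
  · have h5 := h3 (f + g)
    rw [Submodule.coe_add] at h5
    rw [formBilin, h5, h3 f, h3 g, ENNReal.toReal_ofReal (h2 _), ENNReal.toReal_ofReal (h2 _),
      ENNReal.toReal_ofReal (h2 _), map_add, map_add, LinearMap.add_apply, LinearMap.add_apply,
      h1 g f]
    ring

lemma IsForm.add_lt_top (hq : IsForm q) {f g : H} (hf : q f < ∞) (hg : q g < ∞) :
    q (f + g) < ∞ := by
  obtain ⟨D, B, -, -, h, -⟩ := hq.exists_bilin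
  rw [h] at hf hg ⊢
  exact add_mem hf hg

lemma IsForm.sub_lt_top (hq : IsForm q) {f g : H} (hf : q f < ∞) (hg : q g < ∞) :
    q (f - g) < ∞ := by
  obtain ⟨D, B, -, -, h, -⟩ := hq.exists_bilin
  rw [h] at hf hg ⊢
  exact sub_mem hf hg

lemma IsForm.smul_lt_top (hq : IsForm q) (r : ℝ) {f : H} (hf : q f < ∞) : q (r • f) < ∞ := by
  obtain ⟨D, B, -, -, h, -⟩ := hq.exists_bilin
  rw [h] at hf ⊢
  exact Submodule.smul_mem _ _ hf

lemma IsForm.map_zero (hq : IsForm q) : q 0 = 0 := by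
  obtain ⟨D, B, -, -, -, h, -⟩ := hq.exists_bilin
  simpa using h 0

lemma formBilin_comm (f g : H) : formBilin q f g = formBilin q g f := by
  rw [formBilin, formBilin, add_comm f g]
  ring

lemma IsForm.bilin_self (hq : IsForm q) {f : H} (hf : q f < ∞) :
    formBilin q f f = (q f).toReal := by
  obtain ⟨D, B, -, h2, h3, h4, h5⟩ := hq.exists_bilin
  have hf' := (h3 f).1 hf
  have h6 := h5 ⟨f, hf'⟩ ⟨f, hf'⟩
  have h7 := h4 ⟨f, hf'⟩
  dsimp only at h6 h7
  rw [h6, h7, ENNReal.toReal_ofReal (h2 _)]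

lemma IsForm.bilin_add_left (hq : IsForm q) {f g h : H} (hf : q f < ∞) (hg : q g < ∞)
    (hh : q h < ∞) : formBilin q (f + g) h = formBilin q f h + formBilin q g h := by
  obtain ⟨D, B, -, h2, h3, h4, h5⟩ := hq.exists_bilin
  have h6 := h5 (⟨f, (h3 f).1 hf⟩ + ⟨g, (h3 g).1 hg⟩) ⟨h, (h3 h).1 hh⟩
  rw [_root_.map_add, LinearMap.add_apply, ← h5, ← h5] at h6
  exact h6

lemma IsForm.bilin_smul_left (hq : IsForm q) (r : ℝ) {f h : H} (hf : q f < ∞)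
    (hh : q h < ∞) : formBilin q (r • f) h = r * formBilin q f h := by
  obtain ⟨D, B, -, h2, h3, h4, h5⟩ := hq.exists_bilin
  have h6 := h5 (r • ⟨f, (h3 f).1 hf⟩) ⟨h, (h3 h).1 hh⟩
  rw [_root_.map_smul, LinearMap.smul_apply, ← h5] at h6
  exact h6

lemma IsForm.bilin_sub_left (hq : IsForm q) {f g h : H} (hf : q f < ∞) (hg : q g < ∞)
    (hh : q h < ∞) : formBilin q (f - g) h = formBilin q f h - formBilin q g h := by
  have h1 := hq.bilin_add_left (hq.sub_lt_top hf hg) hg hh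
  rw [sub_add_cancel] at h1
  linarith

lemma IsForm.toReal_sub (hq : IsForm q) {f g : H} (hf : q f < ∞) (hg : q g < ∞) :
    (q (f - g)).toReal = (q f).toReal - 2 * formBilin q f g + (q g).toReal := by
  have hs := hq.sub_lt_top hf hg
  rw [← hq.bilin_self hs, hq.bilin_sub_left hf hg hs, formBilin_comm f, formBilin_comm g,
    hq.bilin_sub_left hf hg hf, hq.bilin_sub_left hf hg hg, hq.bilin_self hf, hq.bilin_self hg,
    formBilin_comm g]
  ring

lemma toReal_form_add (f g : H) :
    (q (f + g)).toReal = (q f).toReal + 2 * formBilin q f g + (q g).toReal := by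
  rw [formBilin]
  ring

lemma formOne_lt_top_iff {f : H} : formOne q f < ∞ ↔ q f < ∞ := by
  rw [formOne, ENNReal.add_lt_top]
  exact and_iff_left (ENNReal.pow_lt_top enorm_lt_top)

lemma toReal_formOne {f : H} (hf : q f < ∞) :
    (formOne q f).toReal = (q f).toReal + ‖f‖ ^ 2 := by
  rw [formOne, ENNReal.toReal_add hf.ne (ENNReal.pow_lt_top enorm_lt_top).ne, ENNReal.toReal_pow,
    toReal_enorm]

/-! ### The Hilbert space of a closed form -/

/-- The domain of a form, without the norm of the ambient Hilbert space. -/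
def FormSpace (D : Submodule ℝ H) : Type u := D

instance (D : Submodule ℝ H) : AddCommGroup (FormSpace D) := inferInstanceAs (AddCommGroup D)

instance (D : Submodule ℝ H) : Module ℝ (FormSpace D) := inferInstanceAs (Module ℝ D)

/-- For t > 0 the norm of t q + ‖·‖² is equivalent to the form norm, so closedness makes the domain
a Hilbert space whose inclusion `J` is bounded and has an adjoint. -/
lemma exists_hilbertSpace (hq : IsForm q) (hc : IsClosedForm q) {t : ℝ} (ht : 0 < t) :
    ∃ (V : Type u) (_ : NormedAddCommGroup V) (_ : InnerProductSpace ℝ V) (_ : CompleteSpace V)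
      (J : V →L[ℝ] H), (∀ v, q (J v) < ∞) ∧ (∀ f, q f < ∞ → ∃ v, J v = f) ∧
      ∀ v w, inner ℝ v w = t * formBilin q (J v) (J w) + inner ℝ (J v) (J w) := by
  obtain ⟨D, B, h1, h2, h3, h4, h5⟩ := hq.exists_bilin
  let J₀ : FormSpace D →ₗ[ℝ] H := D.subtype
  have hJ₀ : ∀ v, q (J₀ v) < ∞ := fun v => (h3 _).2 v.2
  have hinj : ∀ v, J₀ v = 0 → v = 0 := fun v hv => Subtype.ext hv
  let core : InnerProductSpace.Core ℝ (FormSpace D) :=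
    { inner := fun v w => t * formBilin q (J₀ v) (J₀ w) + inner ℝ (J₀ v) (J₀ w)
      conj_inner_symm := fun v w => by
        simp only [conj_trivial]
        rw [formBilin_comm, real_inner_comm]
      re_inner_nonneg := fun v => by
        simp only [RCLike.re_to_real]
        rw [hq.bilin_self (hJ₀ v), real_inner_self_eq_norm_sq]
        exact add_nonneg (mul_nonneg ht.le ENNReal.toReal_nonneg) (sq_nonneg _)
      add_left := fun u v w => by
        rw [_root_.map_add, hq.bilin_add_left (hJ₀ u) (hJ₀ v) (hJ₀ w), inner_add_left]
        ring
      smul_left := fun v w r => by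
        rw [_root_.map_smul, hq.bilin_smul_left r (hJ₀ v) (hJ₀ w), real_inner_smul_left]
        simp only [conj_trivial]
        ring
      definite := fun v hv => by
        refine hinj v ?_
        rw [hq.bilin_self (hJ₀ v), real_inner_self_eq_norm_sq] at hv
        have h6 : 0 ≤ t * (q (J₀ v)).toReal := mul_nonneg ht.le ENNReal.toReal_nonneg
        have h7 : ‖J₀ v‖ ^ 2 = 0 := by nlinarith [sq_nonneg ‖J₀ v‖]
        simpa using h7 }
  let i1 : NormedAddCommGroup (FormSpace D) := core.toNormedAddCommGroup
  let i2 : InnerProductSpace ℝ (FormSpace D) := InnerProductSpace.ofCore core.toCore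
  have hinner : ∀ v w : FormSpace D,
      inner ℝ v w = t * formBilin q (J₀ v) (J₀ w) + inner ℝ (J₀ v) (J₀ w) := fun v w => rfl
  have hnorm : ∀ v : FormSpace D, ‖v‖ ^ 2 = t * (q (J₀ v)).toReal + ‖J₀ v‖ ^ 2 := fun v => by
    rw [← real_inner_self_eq_norm_sq, hinner, hq.bilin_self (hJ₀ v), real_inner_self_eq_norm_sq]
  let J : FormSpace D →L[ℝ] H := J₀.mkContinuous 1 fun v => by
    rw [one_mul]
    refine (sq_le_sq₀ (norm_nonneg _) (norm_nonneg _)).1 ?_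
    rw [hnorm]
    exact le_add_of_nonneg_left (mul_nonneg ht.le ENNReal.toReal_nonneg)
  refine ⟨FormSpace D, i1, i2, ?_, J, hJ₀, fun f hf => ⟨⟨f, (h3 f).1 hf⟩, rfl⟩, hinner⟩
  -- Closedness is stated for `formOne`. The Cauchy condition is translated with the factor t⁻¹ + 1,
  -- the limit back with t + 1.
  refine Metric.complete_of_cauchySeq_tendsto fun u hu => ?_
  have hone : ∀ v : FormSpace D, formOne q (J₀ v) ≤ ENNReal.ofReal ((t⁻¹ + 1) * ‖v‖ ^ 2) := by
    intro v
    rw [ENNReal.le_ofReal_iff_toReal_le (formOne_lt_top_iff.2 (hJ₀ v)).ne (by positivity),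
      toReal_formOne (hJ₀ v), hnorm]
    have h6 : (t⁻¹ + 1) * (t * (q (J₀ v)).toReal + ‖J₀ v‖ ^ 2) = (q (J₀ v)).toReal
        + ‖J₀ v‖ ^ 2 + (t * (q (J₀ v)).toReal + t⁻¹ * ‖J₀ v‖ ^ 2) := by
      field_simp
      ring
    rw [h6]
    have := ENNReal.toReal_nonneg (a := q (J₀ v))
    exact le_add_of_nonneg_right (by positivity)
  obtain ⟨v, hv, hlim⟩ := hc (fun n => J₀ (u n)) (fun n => hJ₀ _) fun ε hε => by
    obtain ⟨δ, hδ, hδε⟩ := ENNReal.lt_iff_exists_nnreal_btwn.1 hε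
    have hδ' : (0 : ℝ) < δ := by exact_mod_cast hδ
    obtain ⟨N, hN⟩ := Metric.cauchySeq_iff.1 hu (√(δ / (t⁻¹ + 1)))
      (Real.sqrt_pos.2 (by positivity))
    refine ⟨N, fun k hk n hn => ?_⟩
    rw [← map_sub]
    refine ((hone _).trans_lt ?_).trans hδε
    rw [← ENNReal.ofReal_coe_nnreal, ENNReal.ofReal_lt_ofReal_iff hδ', ← lt_div_iff₀' (by positivity)]
    have h6 := hN k hk n hn
    rw [dist_eq_norm] at h6
    calc ‖u k - u n‖ ^ 2 < √(δ / (t⁻¹ + 1)) ^ 2 := by gcongr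
      _ = δ / (t⁻¹ + 1) := Real.sq_sqrt (by positivity)
  refine ⟨⟨v, (h3 v).1 hv⟩, tendsto_iff_norm_sub_tendsto_zero.2 ?_⟩
  set v' : FormSpace D := ⟨v, (h3 v).1 hv⟩
  have h6 : Tendsto (fun n => (t + 1) * (formOne q (J₀ (u n) - v)).toReal) atTop (𝓝 0) := by
    simpa using ((ENNReal.tendsto_toReal ENNReal.zero_ne_top).comp hlim).const_mul (t + 1)
  have h7 : Tendsto (fun n => ‖u n - v'‖ ^ 2) atTop (𝓝 0) := by
    refine squeeze_zero (fun n => sq_nonneg _) (fun n => ?_) h6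
    have h8 : J₀ (u n) - v = J₀ (u n - v') := by rw [map_sub]; rfl
    rw [h8, toReal_formOne (hJ₀ _), hnorm]
    have := ENNReal.toReal_nonneg (a := q (J₀ (u n - v')))
    nlinarith [sq_nonneg ‖J₀ (u n - v')‖]
  have h9 := h7.sqrt
  simpa [Real.sqrt_sq (norm_nonneg _)] using h9

/-! ### Resolvents -/

/-- `T = (1 + t L)⁻¹`, where `L` is the operator associated with `q`. -/
def IsResolvent (q : H → ℝ≥0∞) (t : ℝ) (T : H →L[ℝ] H) : Prop :=
  (∀ f, q (T f) < ∞) ∧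
  (∀ f v, q v < ∞ → t * formBilin q (T f) v + inner ℝ (T f) v = inner ℝ f v) ∧
  ∀ f g, inner ℝ (T f) g = inner ℝ f (T g)

/-- The resolvent is J J*: in the form inner product, ⟨J* f, w⟩ = ⟨f, J w⟩ is the resolvent
equation. -/
lemma exists_isResolvent [CompleteSpace H] (hq : IsForm q) (hc : IsClosedForm q) {t : ℝ}
    (ht : 0 < t) : ∃ T, IsResolvent q t T := by
  obtain ⟨V, i1, i2, i3, J, h1, h2, h3⟩ := exists_hilbertSpace hq hc ht
  refine ⟨J.comp (ContinuousLinearMap.adjoint J), fun f => h1 _, fun f v hv => ?_, fun f g => ?_⟩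
  · obtain ⟨w, rfl⟩ := h2 v hv
    rw [ContinuousLinearMap.comp_apply, ← h3, ContinuousLinearMap.adjoint_inner_left]
  · rw [ContinuousLinearMap.comp_apply, ContinuousLinearMap.comp_apply,
      ← ContinuousLinearMap.adjoint_inner_right, ContinuousLinearMap.adjoint_inner_left]

/-- The estimates for resolvents. -/
lemma IsResolvent.estimate (hq : IsForm q) {t : ℝ} {T : H →L[ℝ] H}
    (hT : IsResolvent q t T) {f : H} (hf : q f < ∞) :
    t / 2 * ((q (T f)).toReal + (q (T f - f)).toReal) + ‖T f - f‖ ^ 2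
      = t / 2 * (q f).toReal := by
  have h1 := hT.2.1 f (T f - f) (hq.sub_lt_top (hT.1 f) hf)
  have h2 := hq.toReal_sub (hT.1 f) hf
  rw [formBilin_comm, hq.bilin_sub_left (hT.1 f) hf (hT.1 f), hq.bilin_self (hT.1 f),
    formBilin_comm f] at h1
  have h3 : inner ℝ (T f) (T f - f) - inner ℝ f (T f - f) = ‖T f - f‖ ^ 2 := by
    rw [← inner_sub_left, real_inner_self_eq_norm_sq]
  rw [h2, ← h3]
  linear_combination h1

/-- The approximating form at a resolvent. -/
def approxForm (t : ℝ) (T : H →L[ℝ] H) (f g : H) : ℝ := t⁻¹ * (inner ℝ f g - inner ℝ (T f) g)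

lemma IsResolvent.approxForm_eq {t : ℝ} (ht : 0 < t) {T : H →L[ℝ] H}
    (hT : IsResolvent q t T) {f g : H} (hg : q g < ∞) :
    approxForm t T f g = formBilin q (T f) g := by
  rw [approxForm, ← hT.2.1 f g hg, add_sub_cancel_right, inv_mul_cancel_left₀ ht.ne']

/-- The approximating form is q(Tₙ f, f), so weak convergence Tₙ f → f in the Hilbert space of the
form suffices. The resolvent estimate bounds the sequence. The range of J* is dense because J is
injective, and on it weak convergence reduces to Tₙ f → f in `H`. -/
lemma tendsto_approxForm_self [CompleteSpace H] (hq : IsForm q) (hc : IsClosedForm q)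
    {t : ℕ → ℝ} (ht : ∀ n, 0 < t n) (ht1 : ∀ n, t n ≤ 1) (ht0 : Tendsto t atTop (𝓝 0))
    {T : ℕ → H →L[ℝ] H} (hT : ∀ n, IsResolvent q (t n) (T n)) {f : H} (hf : q f < ∞) :
    Tendsto (fun n => approxForm (t n) (T n) f f) atTop (𝓝 (q f).toReal) := by
  obtain ⟨V, i1, i2, i3, J, h1, h2, h3⟩ := exists_hilbertSpace hq hc one_pos
  obtain ⟨w, hw⟩ := h2 f hf
  choose v hv using fun n => h2 (T n f) ((hT n).1 f)
  have hest := fun n => (hT n).estimate hq hf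
  have hTf : Tendsto (fun n => T n f) atTop (𝓝 f) := by
    refine tendsto_iff_norm_sub_tendsto_zero.2 ?_
    have h4 : Tendsto (fun n => ‖T n f - f‖ ^ 2) atTop (𝓝 0) := by
      refine squeeze_zero (g := fun n => t n / 2 * (q f).toReal) (fun n => sq_nonneg _)
        (fun n => ?_) (by simpa using (ht0.div_const 2).mul_const (q f).toReal)
      rw [← hest n]
      have := ht n
      exact le_add_of_nonneg_left (by positivity)
    simpa [Real.sqrt_sq (norm_nonneg _)] using h4.sqrt
  have hnorm : ∀ u : V, ‖u‖ ^ 2 = (q (J u)).toReal + ‖J u‖ ^ 2 := fun u => by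
    rw [← real_inner_self_eq_norm_sq, h3, hq.bilin_self (h1 u), real_inner_self_eq_norm_sq, one_mul]
  have hbd : ∀ n, ‖v n - w‖ ≤ √(2 * (q f).toReal) := fun n => by
    refine Real.le_sqrt_of_sq_le ?_
    rw [hnorm, map_sub, hv, hw]
    have h4 := hest n
    have h5 := ht n
    have h6 := ht1 n
    have h7 : 0 ≤ (q (T n f)).toReal := ENNReal.toReal_nonneg
    have h8 : 0 ≤ (q (T n f - f)).toReal := ENNReal.toReal_nonneg
    have h9 : 0 ≤ (q f).toReal := ENNReal.toReal_nonneg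
    have h10 : (q (T n f - f)).toReal ≤ (q f).toReal := by
      by_contra h11
      push Not at h11
      nlinarith [mul_pos h5 (sub_pos.2 h11), mul_nonneg h5.le h7, sq_nonneg ‖T n f - f‖]
    nlinarith [mul_nonneg h5.le h7, mul_nonneg h5.le h8]
  have hdense : Dense (Set.range (ContinuousLinearMap.adjoint J)) := by
    have h4 : ((ContinuousLinearMap.adjoint J).range)ᗮ = ⊥ := by
      refine (Submodule.eq_bot_iff _).2 fun u hu => ?_
      have h5 : inner ℝ (J u) (J u) = 0 := by
        rw [← ContinuousLinearMap.adjoint_inner_left]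
        exact Submodule.inner_right_of_mem_orthogonal (LinearMap.mem_range_self _ (J u)) hu
      have h6 : J u = 0 := inner_self_eq_zero.1 h5
      have h7 := hnorm u
      rw [h6, hq.map_zero] at h7
      simpa using h7
    have h8 := Submodule.dense_iff_topologicalClosure_eq_top.2
      (Submodule.topologicalClosure_eq_top_iff.2 h4)
    exact h8
  have hweak := tendsto_inner_of_dense hbd hdense (by
    rintro _ ⟨h, rfl⟩
    simp only [ContinuousLinearMap.adjoint_inner_right, hv, hw]
    exact hTf.inner tendsto_const_nhds) w
  simp only [h3, hv, hw, one_mul, hq.bilin_self hf] at hweak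
  have h4 := hweak.sub (hTf.inner (tendsto_const_nhds (x := f)))
  simp only [add_sub_cancel_right] at h4
  exact h4.congr fun n => ((hT n).approxForm_eq (ht n) hf).symm

/-- Polarization, using the symmetry of the resolvents. -/
lemma tendsto_approxForm [CompleteSpace H] (hq : IsForm q) (hc : IsClosedForm q)
    {t : ℕ → ℝ} (ht : ∀ n, 0 < t n) (ht1 : ∀ n, t n ≤ 1) (ht0 : Tendsto t atTop (𝓝 0))
    {T : ℕ → H →L[ℝ] H} (hT : ∀ n, IsResolvent q (t n) (T n)) {f g : H} (hf : q f < ∞)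
    (hg : q g < ∞) :
    Tendsto (fun n => approxForm (t n) (T n) f g) atTop (𝓝 (formBilin q f g)) := by
  have h1 := tendsto_approxForm_self hq hc ht ht1 ht0 hT (hq.add_lt_top hf hg)
  have h2 := tendsto_approxForm_self hq hc ht ht1 ht0 hT hf
  have h3 := tendsto_approxForm_self hq hc ht ht1 ht0 hT hg
  refine (((h1.sub h2).sub h3).div_const 2).congr fun n => ?_
  simp only [approxForm, _root_.map_add, inner_add_left, inner_add_right]
  rw [(hT n).2.2 g f, real_inner_comm f g, real_inner_comm (T n f) g]
  ring

end AbstractForms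
end

noncomputable section

/-! ### Resolvents of Dirichlet forms are Markovian -/

/-- If `0 ≤ f ≤ 1`, then `0 ≤ T f ≤ 1` for the resolvents `T` of a Markovian form. -/
lemma IsResolvent.markovian {Ω : Type*} [MeasurableSpace Ω] {ν : Measure Ω}
    {q : Lp ℝ 2 ν → ℝ≥0∞} (hq : IsForm q) (hM : IsMarkovian q) {t : ℝ} (ht : 0 < t)
    {T : Lp ℝ 2 ν →L[ℝ] Lp ℝ 2 ν} (hT : IsResolvent q t T) {f : Lp ℝ 2 ν}
    (h0 : ∀ᵐ x ∂ν, 0 ≤ f x) (h1 : ∀ᵐ x ∂ν, f x ≤ 1) :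
    ∀ᵐ x ∂ν, 0 ≤ T f x ∧ T f x ≤ 1 := by
  have hC0 : min (max (0 : ℝ) 0) 1 = 0 := by simp
  have hC := min_max_lipschitz 1
  -- `T f` minimizes v ↦ t q(v) + ‖v − f‖². Clipping it to [0, 1] increases neither term, because
  -- `f` takes values there, and uniqueness of the minimizer gives w = v.
  set v := T f
  set w := hC.compLp hC0 v
  have hwv : q w ≤ q v := hM _ hC hC0 v
  have hv : q v < ∞ := hT.1 f
  have hw : q w < ∞ := hwv.trans_lt hv
  have hnorm : ‖w - f‖ ≤ ‖v - f‖ := by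
    refine Lp.norm_le_norm_of_ae_le ?_
    filter_upwards [hC.coeFn_compLp hC0 v, Lp.coeFn_sub w f, Lp.coeFn_sub v f, h0, h1]
      with x h2 h3 h4 h5 h6
    rw [h3, h4, Pi.sub_apply, Pi.sub_apply, h2]
    have h7 := WeightedGraph.abs_le_of_contraction hC (v x) (f x)
    simp only [max_eq_left h5, min_eq_left h6] at h7
    exact h7
  have e1 := hT.2.1 f (w - v) (hq.sub_lt_top hw hv)
  have e2 := hq.toReal_sub hw hv
  rw [formBilin_comm, hq.bilin_sub_left hw hv hv, hq.bilin_self hv] at e1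
  have e3 : ‖w - f‖ ^ 2 = ‖w - v‖ ^ 2 + 2 * inner ℝ (v - f) (w - v) + ‖v - f‖ ^ 2 := by
    rw [show w - f = (w - v) + (v - f) by abel, norm_add_sq_real, real_inner_comm]
  have e4 : inner ℝ (v - f) (w - v) = inner ℝ v (w - v) - inner ℝ f (w - v) := inner_sub_left _ _ _
  have e5 : ‖w - f‖ ^ 2 ≤ ‖v - f‖ ^ 2 := by gcongr
  have e6 : (q w).toReal ≤ (q v).toReal := ENNReal.toReal_mono hv.ne hwv
  have e7 : 0 ≤ (q (w - v)).toReal := ENNReal.toReal_nonneg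
  have e8 : ‖w - v‖ ^ 2 = 0 := by
    refine le_antisymm ?_ (sq_nonneg _)
    nlinarith [mul_nonneg ht.le e7, mul_le_mul_of_nonneg_left e6 ht.le]
  have e9 : w = v := by
    rw [← sub_eq_zero]
    simpa using e8
  filter_upwards [hC.coeFn_compLp hC0 v] with x hx
  have : (v : Ω → ℝ) x = min (max (v x) 0) 1 := by
    conv_lhs => rw [← e9]
    exact hx
  rw [this]
  exact ⟨le_min (le_max_right _ _) zero_le_one, min_le_right _ _⟩

namespace WeightedGraph

variable {X : Type*} [MeasurableSpace X] {m : Measure X} [Countable X] [DiscreteMeasurableSpace X]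

/-! ### Finitely supported elements of `ℓ²(X, m)` -/

/-- The characteristic function of a vertex as an element of `ℓ²(X, m)`. -/
def vertexLp (hm : ∀ x, 0 < m {x} ∧ m {x} < ∞) (x : X) : Lp ℝ 2 m :=
  indicatorConstLp 2 (MeasurableSet.singleton x) (hm x).2.ne 1

lemma coe_vertexLp (hm : ∀ x, 0 < m {x} ∧ m {x} < ∞) (x : X) :
    (vertexLp hm x : X → ℝ) = vertexFn x :=
  funext ((ae_iff_forall hm).1 indicatorConstLp_coeFn)

lemma inner_vertexLp (hm : ∀ x, 0 < m {x} ∧ m {x} < ∞) (f : Lp ℝ 2 m) (x : X) :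
    inner ℝ f (vertexLp hm x) = m.real {x} * f x := by
  rw [real_inner_comm, vertexLp, L2.inner_indicatorConstLp_eq_inner_setIntegral]
  simp [mul_comm, Measure.real]

lemma norm_sq_eq_tsum (hm : ∀ x, 0 < m {x} ∧ m {x} < ∞) (f : Lp ℝ 2 m) :
    (Summable fun x => m.real {x} * f x ^ 2) ∧ ‖f‖ ^ 2 = ∑' x, m.real {x} * f x ^ 2 := by
  have h0 : ∀ x, 0 ≤ m.real {x} * f x ^ 2 := fun x => mul_nonneg measureReal_nonneg (sq_nonneg _)
  have h1 : ‖f‖ₑ ^ 2 = ∑' x, ENNReal.ofReal (m.real {x} * f x ^ 2) := by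
    rw [Lp.enorm_def, sq_eLpNorm_two hm]
  have h2 : (∑' x, ENNReal.ofReal (m.real {x} * f x ^ 2)) ≠ ∞ := by
    rw [← h1]
    exact (ENNReal.pow_lt_top enorm_lt_top).ne
  have h3 : Summable fun x => m.real {x} * f x ^ 2 :=
    (ENNReal.summable_toReal h2).congr fun x => ENNReal.toReal_ofReal (h0 x)
  refine ⟨h3, ?_⟩
  rw [← ENNReal.ofReal_tsum_of_nonneg h0 h3] at h1
  have h4 := congrArg ENNReal.toReal h1
  rwa [ENNReal.toReal_pow, toReal_enorm, ENNReal.toReal_ofReal (tsum_nonneg h0)] at h4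

lemma coe_sum_vertexLp (hm : ∀ x, 0 < m {x} ∧ m {x} < ∞) (a : X → ℝ) (K : Finset X) (y : X) :
    open Classical in
    (∑ x ∈ K, a x • vertexLp hm x : Lp ℝ 2 m) y = if y ∈ K then a y else 0 := by
  classical
  induction K using Finset.induction_on with
  | empty =>
    rw [Finset.sum_empty, coe_zero hm]
    simp
  | insert x K hx ih =>
    rw [Finset.sum_insert hx, coe_add hm, Pi.add_apply, ih, coe_smul hm, Pi.smul_apply,
      coe_vertexLp]
    by_cases hy : y = x
    · simp [hy, hx]
    · simp [vertexFn_of_ne hy, hy]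

lemma hasSum_vertexLp (hm : ∀ x, 0 < m {x} ∧ m {x} < ∞) (f : Lp ℝ 2 m) :
    Tendsto (fun K : Finset X => ∑ x ∈ K, f x • vertexLp hm x) atTop (𝓝 f) := by
  classical
  obtain ⟨hs, -⟩ := norm_sq_eq_tsum hm f
  have h1 : ∀ K : Finset X, ‖(∑ x ∈ K, f x • vertexLp hm x) - f‖ ^ 2
      = ∑' x, m.real {x} * f x ^ 2 - ∑ x ∈ K, m.real {x} * f x ^ 2 := by
    intro K
    rw [(norm_sq_eq_tsum hm _).2, eq_sub_iff_add_eq,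
      sum_eq_tsum_indicator (fun x => m.real {x} * f x ^ 2) K,
      ← Summable.tsum_add (norm_sq_eq_tsum hm _).1 (hs.indicator _)]
    refine tsum_congr fun x => ?_
    rw [coe_sub hm, Pi.sub_apply, coe_sum_vertexLp]
    by_cases hx : x ∈ K
    · simp [hx]
    · simp [hx]
  have h2 : Tendsto (fun K : Finset X => ‖(∑ x ∈ K, f x • vertexLp hm x) - f‖ ^ 2) atTop
      (𝓝 0) := by
    simp only [h1]
    have h3 := hs.hasSum.const_sub (∑' x, m.real {x} * f x ^ 2)
    rwa [sub_self] at h3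
  refine tendsto_iff_norm_sub_tendsto_zero.2 ?_
  simpa [Real.sqrt_sq (norm_nonneg _)] using h2.sqrt

/-- The discrete energy inequality for a symmetric sub-Markovian kernel. -/
lemma sum_energy_le {τ : X → X → ℝ} {κ : X → ℝ} {K : Finset X} {J : Finset (X × X)}
    (hτ : ∀ x y, 0 ≤ τ x y) (hsymm : ∀ x y, τ x y = τ y x)
    (hκ : ∀ x, ∑ y ∈ K, τ x y ≤ κ x) (hJ : J ⊆ K ×ˢ K) {f g : X → ℝ}
    (h1 : ∀ x, |g x| ≤ |f x|) (h2 : ∀ x y, |g x - g y| ≤ |f x - f y|) :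
    (∑ x ∈ K, κ x * g x ^ 2 - ∑ x ∈ K, ∑ y ∈ K, τ x y * (g x * g y))
      + 2⁻¹ * ∑ p ∈ J, τ p.1 p.2 * ((f p.1 - f p.2) ^ 2 - (g p.1 - g p.2) ^ 2)
      ≤ ∑ x ∈ K, κ x * f x ^ 2 - ∑ x ∈ K, ∑ y ∈ K, τ x y * (f x * f y) := by
  -- Summation by parts into a jump part and a killing part with weight κ − ∑ τ ≥ 0. A contraction
  -- lowers each term of both, so the jump terms from `J` may be kept and the other decreases
  -- dropped.
  have key : ∀ h : X → ℝ, ∑ x ∈ K, κ x * h x ^ 2 - ∑ x ∈ K, ∑ y ∈ K, τ x y * (h x * h y)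
      = 2⁻¹ * ∑ p ∈ K ×ˢ K, τ p.1 p.2 * (h p.1 - h p.2) ^ 2
        + ∑ x ∈ K, (κ x - ∑ y ∈ K, τ x y) * h x ^ 2 := by
    intro h
    have e1 : ∑ p ∈ K ×ˢ K, τ p.1 p.2 * (h p.1 - h p.2) ^ 2
        = ∑ x ∈ K, ∑ y ∈ K, τ x y * h x ^ 2 - 2 * ∑ x ∈ K, ∑ y ∈ K, τ x y * (h x * h y)
          + ∑ x ∈ K, ∑ y ∈ K, τ x y * h y ^ 2 := by
      rw [Finset.sum_product, Finset.mul_sum, ← Finset.sum_sub_distrib, ← Finset.sum_add_distrib]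
      refine Finset.sum_congr rfl fun x _ => ?_
      rw [Finset.mul_sum, ← Finset.sum_sub_distrib, ← Finset.sum_add_distrib]
      exact Finset.sum_congr rfl fun y _ => by ring
    have e2 : ∑ x ∈ K, ∑ y ∈ K, τ x y * h y ^ 2 = ∑ x ∈ K, ∑ y ∈ K, τ x y * h x ^ 2 := by
      rw [Finset.sum_comm]
      exact Finset.sum_congr rfl fun x _ => Finset.sum_congr rfl fun y _ => by rw [hsymm]
    have e3 : ∑ x ∈ K, (κ x - ∑ y ∈ K, τ x y) * h x ^ 2
        = ∑ x ∈ K, κ x * h x ^ 2 - ∑ x ∈ K, ∑ y ∈ K, τ x y * h x ^ 2 := by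
      rw [← Finset.sum_sub_distrib]
      exact Finset.sum_congr rfl fun x _ => by rw [sub_mul, Finset.sum_mul]
    rw [e1, e2, e3]
    ring
  rw [key f, key g]
  have e4 : ∑ x ∈ K, (κ x - ∑ y ∈ K, τ x y) * g x ^ 2
      ≤ ∑ x ∈ K, (κ x - ∑ y ∈ K, τ x y) * f x ^ 2 :=
    Finset.sum_le_sum fun x _ => mul_le_mul_of_nonneg_left (sq_le_sq.2 (h1 x))
      (sub_nonneg.2 (hκ x))
  have e5 : ∑ p ∈ J, τ p.1 p.2 * ((f p.1 - f p.2) ^ 2 - (g p.1 - g p.2) ^ 2)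
      ≤ ∑ p ∈ K ×ˢ K, τ p.1 p.2 * ((f p.1 - f p.2) ^ 2 - (g p.1 - g p.2) ^ 2) :=
    Finset.sum_le_sum_of_subset_of_nonneg hJ fun p _ _ =>
      mul_nonneg (hτ _ _) (sub_nonneg.2 (sq_le_sq.2 (h2 _ _)))
  have e6 : ∑ p ∈ K ×ˢ K, τ p.1 p.2 * ((f p.1 - f p.2) ^ 2 - (g p.1 - g p.2) ^ 2)
      = ∑ p ∈ K ×ˢ K, τ p.1 p.2 * (f p.1 - f p.2) ^ 2
        - ∑ p ∈ K ×ˢ K, τ p.1 p.2 * (g p.1 - g p.2) ^ 2 := by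
    rw [← Finset.sum_sub_distrib]
    exact Finset.sum_congr rfl fun p _ => by ring
  linarith

/-- The energy inequality for the resolvents of a Dirichlet form. -/
lemma resolvent_energy_le (hm : ∀ x, 0 < m {x} ∧ m {x} < ∞) {q : Lp ℝ 2 m → ℝ≥0∞}
    (hq : IsForm q) (hM : IsMarkovian q) {t : ℝ} (ht : 0 < t)
    {T : Lp ℝ 2 m →L[ℝ] Lp ℝ 2 m} (hT : IsResolvent q t T) {C : ℝ → ℝ} (hC : LipschitzWith 1 C)
    (h0 : C 0 = 0) (f : Lp ℝ 2 m) (J : Finset (X × X)) :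
    (‖hC.compLp h0 f‖ ^ 2 - inner ℝ (T (hC.compLp h0 f)) (hC.compLp h0 f))
      + 2⁻¹ * ∑ p ∈ J, inner ℝ (T (vertexLp hm p.1)) (vertexLp hm p.2)
        * ((f p.1 - f p.2) ^ 2 - (C (f p.1) - C (f p.2)) ^ 2)
      ≤ ‖f‖ ^ 2 - inner ℝ (T f) f := by
  classical
  set g := hC.compLp h0 f
  have hg : ∀ x, g x = C (f x) := congrFun (coe_compLp hm hC h0 f)
  -- The sub-Markov property on finite indicators gives both nonnegativity of the kernel ⟨T 1_x,
  -- 1_y⟩ and the bound m(x) on its row sums.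
  have hTK : ∀ K : Finset X, ∀ y, 0 ≤ T (∑ x ∈ K, vertexLp hm x) y ∧
      T (∑ x ∈ K, vertexLp hm x) y ≤ 1 := by
    intro K
    have h1 := coe_sum_vertexLp hm (fun _ => 1) K
    simp only [one_smul] at h1
    refine (ae_iff_forall hm).1 (hT.markovian hq hM ht ((ae_iff_forall hm).2 fun x => ?_)
      ((ae_iff_forall hm).2 fun x => ?_))
    · rw [h1]; split_ifs <;> norm_num
    · rw [h1]; split_ifs <;> norm_num
  have hτ : ∀ x y, 0 ≤ inner ℝ (T (vertexLp hm x)) (vertexLp hm y) := fun x y => by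
    rw [inner_vertexLp]
    have := (hTK {x} y).1
    rw [Finset.sum_singleton] at this
    exact mul_nonneg measureReal_nonneg this
  have hsymm : ∀ x y, inner ℝ (T (vertexLp hm x)) (vertexLp hm y)
      = inner ℝ (T (vertexLp hm y)) (vertexLp hm x) := fun x y => by
    rw [hT.2.2, real_inner_comm]
  have hκ : ∀ (K : Finset X) x, ∑ y ∈ K, inner ℝ (T (vertexLp hm x)) (vertexLp hm y)
      ≤ m.real {x} := fun K x => by
    rw [Finset.sum_congr rfl fun y _ => hsymm x y, ← sum_inner, ← map_sum, inner_vertexLp]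
    exact mul_le_of_le_one_right measureReal_nonneg (hTK K x).2
  have hquad : ∀ (h : Lp ℝ 2 m) (K : Finset X),
      ‖∑ x ∈ K, h x • vertexLp hm x‖ ^ 2
        - inner ℝ (T (∑ x ∈ K, h x • vertexLp hm x)) (∑ x ∈ K, h x • vertexLp hm x)
      = ∑ x ∈ K, m.real {x} * h x ^ 2
        - ∑ x ∈ K, ∑ y ∈ K, inner ℝ (T (vertexLp hm x)) (vertexLp hm y) * (h x * h y) := by
    intro h K
    congr 1
    · rw [← real_inner_self_eq_norm_sq, inner_sum]
      refine Finset.sum_congr rfl fun x hx => ?_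
      rw [real_inner_smul_right, inner_vertexLp, coe_sum_vertexLp, if_pos hx]
      ring
    · rw [map_sum, sum_inner]
      refine Finset.sum_congr rfl fun x _ => ?_
      rw [inner_sum]
      refine Finset.sum_congr rfl fun y _ => ?_
      rw [map_smul, real_inner_smul_left, real_inner_smul_right]
      ring
  have hlim : ∀ h : Lp ℝ 2 m, Tendsto (fun K : Finset X =>
      ∑ x ∈ K, m.real {x} * h x ^ 2
        - ∑ x ∈ K, ∑ y ∈ K, inner ℝ (T (vertexLp hm x)) (vertexLp hm y) * (h x * h y)) atTop
      (𝓝 (‖h‖ ^ 2 - inner ℝ (T h) h)) := by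
    intro h
    simp only [← hquad]
    have h1 := hasSum_vertexLp hm h
    exact (h1.norm.pow 2).sub (((T.continuous.tendsto h).comp h1).inner h1)
  refine le_of_tendsto_of_tendsto ((hlim g).add_const _) (hlim f) ?_
  filter_upwards [eventually_ge_atTop (J.image Prod.fst ∪ J.image Prod.snd)] with K hK
  have hJK : J ⊆ K ×ˢ K := fun p hp => Finset.mem_product.2
    ⟨hK (Finset.mem_union_left _ (Finset.mem_image_of_mem _ hp)),
      hK (Finset.mem_union_right _ (Finset.mem_image_of_mem _ hp))⟩
  simp only [hg]
  exact sum_energy_le hτ hsymm (hκ K) hJK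
    (fun x => by simpa [h0] using abs_le_of_contraction hC (f x) 0)
    fun x y => abs_le_of_contraction hC _ _

/-- Normal contractions decrease a Dirichlet form at least by the decrease of its jump part. -/
lemma form_energy_le (hm : ∀ x, 0 < m {x} ∧ m {x} < ∞) {q : Lp ℝ 2 m → ℝ≥0∞}
    (hq : IsWideDirichletForm q) (hv : ∀ x, q (vertexLp hm x) < ∞) {C : ℝ → ℝ}
    (hC : LipschitzWith 1 C) (h0 : C 0 = 0) {f : Lp ℝ 2 m} (hf : q f < ∞)
    (J : Finset (X × X)) :
    (q (hC.compLp h0 f)).toReal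
      + 2⁻¹ * ∑ p ∈ J, -formBilin q (vertexLp hm p.1) (vertexLp hm p.2)
        * ((f p.1 - f p.2) ^ 2 - (C (f p.1) - C (f p.2)) ^ 2)
      ≤ (q f).toReal := by
  set t : ℕ → ℝ := fun n => 1 / ((n : ℝ) + 1)
  have ht : ∀ n, 0 < t n := fun n => by positivity
  have ht1 : ∀ n, t n ≤ 1 := fun n => by
    simp only [t]
    rw [div_le_one (by positivity)]
    linarith [n.cast_nonneg (α := ℝ)]
  have ht0 : Tendsto t atTop (𝓝 0) := tendsto_one_div_add_atTop_nhds_zero_nat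
  choose T hT using fun n => exists_isResolvent hq.isForm hq.closed (ht n)
  set g := hC.compLp h0 f
  have hg : q g < ∞ := (hq.markovian C hC h0 f).trans_lt hf
  have l1 := tendsto_approxForm_self hq.isForm hq.closed ht ht1 ht0 hT hf
  have l2 := tendsto_approxForm_self hq.isForm hq.closed ht ht1 ht0 hT hg
  have l3 := fun p : X × X =>
    tendsto_approxForm hq.isForm hq.closed ht ht1 ht0 hT (hv p.1) (hv p.2)
  refine le_of_tendsto_of_tendsto (l2.add ((tendsto_finsetSum J fun p _ =>
    ((l3 p).neg.mul_const _)).const_mul 2⁻¹)) l1 (Eventually.of_forall fun n => ?_)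
  have h1 := mul_le_mul_of_nonneg_left
    (resolvent_energy_le hm hq.isForm hq.markovian (ht n) (hT n) hC h0 f J) (inv_nonneg.2 (ht n).le)
  -- Off the diagonal ⟨1_x, 1_y⟩ = 0, so the negative of the approximating form is t⁻¹ times the
  -- kernel; on the diagonal the other factor is zero.
  have h2 : ∀ p : X × X, -approxForm (t n) (T n) (vertexLp hm p.1) (vertexLp hm p.2)
      * ((f p.1 - f p.2) ^ 2 - (C (f p.1) - C (f p.2)) ^ 2)
      = (t n)⁻¹ * (inner ℝ (T n (vertexLp hm p.1)) (vertexLp hm p.2)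
        * ((f p.1 - f p.2) ^ 2 - (C (f p.1) - C (f p.2)) ^ 2)) := by
    intro p
    by_cases hp : p.1 = p.2
    · simp [hp]
    · rw [approxForm, inner_vertexLp, coe_vertexLp, vertexFn_of_ne (Ne.symm hp)]
      ring
  simp only [h2, ← Finset.mul_sum]
  simp only [approxForm, real_inner_self_eq_norm_sq]
  refine le_trans (le_of_eq ?_) h1
  ring

end WeightedGraph
end

noncomputable section

/-! ### Constructions of forms -/

section Constructions

variable {H : Type*} [NormedAddCommGroup H] [InnerProductSpace ℝ H]

lemma formDiff_of_lt_top {p q : H → ℝ≥0∞} {f : H} (hf : p f < ∞) :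
    formDiff p q f = p f - q f := if_pos hf

lemma formDiff_of_not_lt_top {p q : H → ℝ≥0∞} {f : H} (hf : ¬p f < ∞) :
    formDiff p q f = ∞ := if_neg hf

/-- A form from a bilinear form defined by the polarization of other forms. -/
lemma IsForm.of_bilin {p q : H → ℝ≥0∞} (hp : IsForm p) (b : H → H → ℝ)
    (hadd : ∀ f g h, p f < ∞ → p g < ∞ → p h < ∞ → b (f + g) h = b f h + b g h)
    (hsmul : ∀ (r : ℝ) f h, p f < ∞ → p h < ∞ → b (r • f) h = r * b f h)
    (hsymm : ∀ f g, b f g = b g f) (hq : ∀ f, p f < ∞ → 0 ≤ b f f ∧ q f = ENNReal.ofReal (b f f))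
    (htop : ∀ f, ¬p f < ∞ → q f = ∞) : IsForm q := by
  obtain ⟨D, B, -, -, h3, -, -⟩ := hp.exists_bilin
  have hD : ∀ f : D, p f < ∞ := fun f => (h3 f).2 f.2
  refine ⟨D, LinearMap.mk₂ ℝ (fun f g : D => b f g) (fun f g h => hadd _ _ _ (hD f) (hD g) (hD h))
    (fun r f h => hsmul _ _ _ (hD f) (hD h)) (fun f g h => ?_) (fun r f g => ?_),
    fun f g => hsymm _ _, fun f => (hq _ (hD f)).1, fun f => (hq _ (hD f)).2,
    fun f hf => htop f fun h => hf ((h3 f).1 h)⟩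
  · rw [hsymm f, hsymm f, hsymm f]
    exact hadd _ _ _ (hD g) (hD h) (hD f)
  · rw [hsymm f, hsymm f]
    exact hsmul _ _ _ (hD g) (hD f)

lemma IsForm.formOne {q : H → ℝ≥0∞} (hq : IsForm q) : IsForm (formOne q) := by
  refine hq.of_bilin (fun f g => formBilin q f g + inner ℝ f g)
    (fun f g h hf hg hh => ?_) (fun r f h hf hh => ?_) (fun f g => ?_) (fun f hf => ?_)
    fun f hf => ?_
  · rw [hq.bilin_add_left hf hg hh, inner_add_left]
    ring
  · rw [hq.bilin_smul_left r hf hh, real_inner_smul_left]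
    ring
  · rw [formBilin_comm, real_inner_comm]
  · rw [hq.bilin_self hf, real_inner_self_eq_norm_sq, ← toReal_formOne hf,
      ENNReal.ofReal_toReal (formOne_lt_top_iff.2 hf).ne]
    exact ⟨ENNReal.toReal_nonneg, rfl⟩
  · rw [← formOne_lt_top_iff, not_lt, top_le_iff] at hf
    exact hf

lemma IsForm.formDiff {p q : H → ℝ≥0∞} (hp : IsForm p) (hq : IsForm q) (hle : q ≤ p) :
    IsForm (formDiff p q) := by
  refine hp.of_bilin (fun f g => formBilin p f g - formBilin q f g)
    (fun f g h hf hg hh => ?_) (fun r f h hf hh => ?_) (fun f g => ?_) (fun f hf => ?_)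
    fun f hf => formDiff_of_not_lt_top hf
  · rw [hp.bilin_add_left hf hg hh, hq.bilin_add_left ((hle f).trans_lt hf) ((hle g).trans_lt hg)
      ((hle h).trans_lt hh)]
    ring
  · rw [hp.bilin_smul_left r hf hh, hq.bilin_smul_left r ((hle f).trans_lt hf)
      ((hle h).trans_lt hh)]
    ring
  · rw [formBilin_comm, formBilin_comm (q := q)]
  · have hqf := (hle f).trans_lt hf
    rw [hp.bilin_self hf, hq.bilin_self hqf, formDiff_of_lt_top hf,
      ENNReal.ofReal_sub _ ENNReal.toReal_nonneg, ENNReal.ofReal_toReal hf.ne,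
      ENNReal.ofReal_toReal hqf.ne]
    exact ⟨sub_nonneg.2 (ENNReal.toReal_mono hf.ne (hle f)), rfl⟩

/-- Pullback of a form along a linear relation. -/
lemma IsForm.pullback {K : Type*} [NormedAddCommGroup K] [InnerProductSpace ℝ K] {q : H → ℝ≥0∞}
    (hq : IsForm q) {q' : K → ℝ≥0∞} (R : Submodule ℝ (K × H))
    (h0 : ∀ x ∈ R, x.1 = 0 → x.2 = 0) (h1 : ∀ x ∈ R, q x.2 < ∞ ∧ q' x.1 = q x.2)
    (h2 : ∀ φ, q' φ < ∞ → ∃ u, (φ, u) ∈ R) : IsForm q' := by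
  obtain ⟨D, B, hs, hn, h3, h4, -⟩ := hq.exists_bilin
  have hR : ∀ φ : R.map (LinearMap.fst ℝ K H), (φ.1, R.toLinearPMap φ) ∈ R :=
    Submodule.mem_graph_toLinearPMap h0
  let L : R.map (LinearMap.fst ℝ K H) →ₗ[ℝ] D :=
    LinearMap.codRestrict D R.toLinearPMap.toFun fun φ => (h3 _).1 (h1 _ (hR φ)).1
  refine ⟨R.map (LinearMap.fst ℝ K H), B.compl₁₂ L L, fun f g => hs _ _, fun f => hn _,
    fun f => ?_, fun f hf => ?_⟩
  · rw [(h1 _ (hR f)).2]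
    exact h4 (L f)
  · by_contra h5
    obtain ⟨u, hu⟩ := h2 f (lt_top_iff_ne_top.2 h5)
    exact hf ⟨(f, u), hu, rfl⟩

end Constructions

namespace WeightedGraph

variable {X : Type*} [MeasurableSpace X] {G : WeightedGraph X} {m : Measure X}
  [Countable X] [DiscreteMeasurableSpace X]

/-! ### The Neumann form -/

lemma toReal_neumannForm (hm : ∀ x, 0 < m {x} ∧ m {x} < ∞) {f : Lp ℝ 2 m}
    (hf : (f : X → ℝ) ∈ G.formDomain m) :
    (G.neumannForm m f).toReal = G.oneForm m f f - ‖f‖ ^ 2 := by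
  have h1 := toReal_formOne ((neumannForm_lt_top_iff hm).2 hf)
  rw [formOne_neumannForm hm hf, ENNReal.toReal_ofReal (oneForm_self_nonneg _)] at h1
  linarith

lemma bilin_neumannForm (hm : ∀ x, 0 < m {x} ∧ m {x} < ∞) {f g : Lp ℝ 2 m}
    (hf : (f : X → ℝ) ∈ G.formDomain m) (hg : (g : X → ℝ) ∈ G.formDomain m) :
    formBilin (G.neumannForm m) f g = G.oneForm m f g - inner ℝ f g := by
  have hfg : ((f + g : Lp ℝ 2 m) : X → ℝ) ∈ G.formDomain m := by
    rw [coe_add hm]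
    exact add_mem hf hg
  rw [formBilin, toReal_neumannForm hm hfg, toReal_neumannForm hm hf, toReal_neumannForm hm hg,
    coe_add hm, oneForm_add_left hf hg (add_mem hf hg), oneForm_add_right hf hg hf,
    oneForm_add_right hf hg hg, norm_add_sq_real, oneForm_comm (g : X → ℝ) f]
  ring

lemma isForm_neumannForm (hm : ∀ x, 0 < m {x} ∧ m {x} < ∞) : IsForm (G.neumannForm m) := by
  let D : Submodule ℝ (Lp ℝ 2 m) :=
    { carrier := {f | (f : X → ℝ) ∈ G.formDomain m}
      add_mem' := fun {f g} hf hg => by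
        change ((f + g : Lp ℝ 2 m) : X → ℝ) ∈ G.formDomain m
        rw [coe_add hm]
        exact add_mem hf hg
      zero_mem' := by
        change ((0 : Lp ℝ 2 m) : X → ℝ) ∈ G.formDomain m
        rw [coe_zero hm]
        exact zero_mem _
      smul_mem' := fun r f hf => by
        change ((r • f : Lp ℝ 2 m) : X → ℝ) ∈ G.formDomain m
        rw [coe_smul hm]
        exact Submodule.smul_mem _ _ hf }
  have hD : ∀ f : D, (f.1 : X → ℝ) ∈ G.formDomain m := fun f => f.2
  refine ⟨D, LinearMap.mk₂ ℝ (fun f g : D => G.oneForm m f.1 g.1 - inner ℝ f.1 g.1)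
    (fun f g h => ?_) (fun r f h => ?_) (fun f g h => ?_) (fun r f g => ?_), fun f g => ?_,
    fun f => ?_, fun f => ?_, fun f hf => ?_⟩
  · rw [Submodule.coe_add, coe_add hm, oneForm_add_left (hD f) (hD g) (hD h), inner_add_left]
    ring
  · rw [Submodule.coe_smul, coe_smul hm, oneForm_smul_left, real_inner_smul_left, smul_eq_mul]
    ring
  · rw [Submodule.coe_add, coe_add hm, oneForm_add_right (hD g) (hD h) (hD f), inner_add_right]
    ring
  · rw [Submodule.coe_smul, coe_smul hm, oneForm_smul_right, real_inner_smul_right, smul_eq_mul]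
    ring
  · change G.oneForm m f.1 g.1 - inner ℝ f.1 g.1 = G.oneForm m g.1 f.1 - inner ℝ g.1 f.1
    rw [oneForm_comm, real_inner_comm]
  · change 0 ≤ G.oneForm m f.1 f.1 - inner ℝ f.1 f.1
    rw [real_inner_self_eq_norm_sq, ← toReal_neumannForm hm (hD f)]
    exact ENNReal.toReal_nonneg
  · change _ = ENNReal.ofReal (G.oneForm m f.1 f.1 - inner ℝ f.1 f.1)
    rw [real_inner_self_eq_norm_sq, ← toReal_neumannForm hm (hD f),
      ENNReal.ofReal_toReal ((neumannForm_lt_top_iff hm).2 (hD f)).ne]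
  · by_contra h
    exact hf ((neumannForm_lt_top_iff hm).1 (lt_top_iff_ne_top.2 h))

/-! ### Forms between `Q⁽ᴺ⁾` and `Q⁽ᴰ⁾` -/

/-- `Q` is a form with `Q⁽ᴺ⁾ ≤ Q ≤ Q⁽ᴰ⁾`. -/
structure IsIntermediate (G : WeightedGraph X) (m : Measure X) (Q : Lp ℝ 2 m → ℝ≥0∞) : Prop where
  isForm : IsForm Q
  neumann_le : G.neumannForm m ≤ Q
  eq_neumann : ∀ f : Lp ℝ 2 m, (f : X → ℝ) ∈ G.dirichletSpace m → Q f = G.neumannForm m f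

lemma isIntermediate_of_le (hm : ∀ x, 0 < m {x} ∧ m {x} < ∞) {Q : Lp ℝ 2 m → ℝ≥0∞}
    (hQ : IsForm Q) (hN : G.neumannForm m ≤ Q) (hD : Q ≤ G.dirichletForm m) :
    G.IsIntermediate m Q :=
  ⟨hQ, hN, fun f hf => le_antisymm ((hD f).trans (dirichletForm_eq hm hf).le) (hN f)⟩

lemma isIntermediate_neumannForm (hm : ∀ x, 0 < m {x} ∧ m {x} < ∞) :
    G.IsIntermediate m (G.neumannForm m) := ⟨isForm_neumannForm hm, le_rfl, fun _ _ => rfl⟩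

/-- The difference `Q - Q⁽ᴺ⁾` on `D(Q)`. -/
def excess (G : WeightedGraph X) (m : Measure X) (Q : Lp ℝ 2 m → ℝ≥0∞) (f : Lp ℝ 2 m) : ℝ :=
  (Q f).toReal - (G.neumannForm m f).toReal

section Intermediate

variable {Q : Lp ℝ 2 m → ℝ≥0∞}

lemma IsIntermediate.mem (hm : ∀ x, 0 < m {x} ∧ m {x} < ∞) (hQ : G.IsIntermediate m Q)
    {f : Lp ℝ 2 m} (hf : Q f < ∞) : (f : X → ℝ) ∈ G.formDomain m :=
  (neumannForm_lt_top_iff hm).1 ((hQ.neumann_le f).trans_lt hf)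

lemma IsIntermediate.lt_top (hm : ∀ x, 0 < m {x} ∧ m {x} < ∞) (hQ : G.IsIntermediate m Q)
    {f : Lp ℝ 2 m} (hf : (f : X → ℝ) ∈ G.dirichletSpace m) : Q f < ∞ := by
  rw [hQ.eq_neumann f hf]
  exact (neumannForm_lt_top_iff hm).2 hf.1

/-- Q − Q⁽ᴺ⁾ is nonnegative and vanishes on D(Q⁽ᴰ⁾). At r g + f it is an affine function of r,
bounded below by zero, so its slope, twice the difference of the mixed terms, must vanish. -/
lemma IsIntermediate.bilin_eq (hm : ∀ x, 0 < m {x} ∧ m {x} < ∞) (hQ : G.IsIntermediate m Q)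
    {f g : Lp ℝ 2 m} (hf : Q f < ∞) (hg : (g : X → ℝ) ∈ G.dirichletSpace m) :
    formBilin Q f g = formBilin (G.neumannForm m) f g := by
  have hN := isForm_neumannForm (G := G) hm
  have hgQ := hQ.lt_top hm hg
  have hfN := (hQ.neumann_le f).trans_lt hf
  have hgN := (hQ.neumann_le g).trans_lt hgQ
  have key : ∀ r : ℝ, 0 ≤ G.excess m Q f
      + 2 * r * (formBilin Q g f - formBilin (G.neumannForm m) g f) := by
    intro r
    have h1 := hQ.isForm.smul_lt_top r hgQ
    have h2 : (G.neumannForm m (r • g + f)).toReal ≤ (Q (r • g + f)).toReal :=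
      ENNReal.toReal_mono (hQ.isForm.add_lt_top h1 hf).ne (hQ.neumann_le _)
    have h3 : Q (r • g) = G.neumannForm m (r • g) := hQ.eq_neumann _ (by
      rw [coe_smul hm]
      exact Submodule.smul_mem _ _ hg)
    rw [toReal_form_add, toReal_form_add, h3, hQ.isForm.bilin_smul_left r hgQ hf,
      hN.bilin_smul_left r hgN hfN] at h2
    rw [excess]
    linarith
  rw [formBilin_comm, formBilin_comm (q := G.neumannForm m)]
  by_contra hne
  have hd := sub_ne_zero.2 hne
  set d := formBilin Q g f - formBilin (G.neumannForm m) g f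
  -- This value of r would make the affine function equal to −1.
  have h4 := key (-(G.excess m Q f + 1) / (2 * d))
  have h5 : 2 * (-(G.excess m Q f + 1) / (2 * d)) * d = -(G.excess m Q f + 1) := by
    field_simp
  rw [h5] at h4
  linarith

/-- `Q - Q⁽ᴺ⁾` depends only on the boundary values. -/
lemma IsIntermediate.excess_eq (hm : ∀ x, 0 < m {x} ∧ m {x} < ∞) (hQ : G.IsIntermediate m Q)
    {f g : Lp ℝ 2 m} (hf : Q f < ∞) (h : (f - g : X → ℝ) ∈ G.dirichletSpace m) :
    Q g < ∞ ∧ G.excess m Q g = G.excess m Q f := by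
  rw [← coe_sub hm] at h
  have hd := hQ.lt_top hm h
  have hg : Q g < ∞ := by
    have h1 := hQ.isForm.sub_lt_top hf hd
    rwa [sub_sub_cancel] at h1
  refine ⟨hg, ?_⟩
  have h1 := hQ.isForm.toReal_sub hf hd
  have h2 := (isForm_neumannForm (G := G) hm).toReal_sub ((hQ.neumann_le f).trans_lt hf)
    ((hQ.neumann_le _).trans_lt hd)
  rw [sub_sub_cancel] at h1 h2
  rw [excess, excess, h1, h2, hQ.bilin_eq hm hf h, hQ.eq_neumann _ h]
  ring

/-- The `1`-harmonic part minimizes `Q₁`. -/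
lemma IsIntermediate.formOne_le (hm : ∀ x, 0 < m {x} ∧ m {x} < ∞) (hQ : G.IsIntermediate m Q)
    {f u : Lp ℝ 2 m} (hf : Q f < ∞) (hu : (u : X → ℝ) ∈ G.harmonicSpace m)
    (h : (f - u : X → ℝ) ∈ G.dirichletSpace m) : formOne Q u ≤ formOne Q f := by
  obtain ⟨huQ, he⟩ := hQ.excess_eq hm hf h
  rw [← ENNReal.toReal_le_toReal (formOne_lt_top_iff.2 huQ).ne (formOne_lt_top_iff.2 hf).ne,
    toReal_formOne huQ, toReal_formOne hf]
  have h1 := toReal_neumannForm hm (hQ.mem hm huQ)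
  have h2 := toReal_neumannForm hm (hQ.mem hm hf)
  have h3 : G.oneForm m u u ≤ G.oneForm m f f := by
    have h4 := oneForm_harmonicPart_le hm (hQ.mem hm hf)
    rwa [harmonicPart_unique hm (hQ.mem hm hf) hu h] at h4
  rw [excess, excess] at he
  linarith

lemma vertexLp_mem (hm : ∀ x, 0 < m {x} ∧ m {x} < ∞) (x : X) :
    (vertexLp hm x : X → ℝ) ∈ G.dirichletSpace m := by
  rw [coe_vertexLp]
  exact finite_support_mem_dirichletSpace hm (support_vertexFn x)

/-- On finitely supported functions `Q` agrees with Q⁽ᴺ⁾, so every intermediate form has the edge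
weights of the graph as jump weights. -/
lemma IsIntermediate.bilin_vertexLp (hm : ∀ x, 0 < m {x} ∧ m {x} < ∞)
    (hQ : G.IsIntermediate m Q) {x y : X} (hxy : x ≠ y) :
    -formBilin Q (vertexLp hm x) (vertexLp hm y) = G.b x y := by
  have h1 : (vertexLp hm x : X → ℝ) ∈ G.formDomain m := (vertexLp_mem hm x).1
  have h2 : (vertexLp hm y : X → ℝ) ∈ G.formDomain m := (vertexLp_mem hm y).1
  rw [hQ.bilin_eq hm (hQ.lt_top hm (vertexLp_mem hm x)) (vertexLp_mem hm y),
    bilin_neumannForm hm h1 h2, inner_vertexLp, coe_vertexLp, coe_vertexLp,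
    oneForm_vertexFn (vertexFn_mem hm x) (vertexFn_mem hm y), vertexFn_of_ne hxy.symm,
    tsum_eq_single x]
  · rw [vertexFn_self, G.b_symm y x]
    ring
  · intro z hz
    rw [vertexFn_of_ne hz]
    ring

lemma oneForm_eq_add (f : X → ℝ) (hf : f ∈ G.formDomain m) :
    G.oneForm m f f = ∑' p, G.coord m f (Sum.inl p) ^ 2 + ∑' x, G.coord m f (Sum.inr x) ^ 2 := by
  rw [oneForm_self, Summable.tsum_sum (hf.comp_injective Sum.inl_injective)
    (hf.comp_injective Sum.inr_injective)]

/-- Up to the contribution of the vertices, normal contractions decrease `Q - Q⁽ᴺ⁾`. -/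
lemma IsIntermediate.excess_compLp_le_add (hm : ∀ x, 0 < m {x} ∧ m {x} < ∞)
    (hQ : G.IsIntermediate m Q) (hQ' : IsWideDirichletForm Q) {C : ℝ → ℝ} (hC : LipschitzWith 1 C)
    (h0 : C 0 = 0) {f : Lp ℝ 2 m} (hf : Q f < ∞) :
    G.excess m Q (hC.compLp h0 f) ≤ G.excess m Q f + ∑' x, G.coord m f (Sum.inr x) ^ 2 := by
  set g := hC.compLp h0 f
  have hg : Q g < ∞ := (hQ'.markovian C hC h0 f).trans_lt hf
  have hgf : ∀ x, g x = C (f x) := congrFun (coe_compLp hm hC h0 f)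
  have hfD := hQ.mem hm hf
  have hgD := hQ.mem hm hg
  have hsf : Summable fun p : X × X => G.coord m f (Sum.inl p) ^ 2 :=
    hfD.comp_injective Sum.inl_injective
  have hsg : Summable fun p : X × X => G.coord m g (Sum.inl p) ^ 2 :=
    hgD.comp_injective Sum.inl_injective
  -- By `form_energy_le` the decrease of `Q` dominates every finite partial sum of the decrease of
  -- the edge energy, whose terms are nonnegative, hence also the full sum.
  have h1 : ∑' p : X × X, (G.coord m f (Sum.inl p) ^ 2 - G.coord m g (Sum.inl p) ^ 2)
      ≤ (Q f).toReal - (Q g).toReal := by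
    refine (hsf.sub hsg).tsum_le_of_sum_le fun J => ?_
    have h2 := form_energy_le hm hQ' (fun x => hQ.lt_top hm (vertexLp_mem hm x)) hC h0 hf J
    rw [Finset.mul_sum] at h2
    have h3 : ∀ p : X × X, G.coord m f (Sum.inl p) ^ 2 - G.coord m g (Sum.inl p) ^ 2
        = 2⁻¹ * (-formBilin Q (vertexLp hm p.1) (vertexLp hm p.2)
          * ((f p.1 - f p.2) ^ 2 - (C (f p.1) - C (f p.2)) ^ 2)) := by
      intro p
      rw [coord_inl_sq, coord_inl_sq, hgf, hgf]
      by_cases hp : p.1 = p.2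
      · simp [hp]
      · rw [hQ.bilin_vertexLp hm hp]
        ring
    rw [Finset.sum_congr rfl fun p _ => h3 p]
    linarith
  rw [hsf.tsum_sub hsg] at h1
  have h4 := oneForm_eq_add (f : X → ℝ) hfD
  have h5 := oneForm_eq_add (g : X → ℝ) hgD
  have h6 : 0 ≤ ∑' x, G.coord m g (Sum.inr x) ^ 2 := tsum_nonneg fun _ => sq_nonneg _
  have h7 : ‖g‖ ≤ ‖f‖ := by
    refine Lp.norm_le_norm_of_ae_le ((ae_iff_forall hm).2 fun x => ?_)
    rw [hgf]
    simpa [h0] using abs_le_of_contraction hC (f x) 0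
  have h8 : ‖g‖ ^ 2 ≤ ‖f‖ ^ 2 := by gcongr
  rw [excess, excess, toReal_neumannForm hm hfD, toReal_neumannForm hm hgD]
  linarith

/-- `Q - Q⁽ᴺ⁾` is Markovian on `D(Q)`. -/
lemma IsIntermediate.excess_compLp_le (hm : ∀ x, 0 < m {x} ∧ m {x} < ∞)
    (hQ : G.IsIntermediate m Q) (hQ' : IsWideDirichletForm Q) {C : ℝ → ℝ} (hC : LipschitzWith 1 C)
    (h0 : C 0 = 0) {f : Lp ℝ 2 m} (hf : Q f < ∞) :
    G.excess m Q (hC.compLp h0 f) ≤ G.excess m Q f := by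
  classical
  have hs : Summable fun x => G.coord m f (Sum.inr x) ^ 2 :=
    (hQ.mem hm hf).comp_injective Sum.inr_injective
  have key : ∀ F : Finset X, G.excess m Q (hC.compLp h0 f) ≤ G.excess m Q f
      + (∑' x, G.coord m f (Sum.inr x) ^ 2 - ∑ x ∈ F, G.coord m f (Sum.inr x) ^ 2) := by
    intro F
    -- Setting `f` to zero on `F` leaves the excess of `f` and of C ∘ f unchanged, since both change
    -- by finitely supported functions. The error for `u` is the sum over the complement of `F`.
    set u : Lp ℝ 2 m := f - ∑ x ∈ F, f x • vertexLp hm x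
    have hu : ∀ x, u x = if x ∈ F then 0 else f x := fun x => by
      rw [coe_sub hm, Pi.sub_apply, coe_sum_vertexLp]
      split_ifs <;> simp
    have h1 : (f - u : X → ℝ) ∈ G.dirichletSpace m := by
      refine finite_support_mem_dirichletSpace hm (F.finite_toSet.subset fun x hx => ?_)
      by_contra hxF
      have hxF' : x ∉ F := hxF
      exact hx (by simp [hu, hxF'])
    have h2 : ((hC.compLp h0 f : Lp ℝ 2 m) - (hC.compLp h0 u : Lp ℝ 2 m) : X → ℝ)
        ∈ G.dirichletSpace m := by
      refine finite_support_mem_dirichletSpace hm (F.finite_toSet.subset fun x hx => ?_)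
      by_contra hxF
      have hxF' : x ∉ F := hxF
      exact hx (by simp [coe_compLp hm, hu, hxF'])
    obtain ⟨h3, h4⟩ := hQ.excess_eq hm hf h1
    obtain ⟨-, h5⟩ := hQ.excess_eq hm ((hQ'.markovian C hC h0 f).trans_lt hf) h2
    have h6 := hQ.excess_compLp_le_add hm hQ' hC h0 h3
    rw [h4, h5] at h6
    refine h6.trans (add_le_add le_rfl (le_of_eq ?_))
    have hsu : Summable fun x => G.coord m u (Sum.inr x) ^ 2 :=
      (hQ.mem hm h3).comp_injective Sum.inr_injective
    rw [eq_sub_iff_add_eq, sum_eq_tsum_indicator (fun x => G.coord m f (Sum.inr x) ^ 2) F,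
      ← hsu.tsum_add (hs.indicator _)]
    refine tsum_congr fun x => ?_
    rw [coord_inr_sq, hu]
    by_cases hx : x ∈ F
    · simp [hx]
    · rw [if_neg hx, Set.indicator_of_notMem (by simpa using hx), add_zero, coord_inr_sq]
  have h7 : Tendsto (fun F : Finset X => G.excess m Q f
      + (∑' x, G.coord m f (Sum.inr x) ^ 2 - ∑ x ∈ F, G.coord m f (Sum.inr x) ^ 2)) atTop
      (𝓝 (G.excess m Q f)) := by
    have h8 := (hs.hasSum.const_sub (∑' x, G.coord m f (Sum.inr x) ^ 2)).const_add (G.excess m Q f)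
    rwa [sub_self, add_zero] at h8
  exact ge_of_tendsto h7 (Eventually.of_forall key)

lemma IsIntermediate.formDiff_eq (hQ : G.IsIntermediate m Q) {f : Lp ℝ 2 m} (hf : Q f < ∞) :
    formDiff Q (G.neumannForm m) f = ENNReal.ofReal (G.excess m Q f) := by
  rw [formDiff_of_lt_top hf, excess, ENNReal.ofReal_sub _ ENNReal.toReal_nonneg,
    ENNReal.ofReal_toReal hf.ne, ENNReal.ofReal_toReal ((hQ.neumann_le f).trans_lt hf).ne]

end Intermediate

end WeightedGraph
end

noncomputable section

namespace WeightedGraph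

variable {X : Type*} [MeasurableSpace X] {G : WeightedGraph X} {m : Measure X}
  [Countable X] [DiscreteMeasurableSpace X]

/-! ### Trace forms -/

section TraceForm

variable {o : X} {μ : Measure (G.HarmonicBoundary m)} {Q : Lp ℝ 2 m → ℝ≥0∞}

/-- `u ∈ D(Q)` is `1`-harmonic with trace `φ`. -/
def IsHarmonicFor (G : WeightedGraph X) (m : Measure X) (Q : Lp ℝ 2 m → ℝ≥0∞)
    (μ : Measure (G.HarmonicBoundary m)) (φ : Lp ℝ 2 μ) (u : Lp ℝ 2 m) : Prop :=
  (u : X → ℝ) ∈ G.harmonicSpace m ∧ Q u < ∞ ∧ G.IsTrace m μ u φ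

/-- Subtracting f − H(γf) ∈ D(Q⁽ᴰ⁾), where `Q` is finite, does not lead out of D(Q) and does not
change the trace. -/
lemma IsIntermediate.isHarmonicFor_harmonicExtension (hG : G.Connected)
    (hm : ∀ x, 0 < m {x} ∧ m {x} < ∞) (hμ : G.IsHarmonicMeasure m o μ)
    (hQ : G.IsIntermediate m Q) {f : Lp ℝ 2 m} {φ : Lp ℝ 2 μ} (hf : Q f < ∞)
    (h : G.IsTrace m μ f φ) :
    G.IsHarmonicFor m Q μ φ (G.harmonicExtension m (G.trace m f)) ∧
      (f - G.harmonicExtension m (G.trace m f) : X → ℝ) ∈ G.dirichletSpace m := by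
  have hfD := hQ.mem hm hf
  obtain ⟨h1, h2⟩ := harmonicPart_spec hm hfD
  rw [← coe_harmonicExtension hG hm hμ hfD] at h1 h2
  exact ⟨⟨h1, (hQ.excess_eq hm hf h2).1, isTrace_of_sub_mem hm hfD h2 h⟩, h2⟩

lemma IsHarmonicFor.unique (hG : G.Connected)
    (hm : ∀ x, 0 < m {x} ∧ m {x} < ∞) (hμ : G.IsHarmonicMeasure m o μ) {φ : Lp ℝ 2 μ}
    {u v : Lp ℝ 2 m} {Q' : Lp ℝ 2 m → ℝ≥0∞} (hu : G.IsHarmonicFor m Q μ φ u)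
    (hv : G.IsHarmonicFor m Q' μ φ v) : u = v :=
  coe_injective hm (eq_of_sub_mem_dirichletSpace hm hu.1 hv.1
    (sub_mem_dirichletSpace_of_isTrace hG hm hμ hu.1.1 hv.1.1 hu.2.2 hv.2.2))

lemma exists_of_traceForm_lt_top {φ : Lp ℝ 2 μ} (h : G.traceForm m μ Q φ < ∞) :
    ∃ f : Lp ℝ 2 m, Q f < ∞ ∧ G.IsTrace m μ f φ := by
  by_contra hcon
  rw [traceForm, dif_neg hcon] at h
  exact lt_irrefl _ h

lemma IsIntermediate.exists_isHarmonicFor (hG : G.Connected)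
    (hm : ∀ x, 0 < m {x} ∧ m {x} < ∞) (hμ : G.IsHarmonicMeasure m o μ)
    (hQ : G.IsIntermediate m Q) {φ : Lp ℝ 2 μ} (h : G.traceForm m μ Q φ < ∞) :
    ∃ u, G.IsHarmonicFor m Q μ φ u := by
  obtain ⟨f, hf, hφ⟩ := exists_of_traceForm_lt_top h
  exact ⟨_, (hQ.isHarmonicFor_harmonicExtension hG hm hμ hf hφ).1⟩

/-- The function chosen in `traceForm` is irrelevant, because a 1-harmonic function is determined by
the almost everywhere class of its trace. -/
lemma IsIntermediate.traceForm_eq (hG : G.Connected)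
    (hm : ∀ x, 0 < m {x} ∧ m {x} < ∞) (hμ : G.IsHarmonicMeasure m o μ)
    (hQ : G.IsIntermediate m Q) {φ : Lp ℝ 2 μ} {u : Lp ℝ 2 m} (hu : G.IsHarmonicFor m Q μ φ u) :
    G.traceForm m μ Q φ = formOne Q u := by
  have hex : ∃ f : Lp ℝ 2 m, Q f < ∞ ∧ G.IsTrace m μ f φ := ⟨u, hu.2⟩
  rw [traceForm, dif_pos hex]
  obtain ⟨h1, h2⟩ := hex.choose_spec
  rw [(hQ.isHarmonicFor_harmonicExtension hG hm hμ h1 h2).1.unique hG hm hμ hu]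

/-- The linear relation between functions on the boundary and `1`-harmonic functions in `D(Q)`. -/
def IsIntermediate.relation (hm : ∀ x, 0 < m {x} ∧ m {x} < ∞) (hQ : G.IsIntermediate m Q)
    (μ : Measure (G.HarmonicBoundary m)) : Submodule ℝ (Lp ℝ 2 μ × Lp ℝ 2 m) where
  carrier := {x | G.IsHarmonicFor m Q μ x.1 x.2}
  add_mem' {x y} hx hy := by
    refine ⟨?_, hQ.isForm.add_lt_top hx.2.1 hy.2.1, isTrace_add hm hx.1.1 hy.1.1 hx.2.2 hy.2.2⟩
    rw [Prod.snd_add, coe_add hm]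
    exact add_mem_harmonicSpace hm hx.1 hy.1
  zero_mem' := by
    refine ⟨?_, by rw [Prod.snd_zero, hQ.isForm.map_zero]; exact ENNReal.zero_lt_top, ?_⟩
    · rw [Prod.snd_zero, coe_zero hm]
      exact ⟨zero_mem _, fun x => oneForm_zero_left _⟩
    · rw [Prod.snd_zero, Prod.fst_zero, isTrace_iff hm (by rw [coe_zero hm]; exact zero_mem _)]
      filter_upwards [Lp.coeFn_zero ℝ 2 μ] with z hz
      rw [hz, coe_zero hm]
      exact tendsto_const_nhds
  smul_mem' r x hx := by
    refine ⟨?_, hQ.isForm.smul_lt_top r hx.2.1, isTrace_smul hm r hx.1.1 hx.2.2⟩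
    rw [Prod.smul_snd, coe_smul hm]
    exact smul_mem_harmonicSpace r hx.1

lemma IsIntermediate.relation_eq_zero (hG : G.Connected) (hm : ∀ x, 0 < m {x} ∧ m {x} < ∞)
    (hμ : G.IsHarmonicMeasure m o μ) (hQ : G.IsIntermediate m Q) :
    ∀ x ∈ hQ.relation hm μ, x.1 = 0 → x.2 = 0 := fun x hx h0 => by
  have h1 : G.IsHarmonicFor m Q μ 0 0 := (hQ.relation hm μ).zero_mem
  have h2 : G.IsHarmonicFor m Q μ x.1 x.2 := hx
  rw [h0] at h2
  exact h2.unique hG hm hμ h1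

/-- The trace form is the pullback of Q₁ along the linear relation φ ↦ Hφ, which is single-valued by
`IsIntermediate.relation_eq_zero`. -/
lemma IsIntermediate.isForm_traceForm (hG : G.Connected) (hm : ∀ x, 0 < m {x} ∧ m {x} < ∞)
    (hμ : G.IsHarmonicMeasure m o μ) (hQ : G.IsIntermediate m Q) :
    IsForm (G.traceForm m μ Q) :=
  hQ.isForm.formOne.pullback (hQ.relation hm μ) (hQ.relation_eq_zero hG hm hμ)
    (fun _ hx => ⟨formOne_lt_top_iff.2 hx.2.1, hQ.traceForm_eq hG hm hμ hx⟩)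
    fun _ h => hQ.exists_isHarmonicFor hG hm hμ h

lemma IsIntermediate.exists_isHarmonicFor_compLp (hG : G.Connected)
    (hm : ∀ x, 0 < m {x} ∧ m {x} < ∞) (hμ : G.IsHarmonicMeasure m o μ)
    (hQ : G.IsIntermediate m Q) (hM : IsMarkovian Q) {C : ℝ → ℝ} (hC : LipschitzWith 1 C)
    (h0 : C 0 = 0) {φ : Lp ℝ 2 μ} {u : Lp ℝ 2 m} (hu : G.IsHarmonicFor m Q μ φ u) :
    ∃ v, G.IsHarmonicFor m Q μ (hC.compLp h0 φ) v ∧ Q (hC.compLp h0 u) < ∞ ∧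
      ((hC.compLp h0 u : Lp ℝ 2 m) - v : X → ℝ) ∈ G.dirichletSpace m := by
  have h1 : Q (hC.compLp h0 u) < ∞ := (hM C hC h0 u).trans_lt hu.2.1
  obtain ⟨h2, h3⟩ := hQ.isHarmonicFor_harmonicExtension hG hm hμ h1
    (isTrace_compLp hm hC h0 hu.1.1 hu.2.2)
  exact ⟨_, h2, h1, h3⟩

lemma norm_compLp_le {C : ℝ → ℝ} (hC : LipschitzWith 1 C) (h0 : C 0 = 0) (f : Lp ℝ 2 m) :
    ‖hC.compLp h0 f‖ ≤ ‖f‖ := by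
  refine Lp.norm_le_norm_of_ae_le ?_
  filter_upwards [hC.coeFn_compLp h0 f] with x hx
  rw [hx]
  simpa [h0] using abs_le_of_contraction hC (f x) 0

/-- The contraction of the extension, C ∘ Hφ, has trace C ∘ φ and therefore competes with H(C ∘ φ),
which minimizes Q₁. -/
lemma IsIntermediate.isMarkovian_traceForm (hG : G.Connected)
    (hm : ∀ x, 0 < m {x} ∧ m {x} < ∞) (hμ : G.IsHarmonicMeasure m o μ)
    (hQ : G.IsIntermediate m Q) (hM : IsMarkovian Q) : IsMarkovian (G.traceForm m μ Q) := by
  intro C hC h0 φ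
  by_cases hφ : G.traceForm m μ Q φ < ∞
  · obtain ⟨u, hu⟩ := hQ.exists_isHarmonicFor hG hm hμ hφ
    obtain ⟨v, hv, h1, h2⟩ := hQ.exists_isHarmonicFor_compLp hG hm hμ hM hC h0 hu
    rw [hQ.traceForm_eq hG hm hμ hu, hQ.traceForm_eq hG hm hμ hv]
    refine (hQ.formOne_le hm h1 hv.1 h2).trans (add_le_add (hM C hC h0 u) ?_)
    gcongr
    exact enorm_le_iff_norm_le.2 (norm_compLp_le hC h0 u)
  · rw [not_lt, top_le_iff] at hφ
    rw [hφ]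
    exact le_top

/-- The harmonic extensions of a Cauchy sequence are Cauchy for Q₁. Their limit exists because `Q`
is closed, is 1-harmonic because orthogonality is a closed condition, and its trace is the L² limit
by `exists_trace_bound`. -/
lemma IsIntermediate.isClosedForm_traceForm (hG : G.Connected)
    (hm : ∀ x, 0 < m {x} ∧ m {x} < ∞) (hμ : G.IsHarmonicMeasure m o μ)
    (hQ : G.IsIntermediate m Q) (hc : IsClosedForm Q) : IsClosedForm (G.traceForm m μ Q) := by
  intro φ hφ hcau
  choose u hu using fun n => hQ.exists_isHarmonicFor hG hm hμ (hφ n)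
  have hsub : ∀ {ψ χ : Lp ℝ 2 μ} {v w : Lp ℝ 2 m}, G.IsHarmonicFor m Q μ ψ v →
      G.IsHarmonicFor m Q μ χ w → G.traceForm m μ Q (ψ - χ) = formOne Q (v - w) := by
    intro ψ χ v w hv hw
    have h1 : (ψ, v) ∈ hQ.relation hm μ := hv
    have h2 : (χ, w) ∈ hQ.relation hm μ := hw
    exact hQ.traceForm_eq hG hm hμ (sub_mem h1 h2 : (ψ, v) - (χ, w) ∈ hQ.relation hm μ)
  obtain ⟨v, hv, hlim⟩ := hc u (fun n => (hu n).2.1) fun ε hε => by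
    obtain ⟨N, hN⟩ := hcau ε hε
    refine ⟨N, fun k hk n hn => lt_of_le_of_lt ?_ (hN k hk n hn)⟩
    rw [← hsub (hu k) (hu n)]
    exact le_self_add
  have hvD := hQ.mem hm hv
  have hdD : ∀ n, (u n - v : X → ℝ) ∈ G.formDomain m := fun n => sub_mem (hu n).1.1 hvD
  have hE : Tendsto (fun n => G.oneForm m (u n - v) (u n - v)) atTop (𝓝 0) := by
    have h1 := (ENNReal.tendsto_toReal ENNReal.zero_ne_top).comp hlim
    refine squeeze_zero (fun n => oneForm_self_nonneg _) (fun n => ?_) h1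
    have hd : Q (u n - v) < ∞ := hQ.isForm.sub_lt_top (hu n).2.1 hv
    have h2 := ENNReal.toReal_mono hd.ne (hQ.neumann_le (u n - v))
    rw [toReal_neumannForm hm (by rw [coe_sub hm]; exact hdD n), coe_sub hm] at h2
    rw [Function.comp_apply, toReal_formOne hd]
    linarith
  have hvh : (v : X → ℝ) ∈ G.harmonicSpace m := by
    refine ⟨hvD, fun x => ?_⟩
    have hx := vertexFn_mem (G := G) hm x
    have h1 : ∀ n, |G.oneForm m v (vertexFn x)| ≤ √(G.oneForm m (u n - v) (u n - v))
        * √(G.oneForm m (vertexFn x) (vertexFn x)) := fun n => by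
      have h2 := abs_oneForm_le (hdD n) hx
      rwa [oneForm_sub_left (hu n).1.1 hvD hx, (hu n).1.2 x, zero_sub, abs_neg] at h2
    have h3 := ge_of_tendsto (hE.sqrt.mul_const √(G.oneForm m (vertexFn x) (vertexFn x)))
      (Eventually.of_forall h1)
    rw [Real.sqrt_zero, zero_mul] at h3
    exact abs_eq_zero.1 (le_antisymm h3 (abs_nonneg _))
  obtain ⟨K, hK0, hK⟩ := exists_trace_bound hm hμ
  obtain ⟨ψ, hψ, -⟩ := hK v hvD
  have hvψ : G.IsHarmonicFor m Q μ ψ v := ⟨hvh, hv, hψ⟩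
  refine ⟨ψ, ?_, ?_⟩
  · rw [hQ.traceForm_eq hG hm hμ hvψ]
    exact formOne_lt_top_iff.2 hv
  · have hn : Tendsto (fun n => ‖φ n - ψ‖ₑ ^ 2) atTop (𝓝 0) := by
      have h1 : Tendsto (fun n => ENNReal.ofReal (K * G.oneForm m (u n - v) (u n - v))) atTop
          (𝓝 0) := by
        simpa using ENNReal.tendsto_ofReal (hE.const_mul K)
      refine tendsto_of_tendsto_of_tendsto_of_le_of_le tendsto_const_nhds h1
        (fun n => zero_le) fun n => ?_
      have hd : ((u n - v : Lp ℝ 2 m) : X → ℝ) ∈ G.formDomain m := by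
        rw [coe_sub hm]; exact hdD n
      obtain ⟨χ, hχ, hb⟩ := hK (u n - v) hd
      rw [isTrace_unique hχ (isTrace_sub hm (hu n).1.1 hvD (hu n).2.2 hψ), coe_sub hm] at hb
      rw [← ofReal_norm, ← ENNReal.ofReal_pow (norm_nonneg _)]
      exact ENNReal.ofReal_le_ofReal hb
    have h2 : ∀ n, formOne (G.traceForm m μ Q) (φ n - ψ)
        = formOne Q (u n - v) + ‖φ n - ψ‖ₑ ^ 2 := fun n => by
      rw [formOne, hsub (hu n) hvψ]
    simp only [h2]
    simpa using hlim.add hn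

lemma IsHarmonicFor.neumann (hQ : G.IsIntermediate m Q) {φ : Lp ℝ 2 μ} {u : Lp ℝ 2 m}
    (hu : G.IsHarmonicFor m Q μ φ u) : G.IsHarmonicFor m (G.neumannForm m) μ φ u :=
  ⟨hu.1, (hQ.neumann_le u).trans_lt hu.2.1, hu.2.2⟩

lemma IsIntermediate.dirichletToNeumann_le (hG : G.Connected)
    (hm : ∀ x, 0 < m {x} ∧ m {x} < ∞) (hμ : G.IsHarmonicMeasure m o μ)
    (hQ : G.IsIntermediate m Q) : G.dirichletToNeumann m μ ≤ G.traceForm m μ Q := by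
  intro φ
  by_cases hφ : G.traceForm m μ Q φ < ∞
  · obtain ⟨u, hu⟩ := hQ.exists_isHarmonicFor hG hm hμ hφ
    rw [dirichletToNeumann, hQ.traceForm_eq hG hm hμ hu,
      (isIntermediate_neumannForm hm).traceForm_eq hG hm hμ (hu.neumann hQ)]
    exact add_le_add (hQ.neumann_le u) le_rfl
  · rw [not_lt, top_le_iff] at hφ
    rw [hφ]
    exact le_top

/-- Both trace forms are evaluated at the same 1-harmonic function, so the norm terms in Q₁ and
Q⁽ᴺ⁾₁ cancel. -/
lemma IsIntermediate.formDiff_traceForm_eq (hG : G.Connected)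
    (hm : ∀ x, 0 < m {x} ∧ m {x} < ∞) (hμ : G.IsHarmonicMeasure m o μ)
    (hQ : G.IsIntermediate m Q) {φ : Lp ℝ 2 μ} {u : Lp ℝ 2 m} (hu : G.IsHarmonicFor m Q μ φ u) :
    formDiff (G.traceForm m μ Q) (G.dirichletToNeumann m μ) φ
      = ENNReal.ofReal (G.excess m Q u) := by
  have h1 : G.traceForm m μ Q φ < ∞ := by
    rw [hQ.traceForm_eq hG hm hμ hu]
    exact formOne_lt_top_iff.2 hu.2.1
  rw [← hQ.formDiff_eq hu.2.1, formDiff_of_lt_top h1, formDiff_of_lt_top hu.2.1,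
    dirichletToNeumann, hQ.traceForm_eq hG hm hμ hu,
    (isIntermediate_neumannForm hm).traceForm_eq hG hm hμ (hu.neumann hQ), formOne, formOne,
    ENNReal.add_sub_add_eq_sub_right (ENNReal.pow_lt_top enorm_lt_top).ne]

/-- The excess depends only on boundary values, so H(C ∘ φ) may be replaced by C ∘ Hφ, to which
`IsIntermediate.excess_compLp_le` applies. -/
lemma IsIntermediate.isMarkovian_formDiff (hG : G.Connected)
    (hm : ∀ x, 0 < m {x} ∧ m {x} < ∞) (hμ : G.IsHarmonicMeasure m o μ)
    (hQ : G.IsIntermediate m Q) (hQ' : IsWideDirichletForm Q) :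
    IsMarkovian (formDiff (G.traceForm m μ Q) (G.dirichletToNeumann m μ)) := by
  intro C hC h0 φ
  by_cases hφ : G.traceForm m μ Q φ < ∞
  · obtain ⟨u, hu⟩ := hQ.exists_isHarmonicFor hG hm hμ hφ
    obtain ⟨v, hv, h1, h2⟩ := hQ.exists_isHarmonicFor_compLp hG hm hμ hQ'.markovian hC h0 hu
    rw [hQ.formDiff_traceForm_eq hG hm hμ hu, hQ.formDiff_traceForm_eq hG hm hμ hv,
      (hQ.excess_eq hm h1 h2).2]
    exact ENNReal.ofReal_le_ofReal (hQ.excess_compLp_le hm hQ' hC h0 hu.2.1)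
  · rw [formDiff_of_not_lt_top hφ]
    exact le_top

/-- If the trace of `f` is also the trace of a 1-harmonic u ∈ D(Q), then f − u ∈ D(Q⁽ᴰ⁾), where `Q`
is finite. -/
lemma IsIntermediate.domain_eq (hG : G.Connected)
    (hm : ∀ x, 0 < m {x} ∧ m {x} < ∞) (hμ : G.IsHarmonicMeasure m o μ)
    (hQ : G.IsIntermediate m Q) :
    {f : Lp ℝ 2 m | Q f < ∞} =
      {f | G.neumannForm m f < ∞ ∧ ∃ φ, G.IsTrace m μ f φ ∧ G.traceForm m μ Q φ < ∞} := by
  ext f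
  constructor
  · intro hf
    have hf' : Q f < ∞ := hf
    obtain ⟨K, -, hK⟩ := exists_trace_bound hm hμ
    obtain ⟨φ, hφ, -⟩ := hK f (hQ.mem hm hf')
    refine ⟨(hQ.neumann_le f).trans_lt hf', φ, hφ, ?_⟩
    have h1 := (hQ.isHarmonicFor_harmonicExtension hG hm hμ hf' hφ).1
    rw [hQ.traceForm_eq hG hm hμ h1]
    exact formOne_lt_top_iff.2 h1.2.1
  · rintro ⟨hf, φ, hφ, hlt⟩
    obtain ⟨u, hu⟩ := hQ.exists_isHarmonicFor hG hm hμ hlt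
    exact (hQ.excess_eq hm hu.2.1 (sub_mem_dirichletSpace_of_isTrace hG hm hμ hu.1.1
      ((neumannForm_lt_top_iff hm).1 hf) hu.2.2 hφ)).1

end TraceForm

end WeightedGraph
end

/-! ### The main theorem -/

theorem mainTheorem7 {X : Type*} [Countable X] [MeasurableSpace X] [DiscreteMeasurableSpace X]
    (G : WeightedGraph X) (hG : G.Connected)
    (m : Measure X) (hm : ∀ x, 0 < m {x} ∧ m {x} < ∞) (o : X)
    (μ : Measure (G.HarmonicBoundary m)) (hμ : μ = G.harmonicMeasure m o)
    (Q : Lp ℝ 2 m → ℝ≥0∞) (hQ : IsDirichletForm Q)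
    (hN : G.neumannForm m ≤ Q) (hD : Q ≤ G.dirichletForm m) :
    -- the objects are well defined
    (G.IsHarmonicMeasure m o μ ∧
      (∀ f, G.neumannForm m f < ∞ →
        (∃ φ, G.IsTrace m μ f φ) ∧ ∃! u, G.IsHarmonicExtension m (G.trace m f) u) ∧
      ∀ f φ, Q f < ∞ → G.IsTrace m μ f φ →
        Q (G.harmonicExtension m (G.trace m f)) < ∞ ∧
        G.traceForm m μ Q φ = formOne Q (G.harmonicExtension m (G.trace m f))) ∧
    -- the trace form is a Dirichlet form in the wide sense
    IsWideDirichletForm (G.traceForm m μ Q) ∧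
    -- its difference with the Dirichlet-to-Neumann form is a Markovian form
    (G.dirichletToNeumann m μ ≤ G.traceForm m μ Q ∧
      IsForm (formDiff (G.traceForm m μ Q) (G.dirichletToNeumann m μ)) ∧
      IsMarkovian (formDiff (G.traceForm m μ Q) (G.dirichletToNeumann m μ))) ∧
    -- the domain of `Q` is determined by the domain of its trace form
    {f : Lp ℝ 2 m | Q f < ∞} =
      {f | G.neumannForm m f < ∞ ∧ ∃ φ, G.IsTrace m μ f φ ∧ G.traceForm m μ Q φ < ∞} := by
  have hμ' : G.IsHarmonicMeasure m o μ := by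
    rw [hμ]
    exact WeightedGraph.isHarmonicMeasure_harmonicMeasure hm o
  have hI := WeightedGraph.isIntermediate_of_le hm hQ.isForm hN hD
  refine ⟨⟨hμ', fun f hf => ?_, fun f φ hf hφ => ?_⟩,
    ⟨hI.isForm_traceForm hG hm hμ', hI.isClosedForm_traceForm hG hm hμ' hQ.closed,
      hI.isMarkovian_traceForm hG hm hμ' hQ.markovian⟩,
    ⟨hI.dirichletToNeumann_le hG hm hμ',
      (hI.isForm_traceForm hG hm hμ').formDiff
        ((WeightedGraph.isIntermediate_neumannForm hm).isForm_traceForm hG hm hμ')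
        (hI.dirichletToNeumann_le hG hm hμ'),
      hI.isMarkovian_formDiff hG hm hμ' hQ.toIsWideDirichletForm⟩,
    hI.domain_eq hG hm hμ'⟩
  · have hfD := (WeightedGraph.neumannForm_lt_top_iff hm).1 hf
    obtain ⟨K, -, hK⟩ := WeightedGraph.exists_trace_bound hm hμ'
    obtain ⟨φ, hφ, -⟩ := hK f hfD
    exact ⟨⟨φ, hφ⟩, _, WeightedGraph.isHarmonicExtension_harmonicExtension hm hfD,
      fun u hu => WeightedGraph.isHarmonicExtension_unique hG hm hμ' hu
        (WeightedGraph.isHarmonicExtension_harmonicExtension hm hfD)⟩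
  · have h := (hI.isHarmonicFor_harmonicExtension hG hm hμ' hf hφ).1
    exact ⟨h.2.1, hI.traceForm_eq hG hm hμ' h⟩
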